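/- Let $N\ge 1$, let $(x_n,y_n)$, $n=1,\dots,N$, be data with $x_n\in\mathbb R^{d_{\mathrm x}}$, $y_n\in\{\pm1\}$, and let $\Phi(\theta;x)\in\mathbb R$ be the output of a network with parameter $\theta\in\mathbb R^d$ on input $x\in\mathbb R^{d_{\mathrm x}}$; write $\Phi_x(\theta):=\Phi(\theta;x)$, $q_n(\theta):=y_n\Phi(\theta;x_n)$, and $\|\cdot\|$ for the Euclidean norm (and the induced operator norm of matrices). The training loss is the one of the exponential loss, (A3): $\mathcal L(\theta):=\sum_{n=1}^N e^{-q_n(\theta)}$. For $f:\mathbb R^d\to\mathbb R$ let $$\partial^\circ f(\theta):=\operatorname{conv}\{\lim_k\nabla f(\theta_k):\theta_k\to\theta,\ f\text{ differentiable at }\theta_k\}$$ be Clarke's subdifferential. An *arc* is a map $z:[0,\infty)\to\mathbb R^d$ that is absolutely continuous on compact intervals. A locally Lipschitz $f$ *admits a chain rule* if for every arc $z$ and almost every $t>0$: $(f\circ z)'(t)=\langle h,z'(t)\rangle$ for all $h\in\partial^\circ f(z(t))$. *Gradient flow* is an arc $\theta$ with $\theta'(t)\in-\partial^\circ\mathcal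 L(\theta(t))$ for a.e. $t\ge0$; *gradient descent* is $\theta(t+1)=\theta(t)-\eta(t)\nabla\mathcal L(\theta(t))$, $t=0,1,2,\dots$, with learning rates $\eta(t)\ge 0$. Consider the following assumptions. - (A1) For every $x$, $\Phi_x$ is locally Lipschitz and admits a chain rule. - (S1) For every $x$, $\Phi_x$ is $\mathcal C^2$ on $\mathbb R^d\setminus\{0\}$. - (A2) There is $L>0$ with $\Phi(\alpha\theta;x)=\alpha^L\Phi(\theta;x)$ for all $\alpha>0$, $\theta$, $x$. - (A4) There is a time $t_0\ge 0$ (an integer for gradient descent) with $\mathcal L(\theta(t_0))<1$. - (S5) $\sum_{t\ge0}\eta(t)=+\infty$ and $\eta(t)\le H(\mathcal L(\theta(t)))$ for all $t\ge t_0$. Here $H(x):=\frac{\mu(x)}{C_\eta\,\kappa(x)}$ is given, with $x_0:=\mathcal L(\theta(t_0))$ and $\rho_0:=\|\theta(t_0)\|$, by the following formulas: - $\lambda(x):=\frac1{\log(1/x)}$ and $\mu(x):=\frac{\log(1/x_0)}{2\log(1/x)}$; - $\kappa(x):=x(\log\frac1x)^{2-2/L}$ if $L\le1$ or $x\le e^{2/L-2}$,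 and $\kappa(x):=e^{(2-2/L)(\log(2-2/L)-1)}$ otherwise; - $C_\eta:=\frac12\big(B_1^2+\rho_0^{-L}B_2\big)\max\{\hat\gamma_0^{-2+2/L},B_0^{-2+2/L}\}$, where $B_0,B_1,B_2$ are the suprema of $q_n(\theta)$, $\|\nabla q_n(\theta)\|$, $\|\nabla^2q_n(\theta)\|$ over $\|\theta\|=1$ and $1\le n\le N$; - $\hat\gamma_0:=e^{\phi(x_0)}/\rho_0^L$, where $\phi(x):=\log\log\frac1x+\int_0^x\big(\phi'(w)+\frac1{w\log(1/w)}\big)dw$ and $\phi'(x):=-\sup\Big\{\frac{1+2(1+\lambda(w)/L)\mu(w)}{w\log(1/w)}:w\in[x,x_0]\Big\}$. Assume (A2), (A3), (A4), and let $\bar\theta$ be any limit point of $\theta(t)/\|\theta(t)\|$ as $t\to\infty$ (i.e. a limit along some times $t_m\to\infty$). 1. Assume (S1). Then for gradient flow, and also for gradient descent under (S5), $\bar\theta$ is along the max-margin direction of the hard-margin SVM with kernel $K_{\bar\theta}(x,x')=\langle\nabla\Phi_x(\bar\theta),\nabla\Phi_{x'}(\bar\theta)\rangle$. That is, for some $\alpha>0$,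 $\alpha\bar\theta$ is the (unique) optimal solution of $$\min_{\theta\in\mathbb R^d}\ \tfrac12\|\theta\|^2\quad\text{s.t.}\quad y_n\langle\theta,\nabla\Phi_{x_n}(\bar\theta)\rangle\ge1\quad\text{for all }n=1,\dots,N.$$ 2. Assume (A1) instead of (S1). Then for gradient flow there is a map $h:\mathbb R^{d_{\mathrm x}}\to\mathbb R^d$ with $h(x)\in\partial^\circ\Phi_x(\bar\theta)$ for all $x$ such that the same conclusion holds for the kernel $K_{\bar\theta}(x,x')=\langle h(x),h(x')\rangle$: for some $\alpha>0$, $\alpha\bar\theta$ is the (unique) optimal solution of the same problem with $\nabla\Phi_{x_n}(\bar\theta)$ replaced by $h(x_n)$. -/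

import Mathlib

open Filter Topology MeasureTheory
open scoped Gradient

noncomputable section

namespace HomNet

/-- Euclidean space of dimension `d` (with the `L²`-norm). -/
abbrev Euc (d : ℕ) : Type := EuclideanSpace ℝ (Fin d)

section Nonsmooth

variable {d : ℕ}

/-- Clarke's subdifferential: the convex hull of all limits of gradients `∇ f (u k)` along
sequences `u k → x` of points at which `f` is differentiable. -/
def clarkeSubdiff (f : Euc d → ℝ) (x : Euc d) : Set (Euc d) :=
  convexHull ℝ {g | ∃ u : ℕ → Euc d, Tendsto u atTop (𝓝 x) ∧
    (∀ k, DifferentiableAt ℝ f (u k)) ∧ Tendsto (fun k => ∇ f (u k)) atTop (𝓝 g)}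

/-- An arc on `[0, ∞)`: absolutely continuous on every compact subinterval. (The values at
negative times are irrelevant.) -/
def IsArc (z : ℝ → Euc d) : Prop :=
  ∀ a b : ℝ, 0 ≤ a → a ≤ b → AbsolutelyContinuousOnInterval z a b

/-- `f` is locally Lipschitz and admits a chain rule along every arc. -/
def AdmitsChainRule (f : Euc d → ℝ) : Prop :=
  LocallyLipschitz f ∧ ∀ z : ℝ → Euc d, IsArc z →
    ∀ᵐ t : ℝ, 0 < t → ∀ h ∈ clarkeSubdiff f (z t),
      HasDerivAt (fun s => f (z s)) (inner ℝ h (deriv z t)) t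

/-- Gradient flow on `F`: an arc with `θ'(t) ∈ -∂°F(θ(t))` for almost every `t ≥ 0`. -/
def IsGradientFlow (F : Euc d → ℝ) (θ : ℝ → Euc d) : Prop :=
  IsArc θ ∧ ∀ᵐ t : ℝ, 0 ≤ t → ∃ v, HasDerivAt θ v t ∧ -v ∈ clarkeSubdiff F (θ t)

/-- Gradient descent on `F` with learning rates `η`. -/
def IsGradientDescent (F : Euc d → ℝ) (η : ℕ → ℝ) (θ : ℕ → Euc d) : Prop :=
  ∀ t, θ (t + 1) = θ t - η t • ∇ F (θ t)

end Nonsmooth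

section Classification

variable {d dx N : ℕ}

/-- The margin `q_n(θ) = y_n Φ(θ; x_n)` of the `n`-th data point. -/
def margin (Φ : Euc d → Euc dx → ℝ) (xs : Fin N → Euc dx) (ys : Fin N → ℝ) (n : Fin N)
    (θ : Euc d) : ℝ :=
  ys n * Φ θ (xs n)

/-- The training loss `𝓛(θ) = ∑ n, ℓ(y_n Φ(θ; x_n))` for the exponential loss `ℓ(q) = e^{-q}`. -/
def trainLoss (Φ : Euc d → Euc dx → ℝ) (xs : Fin N → Euc dx) (ys : Fin N → ℝ)
    (θ : Euc d) : ℝ :=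
  ∑ n, Real.exp (-margin Φ xs ys n θ)

/-- `Φ(α θ; x) = α ^ L Φ(θ; x)` for all `α > 0`. -/
def IsHomogeneousNet (Φ : Euc d → Euc dx → ℝ) (L : ℝ) : Prop :=
  ∀ (α : ℝ) (θ : Euc d) (x : Euc dx), 0 < α → Φ (α • θ) x = α ^ L * Φ θ x

/-- For every input, the output is a `C²` function of the parameter away from the origin. -/
def IsSmoothNet (Φ : Euc d → Euc dx → ℝ) : Prop :=
  ∀ x : Euc dx, ContDiffOn ℝ 2 (fun θ => Φ θ x) {0}ᶜ

/-- For every input, the output is a locally Lipschitz function of the parameter which admits a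
chain rule. -/
def IsRegularNet (Φ : Euc d → Euc dx → ℝ) : Prop :=
  ∀ x : Euc dx, AdmitsChainRule (fun θ => Φ θ x)

/-- The kernel of a feature map. -/
def featureKernel (φ : Euc dx → Euc d) (x x' : Euc dx) : ℝ :=
  inner ℝ (φ x) (φ x')

/-- The gradient feature map `x ↦ ∇Φ_x(θ)`, where `Φ_x(θ) = Φ(θ; x)`. -/
def gradFeature (Φ : Euc d → Euc dx → ℝ) (θ : Euc d) (x : Euc dx) : Euc d :=
  ∇ (fun ϑ => Φ ϑ x) θ

/-- The neural tangent kernel at `θ`: `K_θ(x, x') = ⟪∇Φ_x(θ), ∇Φ_{x'}(θ)⟫`. -/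
def ntk (Φ : Euc d → Euc dx → ℝ) (θ : Euc d) (x x' : Euc dx) : ℝ :=
  inner ℝ (∇ (fun ϑ => Φ ϑ x) θ) (∇ (fun ϑ => Φ ϑ x') θ)

/-- `w` satisfies the constraints `y_n ⟪w, φ(x_n)⟫ ≥ 1`. -/
def SVMFeasible (φ : Euc dx → Euc d) (xs : Fin N → Euc dx) (ys : Fin N → ℝ) (w : Euc d) : Prop :=
  ∀ n, 1 ≤ ys n * inner ℝ w (φ (xs n))

/-- `w` is the (unique) optimal solution of the hard-margin SVM with kernel `K`, written in the
feature space of the feature map `φ` of `K`: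
minimize `½ ‖w‖²` subject to `y_n ⟪w, φ(x_n)⟫ ≥ 1` for all `n`. -/
structure IsKernelSVMSolution (K : Euc dx → Euc dx → ℝ) (φ : Euc dx → Euc d)
    (xs : Fin N → Euc dx) (ys : Fin N → ℝ) (w : Euc d) : Prop where
  kernel_eq : ∀ x x', K x x' = featureKernel φ x x'
  feasible : SVMFeasible φ xs ys w
  optimal : ∀ v, SVMFeasible φ xs ys v → 1 / 2 * ‖w‖ ^ 2 ≤ 1 / 2 * ‖v‖ ^ 2
  unique : ∀ v, SVMFeasible φ xs ys v → 1 / 2 * ‖v‖ ^ 2 ≤ 1 / 2 * ‖w‖ ^ 2 → v = w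

/-- `v` is along the max-margin direction: some positive multiple of `v` is the optimal solution
of the hard-margin SVM with kernel `K`. -/
def IsMaxMarginDirection (K : Euc dx → Euc dx → ℝ) (φ : Euc dx → Euc d)
    (xs : Fin N → Euc dx) (ys : Fin N → ℝ) (v : Euc d) : Prop :=
  ∃ α : ℝ, 0 < α ∧ IsKernelSVMSolution K φ xs ys (α • v)

/-- `v` is a limit point of the normalized trajectory `θ(t) / ‖θ(t)‖` as `t → ∞`. -/
def IsLimitDirection {T : Type} [Preorder T] (θ : T → Euc d) (v : Euc d) : Prop :=
  MapClusterPt v atTop (fun t => ‖θ t‖⁻¹ • θ t)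

end Classification

/-! The learning rate bound for gradient descent. Below `x₀` stands for the loss `𝓛(θ(t₀))` at the
separation time `t₀`, and `x` for the current loss. -/

section LearningRate

/-- `λ(x) = (log (1/x))⁻¹`. -/
def lam (x : ℝ) : ℝ := (Real.log (1 / x))⁻¹

/-- `μ(x) = log (1/x₀) / (2 log (1/x))`. -/
def mu (x₀ x : ℝ) : ℝ := Real.log (1 / x₀) / (2 * Real.log (1 / x))

/-- For `L ≤ 1`, `κ(x) = x (log (1/x))^{2-2/L}`. For `L > 1` this is used for `x ≤ e^{2/L-2}`
only, and `κ(x) = e^{(2-2/L)(log(2-2/L)-1)}` for larger `x`. -/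
def kappa (L x : ℝ) : ℝ :=
  if L ≤ 1 ∨ x ≤ Real.exp (2 / L - 2) then x * Real.log (1 / x) ^ (2 - 2 / L)
  else Real.exp ((2 - 2 / L) * (Real.log (2 - 2 / L) - 1))

/-- `φ'(x) = - sup { (1 + 2 (1 + λ(w)/L) μ(w)) / (w log (1/w)) : w ∈ [x, x₀] }`. -/
def phiDeriv (L x₀ x : ℝ) : ℝ :=
  -sSup ((fun w => (1 + 2 * (1 + lam w / L) * mu x₀ w) / (w * Real.log (1 / w))) '' Set.Icc x x₀)

/-- `φ(x) = log log (1/x) + ∫₀ˣ (φ'(w) + 1 / (w log (1/w))) dw`. -/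
def phi (L x₀ x : ℝ) : ℝ :=
  Real.log (Real.log (1 / x)) + ∫ w in (0 : ℝ)..x, (phiDeriv L x₀ w + 1 / (w * Real.log (1 / w)))

variable {d dx N : ℕ}

/-- The smoothed normalized margin `γ̂(θ) = e^{φ(𝓛(θ))} / ‖θ‖^L`. -/
def gammaHat (Φ : Euc d → Euc dx → ℝ) (xs : Fin N → Euc dx) (ys : Fin N → ℝ) (L x₀ : ℝ)
    (θ : Euc d) : ℝ :=
  Real.exp (phi L x₀ (trainLoss Φ xs ys θ)) / ‖θ‖ ^ L

/-- `B₀ = sup { q_n(θ) : ‖θ‖ = 1, n }`. -/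
def B0 (Φ : Euc d → Euc dx → ℝ) (xs : Fin N → Euc dx) (ys : Fin N → ℝ) : ℝ :=
  sSup {r | ∃ (θ : Euc d) (n : Fin N), ‖θ‖ = 1 ∧ r = margin Φ xs ys n θ}

/-- `B₁ = sup { ‖∇q_n(θ)‖ : ‖θ‖ = 1, n }`. -/
def B1 (Φ : Euc d → Euc dx → ℝ) (xs : Fin N → Euc dx) (ys : Fin N → ℝ) : ℝ :=
  sSup {r | ∃ (θ : Euc d) (n : Fin N), ‖θ‖ = 1 ∧ r = ‖∇ (margin Φ xs ys n) θ‖}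

/-- `B₂ = sup { ‖∇²q_n(θ)‖ : ‖θ‖ = 1, n }`, with the operator norm of the Hessian (the derivative
of the gradient). -/
def B2 (Φ : Euc d → Euc dx → ℝ) (xs : Fin N → Euc dx) (ys : Fin N → ℝ) : ℝ :=
  sSup {r | ∃ (θ : Euc d) (n : Fin N), ‖θ‖ = 1 ∧ r = ‖fderiv ℝ (∇ (margin Φ xs ys n)) θ‖}

/-- The constant `C_η`, for the iterate `θ₀` at the separation time:
`½ (B₁² + ‖θ₀‖^{-L} B₂) max { γ̂(θ₀)^{-2+2/L}, B₀^{-2+2/L} }`. -/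
def Ceta (Φ : Euc d → Euc dx → ℝ) (xs : Fin N → Euc dx) (ys : Fin N → ℝ) (L : ℝ)
    (θ₀ : Euc d) : ℝ :=
  1 / 2 * (B1 Φ xs ys ^ 2 + ‖θ₀‖ ^ (-L) * B2 Φ xs ys) *
    max (gammaHat Φ xs ys L (trainLoss Φ xs ys θ₀) θ₀ ^ (-2 + 2 / L))
      (B0 Φ xs ys ^ (-2 + 2 / L))

/-- The learning rate bound `H(x) = μ(x) / (C_η κ(x))`. -/
def rateBound (Φ : Euc d → Euc dx → ℝ) (xs : Fin N → Euc dx) (ys : Fin N → ℝ) (L : ℝ)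
    (θ₀ : Euc d) (x : ℝ) : ℝ :=
  mu (trainLoss Φ xs ys θ₀) x / (Ceta Φ xs ys L θ₀ * kappa L x)

/-- The learning rate condition for gradient descent with separation time `t₀`: the learning rates
are nonnegative with `∑ η(t) = ∞`, and `η(t) ≤ H(𝓛(θ(t)))` from time `t₀` on. -/
structure LearningRateCondition (Φ : Euc d → Euc dx → ℝ) (xs : Fin N → Euc dx)
    (ys : Fin N → ℝ) (L : ℝ) (η : ℕ → ℝ) (θ : ℕ → Euc d) (t₀ : ℕ) : Prop where
  nonneg : ∀ t, 0 ≤ η t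
  sum_eq_top : Tendsto (fun T => ∑ t ∈ Finset.range T, η t) atTop atTop
  le_bound : ∀ t, t₀ ≤ t → η t ≤ rateBound Φ xs ys L (θ t₀) (trainLoss Φ xs ys (θ t))

end LearningRate

end HomNet

end

noncomputable section

namespace HomNet

/-! The theorem splits into a convex half and a dynamical half, joined by `IsKKTDirection`: v is a
nonnegative combination of (sub)gradients of the margins at v, using only those n whose margin is
minimal at v, and all margins are positive.

Convex half. For a function f homogeneous of degree L, Euler's identity ⟨g, v⟩ = L f(v) holds for
every Clarke subgradient g. So at v the margins linearized at v are L times the true margins, and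
the conditions above are the KKT conditions, up to scaling, of the SVM built from these
subgradients. That problem is strictly convex, so KKT points are its unique solutions
(`isMaxMarginDirection_of_stationary`). In the nonsmooth case the subgradients must first be merged
into one function of the input (`IsKKTDirection.exists_feature`).

Dynamical half. Let p be minus the (sub)gradient of the loss ℒ. The smoothed log margin log log(1/ℒ)
- L log‖θ‖ is bounded above, and along the flow its rate of growth is at least L (log‖θ‖)' times
‖p‖²‖θ‖²/⟨p, θ⟩² - 1, which is nonnegative by Cauchy–Schwarz and vanishes only when p is parallel to
θ. The norm tends to infinity, and the direction moves at most C times as fast as log‖θ‖. Hence,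
starting late from a time at which the direction is close to v, log‖θ‖ can grow by a fixed small
amount while the direction stays close to v. A definite misalignment of p and θ throughout this
window would raise the margin by a definite amount, which its boundedness forbids at late times.
This yields nearly aligned points (`HasAlignedPoints`). At such points p/‖p‖ is a combination of
rescaled subgradients with bounded weights; a convergent subsequence gives stationarity, and the
exponential weights of the non-minimal margins die out as ‖θ‖ grows
(`HasAlignedPoints.isKKTDirection`).

Gradient descent follows the same scheme with log log(1/ℒ) replaced by φ(ℒ). The derivative of φ is
slightly steeper, and the surplus pays for the second-order errors of a step whose size obeys the
rate bound (`smoothedLogMargin_segment`, `descent_step`). Since the curvature bound along a step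
itself needs the margin bound at intermediate points, the two are propagated together by continuity
(`loss_segment_le`). -/

theorem _root_.IsCompact.convexHull_of_finiteDimensional {E : Type*} [NormedAddCommGroup E]
    [NormedSpace ℝ E] [FiniteDimensional ℝ E] {s : Set E} (hs : IsCompact s) :
    IsCompact (convexHull ℝ s) := by
  set n := Module.finrank ℝ E + 1
  -- By Carathéodory, finrank + 1 points suffice, so the hull is a continuous image of a compact set
  -- of weights and points.
  have hK : IsCompact ((fun p : (Fin n → ℝ) × (Fin n → E) => ∑ i, p.1 i • p.2 i) ''
      (stdSimplex ℝ (Fin n) ×ˢ Set.univ.pi fun _ => s)) := by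
    refine ((isCompact_stdSimplex ℝ (Fin n)).prod (isCompact_univ_pi fun _ => hs)).image ?_
    fun_prop
  convert hK using 1
  apply Set.Subset.antisymm
  · intro x hx
    obtain ⟨ι, _, z, w, hz, haff, hw, hw1, rfl⟩ := eq_pos_convex_span_of_mem_convexHull hx
    have hcard : Fintype.card ι ≤ Fintype.card (Fin n) := by
      simpa [n] using haff.card_le_finrank_succ.trans
        (Nat.succ_le_succ (Submodule.finrank_le (vectorSpan ℝ (Set.range z))))
    obtain ⟨e⟩ := Function.Embedding.nonempty_of_card_le hcard
    have hne : Nonempty ι := by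
      by_contra h
      rw [not_nonempty_iff] at h
      simp at hw1
    obtain ⟨i0⟩ := hne
    -- A shorter combination is padded with zero weights and with a repeated point of s.
    refine ⟨(Function.extend e w 0, Function.extend e z fun _ => z i0), ⟨⟨?_, ?_⟩, ?_⟩, ?_⟩
    · intro j
      by_cases hj : ∃ i, e i = j
      · obtain ⟨i, rfl⟩ := hj
        simpa [e.injective.extend_apply] using (hw i).le
      · simp [Function.extend_apply' _ _ _ hj]
    · rw [← hw1]
      symm
      refine Fintype.sum_of_injective e e.injective _ _ (fun j hj => ?_) fun i => ?_
      · exact Function.extend_apply' _ _ _ hj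
      · simp [e.injective.extend_apply]
    · intro j _
      by_cases hj : ∃ i, e i = j
      · obtain ⟨i, rfl⟩ := hj
        simpa [e.injective.extend_apply] using hz ⟨i, rfl⟩
      · simpa [Function.extend_apply' _ _ _ hj] using hz ⟨i0, rfl⟩
    · symm
      refine Fintype.sum_of_injective e e.injective _ _ (fun j hj => ?_) fun i => ?_
      · simp only
        rw [Function.extend_apply' _ _ _ hj]
        simp
      · simp [e.injective.extend_apply]
  · rintro _ ⟨⟨w, z⟩, ⟨hw, hz⟩, rfl⟩
    exact (convex_convexHull ℝ s).sum_mem (fun i _ => hw.1 i) hw.2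
      fun i _ => subset_convexHull ℝ s (hz i trivial)

/-! ### Clarke's subdifferential: closed graph, nonemptiness, homogeneity and Euler's identity. -/

section Clarke

variable {d : ℕ} {f : Euc d → ℝ} {x : Euc d}

/-- `f` is Lipschitz on a neighbourhood of `x`. -/
def LipschitzNear (f : Euc d → ℝ) (x : Euc d) : Prop :=
  ∃ K, ∃ s ∈ 𝓝 x, LipschitzOnWith K f s

/-- The limits of gradients of `f` along sequences converging to `x`. -/
def limitingGradients (f : Euc d → ℝ) (x : Euc d) : Set (Euc d) :=
  {g | ∃ u : ℕ → Euc d, Tendsto u atTop (𝓝 x) ∧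
    (∀ k, DifferentiableAt ℝ f (u k)) ∧ Tendsto (fun k => ∇ f (u k)) atTop (𝓝 g)}

theorem clarkeSubdiff_eq : clarkeSubdiff f x = convexHull ℝ (limitingGradients f x) := rfl

/-- Describing the limiting gradients as a slice of a closed set makes diagonal-sequence arguments
unnecessary. -/
theorem mem_limitingGradients_iff {g : Euc d} : g ∈ limitingGradients f x ↔
    (x, g) ∈ closure {p : Euc d × Euc d | DifferentiableAt ℝ f p.1 ∧ ∇ f p.1 = p.2} := by
  rw [mem_closure_iff_seq_limit]
  constructor
  · rintro ⟨u, hu, hd, hg⟩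
    exact ⟨fun k => (u k, ∇ f (u k)), fun k => ⟨hd k, rfl⟩, hu.prodMk_nhds hg⟩
  · rintro ⟨p, hp, hlim⟩
    refine ⟨fun k => (p k).1, (continuous_fst.tendsto _).comp hlim, fun k => (hp k).1, ?_⟩
    have := (continuous_snd.tendsto _).comp hlim
    refine this.congr fun k => ?_
    simp [(hp k).2]

theorem mem_limitingGradients_of_tendsto {u g : ℕ → Euc d} {y : Euc d}
    (hu : Tendsto u atTop (𝓝 x)) (hg : Tendsto g atTop (𝓝 y))
    (h : ∀ k, g k ∈ limitingGradients f (u k)) : y ∈ limitingGradients f x := by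
  rw [mem_limitingGradients_iff]
  exact isClosed_closure.mem_of_tendsto (hu.prodMk_nhds hg)
    (Eventually.of_forall fun k => mem_limitingGradients_iff.1 (h k))

theorem gradient_mem_limitingGradients (h : DifferentiableAt ℝ f x) :
    ∇ f x ∈ limitingGradients f x :=
  ⟨fun _ => x, tendsto_const_nhds, fun _ => h, tendsto_const_nhds⟩

theorem norm_gradient (y : Euc d) : ‖∇ f y‖ = ‖fderiv ℝ f y‖ := by
  simp [gradient]

theorem LipschitzNear.exists_norm_gradient_le (hf : LipschitzNear f x) :
    ∃ K : ℝ, ∀ᶠ y in 𝓝 x, ‖∇ f y‖ ≤ K := by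
  obtain ⟨K, s, hs, hK⟩ := hf
  refine ⟨K, ?_⟩
  filter_upwards [eventually_mem_nhds_iff.2 hs] with y hy
  rw [norm_gradient]
  exact norm_fderiv_le_of_lipschitzOn ℝ hy hK

theorem LipschitzNear.exists_norm_limitingGradients_le (hf : LipschitzNear f x) :
    ∃ K : ℝ, ∀ᶠ y in 𝓝 x, ∀ g ∈ limitingGradients f y, ‖g‖ ≤ K := by
  obtain ⟨K, hK⟩ := hf.exists_norm_gradient_le
  refine ⟨K, ?_⟩
  filter_upwards [eventually_eventually_nhds.2 hK] with y hy
  rintro g ⟨u, hu, -, hg⟩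
  exact le_of_tendsto hg.norm (hu.eventually hy)

theorem LipschitzNear.exists_norm_le (hf : LipschitzNear f x) :
    ∃ K : ℝ, ∀ᶠ y in 𝓝 x, ∀ g ∈ clarkeSubdiff f y, ‖g‖ ≤ K := by
  obtain ⟨K, hK⟩ := hf.exists_norm_limitingGradients_le
  refine ⟨K, hK.mono fun y hy g hg => ?_⟩
  have : clarkeSubdiff f y ⊆ Metric.closedBall 0 K :=
    convexHull_min (fun g hg => by simpa using hy g hg) (convex_closedBall 0 K)
  simpa using this hg

theorem LipschitzNear.isCompact_clarkeSubdiff (hf : LipschitzNear f x) :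
    IsCompact (clarkeSubdiff f x) := by
  refine IsCompact.convexHull_of_finiteDimensional (Metric.isCompact_of_isClosed_isBounded ?_ ?_)
  · have : IsClosed {g | (x, g) ∈
        closure {p : Euc d × Euc d | DifferentiableAt ℝ f p.1 ∧ ∇ f p.1 = p.2}} :=
      isClosed_closure.preimage (by fun_prop)
    have heq : {g | (x, g) ∈
        closure {p : Euc d × Euc d | DifferentiableAt ℝ f p.1 ∧ ∇ f p.1 = p.2}} =
        limitingGradients f x := Set.ext fun g => mem_limitingGradients_iff.symm
    rwa [heq] at this
  · obtain ⟨K, hK⟩ := hf.exists_norm_limitingGradients_le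
    exact isBounded_iff_forall_norm_le.2 ⟨K, fun g hg => hK.self_of_nhds g hg⟩

theorem convex_clarkeSubdiff : Convex ℝ (clarkeSubdiff f x) := convex_convexHull ℝ _

/-- The Clarke subdifferential has closed graph where the function is Lipschitz. -/
theorem LipschitzNear.mem_clarkeSubdiff_of_tendsto (hf : LipschitzNear f x) {u g : ℕ → Euc d}
    {y : Euc d} (hu : Tendsto u atTop (𝓝 x)) (hg : Tendsto g atTop (𝓝 y))
    (h : ∀ k, g k ∈ clarkeSubdiff f (u k)) : y ∈ clarkeSubdiff f x := by
  by_contra hy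
  obtain ⟨F, a, hFa, hay⟩ := geometric_hahn_banach_closed_point convex_clarkeSubdiff
    hf.isCompact_clarkeSubdiff.isClosed hy
  obtain ⟨K, hK⟩ := hf.exists_norm_limitingGradients_le
  have hev : ∀ᶠ k in atTop, g k ∈ clarkeSubdiff f (u k) ∧ a < F (g k) ∧
      ∀ g ∈ limitingGradients f (u k), ‖g‖ ≤ K :=
    (Eventually.of_forall h).and
      (((F.continuous.tendsto y).comp hg).eventually (lt_mem_nhds hay) |>.and (hu.eventually hK))
  obtain ⟨m, hm⟩ := eventually_atTop.1 hev
  -- A point of a convex hull lies in the open half-space above a only if some generator does. This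
  -- reduces the claim to limiting gradients, whose graph is closed.
  have hex : ∀ k, ∃ e ∈ limitingGradients f (u (k + m)), a < F e := by
    intro k
    by_contra! hcon
    have : clarkeSubdiff f (u (k + m)) ⊆ {e | F e ≤ a} :=
      convexHull_min hcon (convex_halfSpace_le F.toLinearMap.isLinear a)
    exact absurd (this (h (k + m))) (not_le.2 (hm (k + m) (by omega)).2.1)
  choose e he hae using hex
  obtain ⟨e', -, φ, hφ, hlim⟩ := tendsto_subseq_of_bounded
    (Metric.isBounded_closedBall (x := (0 : Euc d)) (r := K))
    (fun k => by simpa using (hm (k + m) (by omega)).2.2 _ (he k) : ∀ k, e k ∈ _)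
  have hmem : e' ∈ limitingGradients f x :=
    mem_limitingGradients_of_tendsto (u := fun k => u (φ k + m))
      (hu.comp ((tendsto_add_atTop_nat m).comp hφ.tendsto_atTop)) hlim fun k => he (φ k)
  have h1 : a ≤ F e' := ge_of_tendsto ((F.continuous.tendsto e').comp hlim)
    (Eventually.of_forall fun k => (hae (φ k)).le)
  exact absurd (hFa e' (subset_convexHull ℝ _ hmem)) (not_lt.2 h1)

/-- Rademacher's theorem near a point. -/
theorem LipschitzNear.exists_ae_differentiableAt (hf : LipschitzNear f x) :
    ∃ r > 0, (∃ K, LipschitzOnWith K f (Metric.ball x r)) ∧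
      ∀ᵐ y, y ∈ Metric.ball x r → DifferentiableAt ℝ f y := by
  obtain ⟨K, s, hs, hK⟩ := hf
  obtain ⟨r, hr, hrs⟩ := Metric.mem_nhds_iff.1 hs
  refine ⟨r, hr, ⟨K, hK.mono hrs⟩, ?_⟩
  filter_upwards [(hK.mono hrs).ae_differentiableWithinAt_of_mem (μ := volume)] with y hy hyr
  exact (hy hyr).differentiableAt (Metric.isOpen_ball.mem_nhds hyr)

/-- By Rademacher there are points of differentiability arbitrarily close to x, with bounded
gradients; a subsequence of these gradients converges. -/
theorem LipschitzNear.nonempty_clarkeSubdiff (hf : LipschitzNear f x) :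
    (clarkeSubdiff f x).Nonempty := by
  obtain ⟨r, hr, -, hae⟩ := hf.exists_ae_differentiableAt
  obtain ⟨K, hK⟩ := hf.exists_norm_gradient_le
  have hfreq : ∀ k : ℕ, ∃ y, dist y x < 1 / ((k : ℝ) + 1) ∧ DifferentiableAt ℝ f y ∧
      ‖∇ f y‖ ≤ K := by
    intro k
    obtain ⟨ε, hε, hεK⟩ := Metric.mem_nhds_iff.1 hK
    have hδ : 0 < min (1 / ((k : ℝ) + 1)) (min r ε) :=
      lt_min (by positivity) (lt_min hr hε)
    obtain ⟨y, hy, hyb⟩ := (Measure.dense_of_ae hae).exists_mem_open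
      (Metric.isOpen_ball (x := x) (ε := min (1 / ((k : ℝ) + 1)) (min r ε)))
      ⟨x, Metric.mem_ball_self hδ⟩
    have hyd := Metric.mem_ball.1 hyb
    exact ⟨y, hyd.trans_le (min_le_left _ _),
      hy (Metric.mem_ball.2 (hyd.trans_le ((min_le_right _ _).trans (min_le_left _ _)))),
      hεK (Metric.mem_ball.2 (hyd.trans_le ((min_le_right _ _).trans (min_le_right _ _))))⟩
  choose y hyx hyd hyK using hfreq
  have hlim : Tendsto y atTop (𝓝 x) :=
    tendsto_iff_dist_tendsto_zero.2 (squeeze_zero (fun _ => dist_nonneg) (fun k => (hyx k).le)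
      tendsto_one_div_add_atTop_nhds_zero_nat)
  obtain ⟨g, -, φ, hφ, hg⟩ := tendsto_subseq_of_bounded
    (Metric.isBounded_closedBall (x := (0 : Euc d)) (r := K))
    (fun k => by simpa using hyK k : ∀ k, ∇ f (y k) ∈ _)
  exact ⟨g, subset_convexHull ℝ _ ⟨y ∘ φ, hlim.comp hφ.tendsto_atTop, fun k => hyd _, hg⟩⟩

theorem continuousAt_gradient (hf : ContDiffAt ℝ 1 f x) : ContinuousAt (∇ f) x := by
  have : ContinuousAt (fderiv ℝ f) x := hf.continuousAt_fderiv one_ne_zero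
  exact (InnerProductSpace.toDual ℝ (Euc d)).symm.continuous.continuousAt.comp this

theorem clarkeSubdiff_eq_singleton (hf : ContDiffAt ℝ 1 f x) : clarkeSubdiff f x = {∇ f x} := by
  have : limitingGradients f x = {∇ f x} := by
    ext g
    constructor
    · rintro ⟨u, hu, -, hg⟩
      exact tendsto_nhds_unique hg ((continuousAt_gradient hf).tendsto.comp hu)
    · rintro rfl
      exact gradient_mem_limitingGradients (hf.differentiableAt one_ne_zero)
  rw [clarkeSubdiff_eq, this, convexHull_singleton]

theorem LipschitzNear.of_contDiffAt (hf : ContDiffAt ℝ 1 f x) : LipschitzNear f x :=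
  hf.exists_lipschitzOnWith

theorem gradient_const_mul (c : ℝ) (h : DifferentiableAt ℝ f x) :
    ∇ (fun y => c * f y) x = c • ∇ f x := by
  simp [gradient, fderiv_const_mul h]

theorem smul_mem_clarkeSubdiff_const_mul (c : ℝ) {g : Euc d} (hg : g ∈ clarkeSubdiff f x) :
    c • g ∈ clarkeSubdiff (fun y => c * f y) x := by
  have : clarkeSubdiff f x ⊆ {g | c • g ∈ clarkeSubdiff (fun y => c * f y) x} := by
    refine convexHull_min ?_ ((convex_clarkeSubdiff).is_linear_preimage
      (IsLinearMap.isLinearMap_smul c))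
    rintro g ⟨u, hu, hd, hg⟩
    refine subset_convexHull ℝ _ ⟨u, hu, fun k => (hd k).const_mul c, ?_⟩
    exact (hg.const_smul c).congr fun k => (gradient_const_mul c (hd k)).symm
  exact this hg

section Homogeneous

variable {L : ℝ} (hom : ∀ (c : ℝ) (θ : Euc d), 0 < c → f (c • θ) = c ^ L * f θ)

include hom

/-- Differentiate f = c ^ L f(c⁻¹ ·) at c • x. -/
theorem hasGradientAt_smul {c : ℝ} (hc : 0 < c) (h : DifferentiableAt ℝ f x) :
    HasGradientAt f (c ^ (L - 1) • ∇ f x) (c • x) := by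
  have hc' : c ≠ 0 := hc.ne'
  have h1 : f = fun y => c ^ L * f (c⁻¹ • y) := by
    funext y
    rw [← hom c _ hc, smul_inv_smul₀ hc']
  have h2 : HasFDerivAt f (fderiv ℝ f x) (c⁻¹ • c • x) := by
    rw [inv_smul_smul₀ hc']
    exact h.hasFDerivAt
  have h3 : HasFDerivAt (fun y : Euc d => c⁻¹ • y) (c⁻¹ • ContinuousLinearMap.id ℝ (Euc d))
      (c • x) := (hasFDerivAt_id _).const_smul c⁻¹
  have h4 := (h2.comp (c • x) h3).const_mul (c ^ L)
  have h5 : (fun y => c ^ L * (f ∘ fun y : Euc d => c⁻¹ • y) y) = f := h1.symm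
  have h6 : InnerProductSpace.toDual ℝ (Euc d) (c ^ (L - 1) • ∇ f x) =
      c ^ L • (fderiv ℝ f x).comp (c⁻¹ • ContinuousLinearMap.id ℝ (Euc d)) := by
    rw [map_smul, toDual_gradient]
    ext v
    simp only [smul_apply, ContinuousLinearMap.comp_apply, map_smul,
      smul_eq_mul, ContinuousLinearMap.id_apply]
    rw [Real.rpow_sub_one hc']
    ring
  rw [hasGradientAt_iff_hasFDerivAt, h6]
  exact h4.congr_of_eventuallyEq (Eventually.of_forall fun y => (congrFun h5 y).symm)

theorem smul_mem_clarkeSubdiff {c : ℝ} (hc : 0 < c) {g : Euc d} (hg : g ∈ clarkeSubdiff f x) :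
    c ^ (L - 1) • g ∈ clarkeSubdiff f (c • x) := by
  have : clarkeSubdiff f x ⊆ {g | c ^ (L - 1) • g ∈ clarkeSubdiff f (c • x)} := by
    refine convexHull_min ?_ ((convex_clarkeSubdiff).is_linear_preimage
      (IsLinearMap.isLinearMap_smul _))
    rintro g ⟨u, hu, hd, hg⟩
    refine subset_convexHull ℝ _ ⟨fun k => c • u k, hu.const_smul c,
      fun k => (hasGradientAt_smul hom hc (hd k)).differentiableAt, ?_⟩
    exact (hg.const_smul _).congr fun k => (hasGradientAt_smul hom hc (hd k)).gradient.symm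
  exact this hg

/-- Euler's identity: differentiate c ↦ f(c • x) at c = 1 in two ways. -/
theorem inner_gradient_self (h : DifferentiableAt ℝ f x) : inner ℝ (∇ f x) x = L * f x := by
  have h1 : HasDerivAt (fun c : ℝ => f (c • x)) (fderiv ℝ f x x) 1 := by
    have h2 : HasFDerivAt f (fderiv ℝ f x) ((1 : ℝ) • x) := by simpa using h.hasFDerivAt
    have h3 : HasDerivAt (fun c : ℝ => c • x) x 1 := by
      simpa using (hasDerivAt_id (1 : ℝ)).smul_const x
    exact h2.comp_hasDerivAt 1 h3
  have h2 : HasDerivAt (fun c : ℝ => c ^ L * f x) (L * f x) 1 := by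
    simpa using (Real.hasDerivAt_rpow_const (x := 1) (p := L) (Or.inl one_ne_zero)).mul_const (f x)
  have h3 : (fun c : ℝ => f (c • x)) =ᶠ[𝓝 1] fun c : ℝ => c ^ L * f x := by
    filter_upwards [lt_mem_nhds (zero_lt_one (α := ℝ))] with c hc using hom c x hc
  rw [inner_gradient_left]
  exact h1.unique (h2.congr_of_eventuallyEq h3)

/-- Euler's identity passes to limits of gradients by continuity, and to their convex hull because
it is affine in g. -/
theorem LipschitzNear.inner_self_of_mem_clarkeSubdiff (hf : LipschitzNear f x) {g : Euc d}
    (hg : g ∈ clarkeSubdiff f x) : inner ℝ g x = L * f x := by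
  have hcont : ContinuousAt f x := by
    obtain ⟨K, s, hs, hK⟩ := hf
    exact hK.continuousOn.continuousAt hs
  have : clarkeSubdiff f x ⊆ {g | inner ℝ g x = L * f x} := by
    refine convexHull_min ?_ ?_
    · rintro g ⟨u, hu, hd, hg⟩
      refine tendsto_nhds_unique (hg.inner hu) ?_
      refine ((hcont.tendsto.comp hu).const_mul L).congr fun k => ?_
      exact (inner_gradient_self hom (hd k)).symm
    · exact convex_hyperplane ⟨fun a b => inner_add_left a b x, fun c a => real_inner_smul_left a x c⟩ _
  exact this hg

end Homogeneous

end Clarke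

/-! ### Absolutely continuous functions: composition and monotonicity from the sign of the
derivative. -/

section AbsolutelyContinuous

theorem _root_.LocallyLipschitzOn.comp_absolutelyContinuousOnInterval {E X : Type*}
    [SeminormedAddCommGroup E] [PseudoMetricSpace X] {f : E → X} {z : ℝ → E} {a b : ℝ}
    (hz : AbsolutelyContinuousOnInterval z a b) (hf : LocallyLipschitzOn (z '' Set.uIcc a b) f) :
    AbsolutelyContinuousOnInterval (fun t => f (z t)) a b := by
  obtain ⟨K, hK⟩ := hf.exists_lipschitzOnWith_of_compact
    (isCompact_uIcc.image_of_continuousOn hz.continuousOn)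
  rw [absolutelyContinuousOnInterval_iff] at hz ⊢
  intro ε hε
  -- Dividing by `K + 1` covers the case K = 0 and makes the final estimate strict.
  obtain ⟨δ, hδ, h⟩ := hz (ε / (K + 1)) (by positivity)
  refine ⟨δ, hδ, fun E hE hEδ => ?_⟩
  calc ∑ i ∈ Finset.range E.1, dist (f (z (E.2 i).1)) (f (z (E.2 i).2))
      ≤ ∑ i ∈ Finset.range E.1, K * dist (z (E.2 i).1) (z (E.2 i).2) :=
        Finset.sum_le_sum fun i hi => hK.dist_le_mul _
          (Set.mem_image_of_mem z (hE.1 i hi).1) _ (Set.mem_image_of_mem z (hE.1 i hi).2)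
    _ = K * ∑ i ∈ Finset.range E.1, dist (z (E.2 i).1) (z (E.2 i).2) := by rw [Finset.mul_sum]
    _ ≤ K * (ε / (K + 1)) := by
        gcongr
        exact (h E hE hEδ).le
    _ < (K + 1) * (ε / (K + 1)) := by
        gcongr
        linarith
    _ = ε := by field_simp

theorem _root_.AbsolutelyContinuousOnInterval.comp_contDiffAt {E F : Type*}
    [NormedAddCommGroup E] [NormedSpace ℝ E] [NormedAddCommGroup F] [NormedSpace ℝ F]
    {f : E → F} {z : ℝ → E} {a b : ℝ} (hz : AbsolutelyContinuousOnInterval z a b)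
    (hf : ∀ t ∈ Set.uIcc a b, ContDiffAt ℝ 1 f (z t)) :
    AbsolutelyContinuousOnInterval (fun t => f (z t)) a b := by
  refine LocallyLipschitzOn.comp_absolutelyContinuousOnInterval hz ?_
  rintro _ ⟨t, ht, rfl⟩
  obtain ⟨K, s, hs, hK⟩ := (hf t ht).exists_lipschitzOnWith
  exact ⟨K, s, mem_nhdsWithin_of_mem_nhds hs, hK⟩

theorem _root_.AbsolutelyContinuousOnInterval.finsetSum {ι F : Type*} [NormedAddCommGroup F]
    {f : ι → ℝ → F} {a b : ℝ} (s : Finset ι)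
    (hf : ∀ i ∈ s, AbsolutelyContinuousOnInterval (f i) a b) :
    AbsolutelyContinuousOnInterval (fun t => ∑ i ∈ s, f i t) a b := by
  classical
  induction s using Finset.induction_on with
  | empty =>
    simpa using (LipschitzWith.const (0 : F)).lipschitzOnWith.absolutelyContinuousOnInterval
  | insert i s hi ih =>
    have := (hf i (Finset.mem_insert_self i s)).add
      (ih fun j hj => hf j (Finset.mem_insert_of_mem hj))
    simp only [Finset.sum_insert hi]
    exact this

theorem _root_.AbsolutelyContinuousOnInterval.le_of_ae_deriv_nonneg {f : ℝ → ℝ} {a b : ℝ}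
    (hab : a ≤ b) (hf : AbsolutelyContinuousOnInterval f a b)
    (h : ∀ᵐ t, t ∈ Set.Icc a b → ∃ f', HasDerivAt f f' t ∧ 0 ≤ f') : f a ≤ f b := by
  have h1 := hf.integral_deriv_eq_sub
  have h2 : 0 ≤ ∫ x in a..b, deriv f x := by
    rw [intervalIntegral.integral_of_le hab]
    refine setIntegral_nonneg_of_ae_restrict ?_
    refine (ae_restrict_iff' measurableSet_Ioc).2 ?_
    filter_upwards [h] with t ht hmem
    obtain ⟨f', hf', h0⟩ := ht (Set.Ioc_subset_Icc_self hmem)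
    simpa [hf'.deriv] using h0
  linarith

theorem _root_.AbsolutelyContinuousOnInterval.sub_le_mul_of_ae_deriv_le {f : ℝ → ℝ} {a b C : ℝ}
    (hab : a ≤ b) (hf : AbsolutelyContinuousOnInterval f a b)
    (h : ∀ᵐ t, t ∈ Set.Icc a b → ∃ f', HasDerivAt f f' t ∧ f' ≤ C) :
    f b - f a ≤ C * (b - a) := by
  have hlin : AbsolutelyContinuousOnInterval (fun t : ℝ => C * t) a b :=
    (LipschitzWith.id.lipschitzOnWith.absolutelyContinuousOnInterval).const_mul C
  have := (hlin.sub hf).le_of_ae_deriv_nonneg hab (by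
    filter_upwards [h] with t ht hmem
    obtain ⟨f', hf', h0⟩ := ht hmem
    have := ((hasDerivAt_id t).const_mul C).sub hf'
    exact ⟨_, this, by simpa using h0⟩)
  simp only [Pi.sub_apply] at this
  linarith

end AbsolutelyContinuous

/-! ### The sum rule for the subdifferential of the exponential loss. -/

section SumRule

variable {d : ℕ}

/-- Fubini: for each fixed s the translate of a full-measure set has full measure. The set is first
shrunk to a measurable one so that the quantifiers may be exchanged. -/
theorem ae_ae_add_smul {P : Euc d → Prop} (hP : ∀ᵐ y, P y) (w : Euc d) :
    ∀ᵐ y : Euc d, ∀ᵐ s : ℝ, P (y + s • w) := by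
  obtain ⟨S, hSP, hSm, hS⟩ : ∃ S ⊆ {y | P y}, MeasurableSet S ∧ ∀ᵐ y, y ∈ S := by
    obtain ⟨T, hT, hTm, hT0⟩ := exists_measurable_superset_of_null (ae_iff.1 hP)
    refine ⟨Tᶜ, fun y hy => by_contra fun h => hy (hT h), hTm.compl, ?_⟩
    rw [ae_iff]
    simpa using hT0
  have hmeas : MeasurableSet {p : Euc d × ℝ | p.1 + p.2 • w ∈ S} :=
    hSm.preimage (by fun_prop : Measurable fun p : Euc d × ℝ => p.1 + p.2 • w)
  have h1 : ∀ᵐ y : Euc d, ∀ᵐ s : ℝ, y + s • w ∈ S := by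
    rw [Measure.ae_ae_comm hmeas]
    refine Eventually.of_forall fun s => ?_
    exact (measurePreserving_add_right volume (s • w)).quasiMeasurePreserving.ae hS
  exact h1.mono fun y hy => hy.mono fun s hs => hSP hs

/-- A bound for the directional derivative which holds almost everywhere on a ball on which the
function is Lipschitz holds at all points of differentiability. -/
theorem inner_gradient_le_of_ae {f : Euc d → ℝ} {x w : Euc d} {r a : ℝ} {K : NNReal}
    (hf : LipschitzOnWith K f (Metric.ball x r))
    (hae : ∀ᵐ y, y ∈ Metric.ball x r → DifferentiableAt ℝ f y ∧ inner ℝ (∇ f y) w ≤ a)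
    {y : Euc d} (hy : y ∈ Metric.ball x r) (hd : DifferentiableAt ℝ f y) :
    inner ℝ (∇ f y) w ≤ a := by
  have hline : ∀ (y : Euc d) (t : ℝ), HasDerivAt (fun s : ℝ => y + s • w) w t := fun y t => by
    simpa using ((hasDerivAt_id t).smul_const w).const_add y
  have hderiv : ∀ (y : Euc d) (t : ℝ), DifferentiableAt ℝ f (y + t • w) →
      HasDerivAt (fun s : ℝ => f (y + s • w)) (inner ℝ (∇ f (y + t • w)) w) t := by
    intro y t hd
    rw [inner_gradient_left]
    exact hd.hasFDerivAt.comp_hasDerivAt t (hline y t)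
  have hseg : ∀ (y : Euc d) (t : ℝ), 0 ≤ t → y ∈ Metric.ball x r → y + t • w ∈ Metric.ball x r →
      ∀ s ∈ Set.Icc 0 t, y + s • w ∈ Metric.ball x r := by
    intro y t ht hy hyt s hs
    rcases ht.eq_or_lt with rfl | ht
    · obtain rfl : s = 0 := le_antisymm hs.2 hs.1
      simpa using hy
    · have := (convex_ball x r).add_smul_sub_mem hy hyt
        (t := s / t) ⟨by have := hs.1; positivity, (div_le_one ht).2 hs.2⟩
      rw [add_sub_cancel_left, smul_smul, div_mul_cancel₀ _ ht.ne'] at this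
      exact this
  -- On almost every line parallel to w the derivative bound holds almost everywhere, so it can be
  -- integrated. Density of such lines and continuity of f then extend the increment bound to every
  -- base point in the ball.
  have hgood : ∀ᵐ y : Euc d, ∀ t : ℝ, 0 ≤ t → y ∈ Metric.ball x r → y + t • w ∈ Metric.ball x r →
      f (y + t • w) - f y ≤ a * t := by
    filter_upwards [ae_ae_add_smul hae w] with y hyae t ht hy hyt
    have hsub := hseg y t ht hy hyt
    have hac : AbsolutelyContinuousOnInterval (fun s : ℝ => f (y + s • w)) 0 t := by
      have hl : LipschitzWith ‖w‖₊ (fun s : ℝ => y + s • w) := by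
        refine LipschitzWith.of_dist_le_mul fun s s' => ?_
        rw [dist_add_left, dist_eq_norm, ← sub_smul, norm_smul, mul_comm, Real.dist_eq]
        rfl
      refine LipschitzOnWith.absolutelyContinuousOnInterval (K := K * ‖w‖₊)
        (LipschitzOnWith.comp hf hl.lipschitzOnWith ?_)
      rw [Set.uIcc_of_le ht]
      exact hsub
    have := hac.sub_le_mul_of_ae_deriv_le (C := a) ht (by
      filter_upwards [hyae] with s hs hmem
      exact ⟨_, hderiv y s (hs (hsub s hmem)).1, (hs (hsub s hmem)).2⟩)
    simpa using this
  have hall : ∀ t : ℝ, 0 ≤ t → y + t • w ∈ Metric.ball x r → f (y + t • w) - f y ≤ a * t := by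
    intro t ht hyt
    obtain ⟨u, hu, hlim⟩ := mem_closure_iff_seq_limit.1 ((Measure.dense_of_ae hgood) y)
    have h1 : Tendsto (fun k => u k + t • w) atTop (𝓝 (y + t • w)) := hlim.add_const _
    have hc1 := (hf.continuousOn.continuousAt (Metric.isOpen_ball.mem_nhds hy)).tendsto.comp hlim
    have hc2 := (hf.continuousOn.continuousAt (Metric.isOpen_ball.mem_nhds hyt)).tendsto.comp h1
    refine le_of_tendsto (hc2.sub hc1) ?_
    filter_upwards [hlim.eventually (Metric.isOpen_ball.mem_nhds hy),
      h1.eventually (Metric.isOpen_ball.mem_nhds hyt)] with k hk1 hk2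
    exact hu k t ht hk1 hk2
  have h0 := (hderiv y 0 (by simpa using hd)).tendsto_slope_zero_right
  simp only [zero_smul, add_zero, zero_add] at h0
  refine le_of_tendsto h0 ?_
  have hin : ∀ᶠ t : ℝ in 𝓝[>] 0, y + t • w ∈ Metric.ball x r := by
    refine Filter.Tendsto.eventually (f := fun t : ℝ => y + t • w) ?_
      (Metric.isOpen_ball.mem_nhds hy)
    have := (hline y 0).continuousAt.tendsto.mono_left (nhdsWithin_le_nhds (s := Set.Ioi 0))
    simpa using this
  filter_upwards [hin, self_mem_nhdsWithin] with t ht ht0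
  have ht0' : 0 < t := ht0
  have := hall t ht0'.le ht
  rw [smul_eq_mul, inv_mul_le_iff₀ ht0']
  linarith

variable {N : ℕ} {q : Fin N → Euc d → ℝ} {x : Euc d}

theorem LipschitzNear.continuousAt {f : Euc d → ℝ} (hf : LipschitzNear f x) :
    ContinuousAt f x := by
  obtain ⟨K, s, hs, hK⟩ := hf
  exact hK.continuousOn.continuousAt hs

theorem LipschitzNear.comp_contDiffAt {f : Euc d → ℝ} {g : ℝ → ℝ} (hf : LipschitzNear f x)
    (hg : ContDiffAt ℝ 1 g (f x)) : LipschitzNear (fun y => g (f y)) x := by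
  have hc := hf.continuousAt
  obtain ⟨K, s, hs, hK⟩ := hf
  obtain ⟨K', t, ht, hK'⟩ := hg.exists_lipschitzOnWith
  exact ⟨K' * K, s ∩ f ⁻¹' t, inter_mem hs (hc ht),
    hK'.comp (hK.mono Set.inter_subset_left) fun y hy => hy.2⟩

theorem LipschitzNear.add {f g : Euc d → ℝ} (hf : LipschitzNear f x) (hg : LipschitzNear g x) :
    LipschitzNear (fun y => f y + g y) x := by
  obtain ⟨K, s, hs, hK⟩ := hf
  obtain ⟨K', t, ht, hK'⟩ := hg
  exact ⟨K + K', s ∩ t, inter_mem hs ht,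
    (hK.mono Set.inter_subset_left).add (hK'.mono Set.inter_subset_right)⟩

theorem LipschitzNear.sum {ι : Type*} {f : ι → Euc d → ℝ} (s : Finset ι)
    (hf : ∀ i ∈ s, LipschitzNear (f i) x) : LipschitzNear (fun y => ∑ i ∈ s, f i y) x := by
  classical
  induction s using Finset.induction_on with
  | empty => simpa using ⟨0, Set.univ, univ_mem, (LipschitzWith.const (0 : ℝ)).lipschitzOnWith⟩
  | insert i s hi ih =>
    simp only [Finset.sum_insert hi]
    exact (hf i (Finset.mem_insert_self i s)).add
      (ih fun j hj => hf j (Finset.mem_insert_of_mem hj))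

/-- The exponential loss of a family of margins. -/
def expLoss (q : Fin N → Euc d → ℝ) (θ : Euc d) : ℝ := ∑ n, Real.exp (-q n θ)

/-- A combination of (sub)gradients of the margins, weighted as in the negative gradient of the
exponential loss. -/
def descentDir (q : Fin N → Euc d → ℝ) (θ : Euc d) (h : Fin N → Euc d) : Euc d :=
  ∑ n, Real.exp (-q n θ) • h n

theorem LipschitzNear.expLoss (hq : ∀ n, LipschitzNear (q n) x) :
    LipschitzNear (expLoss q) x :=
  LipschitzNear.sum _ fun n _ =>
    (hq n).comp_contDiffAt (g := fun y => Real.exp (-y)) (by fun_prop)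

theorem hasGradientAt_expLoss {h : Fin N → Euc d} (hq : ∀ n, HasGradientAt (q n) (h n) x) :
    HasGradientAt (expLoss q) (-descentDir q x h) x := by
  rw [hasGradientAt_iff_hasFDerivAt]
  have h1 : HasFDerivAt (HomNet.expLoss q)
      (∑ n, Real.exp (-q n x) • -(InnerProductSpace.toDual ℝ (Euc d) (h n))) x := by
    unfold HomNet.expLoss
    refine HasFDerivAt.fun_sum fun n _ => ?_
    exact (hq n).hasFDerivAt.neg.exp
  have h2 : InnerProductSpace.toDual ℝ (Euc d) (-descentDir q x h) =
      ∑ n, Real.exp (-q n x) • -(InnerProductSpace.toDual ℝ (Euc d) (h n)) := by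
    simp [descentDir, map_sum, map_smul]
  rw [h2]
  exact h1

/-- The sum rule for the Clarke subdifferential of the exponential loss. -/
theorem exists_descentDir_of_mem_clarkeSubdiff (hq : ∀ n, LipschitzNear (q n) x) {g : Euc d}
    (hg : g ∈ clarkeSubdiff (expLoss q) x) :
    ∃ h : Fin N → Euc d, (∀ n, h n ∈ clarkeSubdiff (q n) x) ∧ g = -descentDir q x h := by
  -- The candidate set is compact and convex, so it is enough to catch the limiting gradients, and
  -- one outside it would be strictly separated by a direction w.
  set T : Set (Euc d) := (fun h : Fin N → Euc d => -descentDir q x h) ''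
    Set.univ.pi fun n => clarkeSubdiff (q n) x with hT
  have hTc : IsCompact T := by
    refine (isCompact_univ_pi fun n => (hq n).isCompact_clarkeSubdiff).image ?_
    unfold descentDir
    fun_prop
  have hTconv : Convex ℝ T := by
    refine Convex.is_linear_image (convex_pi fun n _ => convex_clarkeSubdiff) ⟨?_, ?_⟩
    · intro h h'
      simp [descentDir, smul_add, Finset.sum_add_distrib, add_comm]
    · intro c h
      simp [descentDir, Finset.smul_sum, smul_comm c]
  suffices limitingGradients (expLoss q) x ⊆ T by
    obtain ⟨h, hh, rfl⟩ := convexHull_min this hTconv hg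
    exact ⟨h, fun n => hh n trivial, rfl⟩
  rintro g ⟨u, hu, hud, hug⟩
  by_contra hgT
  obtain ⟨F, a, hFa, hag⟩ := geometric_hahn_banach_closed_point hTconv hTc.isClosed hgT
  obtain ⟨w, rfl⟩ := (InnerProductSpace.toDual ℝ (Euc d)).surjective F
  simp only [InnerProductSpace.toDual_apply_apply] at hFa hag
  have hbd : ∀ n, ∃ K : ℝ, ∀ᶠ y in 𝓝 x, ‖∇ (q n) y‖ ≤ K :=
    fun n => (hq n).exists_norm_gradient_le
  choose K hK using hbd
  have hgrad : ∀ y, (∀ n, DifferentiableAt ℝ (q n) y) →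
      HasGradientAt (expLoss q) (-descentDir q y fun n => ∇ (q n) y) y :=
    fun y hy => hasGradientAt_expLoss fun n => (hy n).hasGradientAt
  -- Otherwise a sequence of violations has, by compactness of the gradients, a limit in T on the
  -- wrong side of the hyperplane.
  have hnear : ∀ᶠ y in 𝓝 x, (∀ n, DifferentiableAt ℝ (q n) y) →
      inner ℝ (∇ (expLoss q) y) w ≤ a := by
    by_contra hcon
    rw [not_eventually] at hcon
    obtain ⟨y, hy, hyP⟩ := exists_seq_forall_of_frequently
      (hcon.and_eventually (eventually_all.2 hK))
    have hmem : ∀ k, (fun n => ∇ (q n) (y k)) ∈ Set.univ.pi fun n =>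
        Metric.closedBall (0 : Euc d) (K n) := fun k n _ => by simpa using (hyP k).2 n
    obtain ⟨h, -, φ, hφ, hlim⟩ :=
      (isCompact_univ_pi fun n => isCompact_closedBall (0 : Euc d) (K n)).tendsto_subseq hmem
    have hyφ : Tendsto (fun k => y (φ k)) atTop (𝓝 x) := hy.comp hφ.tendsto_atTop
    have hdiff : ∀ k n, DifferentiableAt ℝ (q n) (y k) := fun k => by
      have := (hyP k).1
      push Not at this
      exact this.1
    have hhmem : -descentDir q x h ∈ T := by
      refine ⟨h, fun n _ => subset_convexHull ℝ _ ?_, rfl⟩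
      exact ⟨fun k => y (φ k), hyφ, fun k => hdiff (φ k) n, (tendsto_pi_nhds.1 hlim) n⟩
    have hlimD : Tendsto (fun k => -descentDir q (y (φ k)) fun n => ∇ (q n) (y (φ k))) atTop
        (𝓝 (-descentDir q x h)) := by
      refine Tendsto.neg (tendsto_finsetSum _ fun n _ => ?_)
      refine Tendsto.smul ?_ ((tendsto_pi_nhds.1 hlim) n)
      exact (Real.continuous_exp.tendsto _).comp ((hq n).continuousAt.tendsto.comp hyφ).neg
    have hle : a ≤ inner ℝ w (-descentDir q x h) := by
      refine ge_of_tendsto (tendsto_const_nhds.inner hlimD) (Eventually.of_forall fun k => ?_)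
      have := (hyP (φ k)).1
      push Not at this
      rw [(hgrad _ (hdiff (φ k))).gradient, real_inner_comm] at this
      exact this.2.le
    exact absurd (hFa _ hhmem) (not_lt.2 hle)
  obtain ⟨K', s, hs, hK'⟩ := LipschitzNear.expLoss hq
  choose r hr _ hae using fun n => (hq n).exists_ae_differentiableAt
  have hball : ∀ᶠ y in 𝓝 x, y ∈ s ∧ (∀ n, y ∈ Metric.ball x (r n)) ∧
      ((∀ n, DifferentiableAt ℝ (q n) y) → inner ℝ (∇ (expLoss q) y) w ≤ a) :=
    Filter.Eventually.and hs
      ((eventually_all.2 fun n => Metric.ball_mem_nhds x (hr n)).and hnear)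
  obtain ⟨R, hR, hball⟩ := Metric.eventually_nhds_iff_ball.1 hball
  -- The loss may be differentiable where some margin is not. Such points form a null set, and
  -- `inner_gradient_le_of_ae` carries the bound over to them.
  have hfin : ∀ y ∈ Metric.ball x R, DifferentiableAt ℝ (expLoss q) y →
      inner ℝ (∇ (expLoss q) y) w ≤ a := by
    intro y hy hd
    refine inner_gradient_le_of_ae (hK'.mono fun y hy => (hball y hy).1) ?_ hy hd
    filter_upwards [ae_all_iff.2 hae] with y hyae hy
    have hdy : ∀ n, DifferentiableAt ℝ (q n) y := fun n => hyae n ((hball y hy).2.1 n)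
    exact ⟨(hgrad y hdy).differentiableAt, (hball y hy).2.2 hdy⟩
  have : inner ℝ w g ≤ a := by
    refine le_of_tendsto (tendsto_const_nhds.inner hug) ?_
    filter_upwards [hu.eventually (Metric.ball_mem_nhds x hR)] with k hk
    rw [real_inner_comm]
    exact hfin _ hk (hud k)
  linarith

end SumRule

/-! ### Homogeneous margins, and passage from aligned points to KKT directions. -/

section Homogeneous

variable {d N : ℕ} {q : Fin N → Euc d → ℝ} {θ : Euc d} {L : ℝ}

theorem exp_neg_le_expLoss (n : Fin N) : Real.exp (-q n θ) ≤ expLoss q θ :=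
  Finset.single_le_sum (f := fun n => Real.exp (-q n θ)) (fun _ _ => (Real.exp_pos _).le)
    (Finset.mem_univ n)

theorem expLoss_pos (hN : 0 < N) : 0 < expLoss q θ :=
  (Real.exp_pos _).trans_le (exp_neg_le_expLoss ⟨0, hN⟩)

theorem neg_log_expLoss_le (n : Fin N) : -Real.log (expLoss q θ) ≤ q n θ := by
  have := Real.log_le_log (Real.exp_pos _) (exp_neg_le_expLoss (q := q) (θ := θ) n)
  rw [Real.log_exp] at this
  linarith

/-- The margins, weighted as in the exponential loss. -/
def weightedMargin (q : Fin N → Euc d → ℝ) (θ : Euc d) : ℝ := ∑ n, Real.exp (-q n θ) * q n θ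

/-- Every margin is at least log(1/ℒ), because each summand of ℒ is at most ℒ. -/
theorem le_weightedMargin :
    expLoss q θ * -Real.log (expLoss q θ) ≤ weightedMargin q θ := by
  unfold weightedMargin
  conv_lhs => lhs; unfold expLoss
  rw [Finset.sum_mul]
  exact Finset.sum_le_sum fun n _ =>
    mul_le_mul_of_nonneg_left (neg_log_expLoss_le n) (Real.exp_pos _).le

theorem inner_descentDir {h : Fin N → Euc d} (hh : ∀ n, inner ℝ (h n) θ = L * q n θ) :
    inner ℝ (descentDir q θ h) θ = L * weightedMargin q θ := by
  simp only [descentDir, weightedMargin, sum_inner, real_inner_smul_left, hh, Finset.mul_sum]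
  exact Finset.sum_congr rfl fun n _ => by ring

theorem norm_descentDir_le {h : Fin N → Euc d} {C : ℝ} (hh : ∀ n, ‖h n‖ ≤ C) :
    ‖descentDir q θ h‖ ≤ expLoss q θ * C := by
  unfold descentDir expLoss
  rw [Finset.sum_mul]
  refine (norm_sum_le _ _).trans (Finset.sum_le_sum fun n _ => ?_)
  rw [norm_smul, Real.norm_of_nonneg (Real.exp_pos _).le]
  exact mul_le_mul_of_nonneg_left (hh n) (Real.exp_pos _).le

/-- A positively homogeneous function which is locally Lipschitz away from the origin. -/
structure IsHomLip (L : ℝ) (f : Euc d → ℝ) : Prop where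
  hom : ∀ (c : ℝ) (θ : Euc d), 0 < c → f (c • θ) = c ^ L * f θ
  lip : ∀ θ, θ ≠ 0 → LipschitzNear f θ

/-- The predicate is left abstract so that the lemma serves both for values and for all subgradients
on the unit sphere; homogeneity then spreads these bounds to all nonzero points. -/
theorem _root_.IsCompact.exists_bound_of_locally {X : Type*} [TopologicalSpace X] {S : Set X}
    (hS : IsCompact S) {P : X → ℝ → Prop} (hmono : ∀ x a b, a ≤ b → P x a → P x b)
    (hloc : ∀ x ∈ S, ∃ K, ∀ᶠ y in 𝓝 x, P y K) : ∃ K, ∀ x ∈ S, P x K := by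
  refine hS.induction_on (p := fun T => ∃ K, ∀ x ∈ T, P x K) ⟨0, by simp⟩ ?_ ?_ ?_
  · rintro s t hst ⟨K, hK⟩
    exact ⟨K, fun x hx => hK x (hst hx)⟩
  · rintro s t ⟨K, hK⟩ ⟨K', hK'⟩
    refine ⟨max K K', fun x hx => ?_⟩
    rcases hx with hx | hx
    · exact hmono _ _ _ (le_max_left _ _) (hK x hx)
    · exact hmono _ _ _ (le_max_right _ _) (hK' x hx)
  · intro x hx
    obtain ⟨K, hK⟩ := hloc x hx
    exact ⟨{y | P y K}, mem_nhdsWithin_of_mem_nhds hK, K, fun y hy => hy⟩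

theorem norm_normalized {θ : Euc d} (hθ : θ ≠ 0) : ‖‖θ‖⁻¹ • θ‖ = 1 := by
  simpa using norm_smul_inv_norm (𝕜 := ℝ) hθ

theorem smul_normalized {θ : Euc d} (hθ : θ ≠ 0) : ‖θ‖ • ‖θ‖⁻¹ • θ = θ :=
  smul_inv_smul₀ (norm_ne_zero_iff.2 hθ) θ

theorem ne_zero_of_norm_eq_one {θ : Euc d} (h : ‖θ‖ = 1) : θ ≠ 0 := by
  rintro rfl
  simp at h

theorem IsHomLip.exists_abs_le {f : Euc d → ℝ} (hf : IsHomLip L f) :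
    ∃ B : ℝ, ∀ θ, θ ≠ 0 → |f θ| ≤ B * ‖θ‖ ^ L := by
  obtain ⟨B, hB⟩ := (isCompact_sphere (0 : Euc d) 1).exists_bound_of_locally
    (P := fun θ B => |f θ| ≤ B) (fun _ _ _ hab h => h.trans hab) fun θ hθ => by
      have hθ' : θ ≠ 0 := ne_zero_of_norm_eq_one (by simpa using hθ)
      have := (hf.lip θ hθ').continuousAt.abs
      exact ⟨|f θ| + 1, (this.eventually (gt_mem_nhds (lt_add_one _))).mono fun _ h => h.le⟩
  refine ⟨B, fun θ hθ => ?_⟩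
  have hpos : 0 < ‖θ‖ := norm_pos_iff.2 hθ
  have h1 := hB (‖θ‖⁻¹ • θ) (by simpa using norm_normalized hθ)
  have h2 := hf.hom ‖θ‖ (‖θ‖⁻¹ • θ) hpos
  rw [smul_normalized hθ] at h2
  rw [h2, abs_mul, abs_of_pos (Real.rpow_pos_of_pos hpos L), mul_comm]
  exact mul_le_mul_of_nonneg_right h1 (Real.rpow_pos_of_pos hpos L).le

theorem IsHomLip.normalized_mem {f : Euc d → ℝ} (hf : IsHomLip L f) {θ g : Euc d} (hθ : θ ≠ 0)
    (hg : g ∈ clarkeSubdiff f θ) : ‖θ‖⁻¹ ^ (L - 1) • g ∈ clarkeSubdiff f (‖θ‖⁻¹ • θ) :=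
  smul_mem_clarkeSubdiff hf.hom (inv_pos.2 (norm_pos_iff.2 hθ)) hg

theorem IsHomLip.exists_norm_le {f : Euc d → ℝ} (hf : IsHomLip L f) :
    ∃ B : ℝ, ∀ θ, θ ≠ 0 → ∀ g ∈ clarkeSubdiff f θ, ‖g‖ ≤ B * ‖θ‖ ^ (L - 1) := by
  obtain ⟨B, hB⟩ := (isCompact_sphere (0 : Euc d) 1).exists_bound_of_locally
    (P := fun θ B => ∀ g ∈ clarkeSubdiff f θ, ‖g‖ ≤ B)
    (fun _ _ _ hab h g hg => (h g hg).trans hab) fun θ hθ =>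
      (hf.lip θ (ne_zero_of_norm_eq_one (by simpa using hθ))).exists_norm_le
  refine ⟨B, fun θ hθ g hg => ?_⟩
  have hpos : 0 < ‖θ‖ := norm_pos_iff.2 hθ
  have h1 := hB (‖θ‖⁻¹ • θ) (by simpa using norm_normalized hθ) _ (hf.normalized_mem hθ hg)
  have hr := Real.rpow_pos_of_pos hpos (L - 1)
  rw [norm_smul, Real.inv_rpow hpos.le, norm_inv, Real.norm_of_nonneg hr.le,
    inv_mul_le_iff₀ hr] at h1
  linarith

theorem exists_uniform_abs_le (hq : ∀ n, IsHomLip L (q n)) :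
    ∃ B : ℝ, 0 < B ∧ ∀ n θ, θ ≠ 0 → |q n θ| ≤ B * ‖θ‖ ^ L := by
  choose B hB using fun n => (hq n).exists_abs_le
  refine ⟨∑ n, |B n| + 1, by positivity, fun n θ hθ => (hB n θ hθ).trans ?_⟩
  gcongr
  have := Finset.single_le_sum (f := fun n => |B n|) (fun _ _ => abs_nonneg _) (Finset.mem_univ n)
  have := le_abs_self (B n)
  linarith

theorem exists_uniform_norm_le (hq : ∀ n, IsHomLip L (q n)) :
    ∃ B : ℝ, 0 < B ∧ ∀ n θ, θ ≠ 0 → ∀ g ∈ clarkeSubdiff (q n) θ, ‖g‖ ≤ B * ‖θ‖ ^ (L - 1) := by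
  choose B hB using fun n => (hq n).exists_norm_le
  refine ⟨∑ n, |B n| + 1, by positivity, fun n θ hθ g hg => (hB n θ hθ g hg).trans ?_⟩
  gcongr
  have := Finset.single_le_sum (f := fun n => |B n|) (fun _ _ => abs_nonneg _) (Finset.mem_univ n)
  have := le_abs_self (B n)
  linarith

/-- With b the cosine of the angle, the left side is 2 - 2b. From 1 ≤ (1 + ε) b² and b ≤ 1 follows 1
≤ (1 + ε) b, so 1 - b ≤ ε. -/
theorem norm_normalized_sub_sq_le {p z : Euc d} {ε : ℝ} (hε : 0 ≤ ε) (hpz : 0 < inner ℝ p z)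
    (h : ‖p‖ ^ 2 * ‖z‖ ^ 2 ≤ (1 + ε) * inner ℝ p z ^ 2) :
    ‖‖p‖⁻¹ • p - ‖z‖⁻¹ • z‖ ^ 2 ≤ 2 * ε := by
  have hp : p ≠ 0 := by
    rintro rfl
    simp at hpz
  have hz : z ≠ 0 := by
    rintro rfl
    simp at hpz
  have hp' : 0 < ‖p‖ := norm_pos_iff.2 hp
  have hz' : 0 < ‖z‖ := norm_pos_iff.2 hz
  rw [norm_sub_sq_real, norm_normalized hp, norm_normalized hz, real_inner_smul_left,
    real_inner_smul_right]
  set b := ‖p‖⁻¹ * (‖z‖⁻¹ * inner ℝ p z) with hb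
  have hb0 : 0 < b := by positivity
  have hb1 : b ≤ 1 := by
    have := real_inner_le_norm p z
    rw [hb, ← mul_assoc, ← mul_inv, inv_mul_le_iff₀ (by positivity)]
    linarith
  have hb2 : 1 ≤ (1 + ε) * b ^ 2 := by
    have : (1 + ε) * b ^ 2 = ((1 + ε) * inner ℝ p z ^ 2) / (‖p‖ ^ 2 * ‖z‖ ^ 2) := by
      rw [hb]
      field_simp
    rw [this, one_le_div (by positivity)]
    exact h
  nlinarith [mul_nonneg hε hb0.le]

/-- `v` satisfies the first order optimality conditions for minimizing the norm under a
lower bound for the margins `q n`, up to scaling. -/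
def IsKKTDirection (q : Fin N → Euc d → ℝ) (v : Euc d) : Prop :=
  ∃ (lam : Fin N → ℝ) (g : Fin N → Euc d), (∀ n, 0 ≤ lam n) ∧
    (∀ n, g n ∈ clarkeSubdiff (q n) v) ∧ v = ∑ n, lam n • g n ∧
    (∀ n k, lam n ≠ 0 → q n v ≤ q k v) ∧ ∀ n, 0 < q n v

/-- There are points in directions close to `v`, of large norm and with normalized margin at least
`γ`, at which a descent direction of the exponential loss is almost parallel to the point. -/
def HasAlignedPoints (q : Fin N → Euc d → ℝ) (L γ : ℝ) (v : Euc d) : Prop :=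
  ∀ ε : ℝ, 0 < ε → ∃ (z : Euc d) (h : Fin N → Euc d), z ≠ 0 ∧
    (∀ n, h n ∈ clarkeSubdiff (q n) z) ∧ γ * ‖z‖ ^ L ≤ -Real.log (expLoss q z) ∧
    ‖‖z‖⁻¹ • z - v‖ < ε ∧ 1 / ε < ‖z‖ ∧
    ‖descentDir q z h‖ ^ 2 * ‖z‖ ^ 2 ≤ (1 + ε) * inner ℝ (descentDir q z h) z ^ 2

/-- Divide p by its norm and rescale the subgradients to the unit sphere. Both the weights and the
subgradients then lie in compact sets, and every KKT condition survives the limit along a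
subsequence. -/
theorem HasAlignedPoints.isKKTDirection (hN : 0 < N) (hL : 0 < L) (hq : ∀ n, IsHomLip L (q n))
    {γ : ℝ} (hγ : 0 < γ) {v : Euc d} (H : HasAlignedPoints q L γ v) : IsKKTDirection q v := by
  have hε : ∀ m : ℕ, (0 : ℝ) < 1 / ((m : ℝ) + 1) := fun m => by positivity
  have hε0 : Tendsto (fun m : ℕ => 1 / ((m : ℝ) + 1)) atTop (𝓝 0) :=
    tendsto_one_div_add_atTop_nhds_zero_nat
  choose z h hz hh hγz hzv hzρ hal using fun m : ℕ => H _ (hε m)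
  have hρ : ∀ m, 0 < ‖z m‖ := fun m => norm_pos_iff.2 (hz m)
  have hρL : ∀ m, 0 < ‖z m‖ ^ L := fun m => Real.rpow_pos_of_pos (hρ m) L
  have hρlim : Tendsto (fun m => ‖z m‖) atTop atTop := by
    refine tendsto_atTop_mono (fun m => ?_) tendsto_natCast_atTop_atTop
    have := hzρ m
    rw [one_div_one_div] at this
    linarith
  have hzlim : Tendsto (fun m => ‖z m‖⁻¹ • z m) atTop (𝓝 v) := by
    rw [tendsto_iff_norm_sub_tendsto_zero]
    exact squeeze_zero (fun _ => norm_nonneg _) (fun m => (hzv m).le) hε0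
  have hv : v ≠ 0 := by
    refine ne_zero_of_norm_eq_one (tendsto_nhds_unique hzlim.norm ?_)
    simp only [norm_normalized (hz _)]
    exact tendsto_const_nhds
  set p : ℕ → Euc d := fun m => descentDir q (z m) (h m)
  have hell : ∀ m, 0 < expLoss q (z m) := fun m => expLoss_pos hN
  have hpz : ∀ m, expLoss q (z m) * (L * (γ * ‖z m‖ ^ L)) ≤ inner ℝ (p m) (z m) := fun m => by
    rw [inner_descentDir (L := L)
      fun n => ((hq n).lip _ (hz m)).inner_self_of_mem_clarkeSubdiff (hq n).hom (hh m n)]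
    have h1 := le_weightedMargin (q := q) (θ := z m)
    have h2 := mul_le_mul_of_nonneg_left (hγz m) (hell m).le
    nlinarith
  have hpz0 : ∀ m, 0 < inner ℝ (p m) (z m) := fun m =>
    lt_of_lt_of_le (by have := hell m; have := hρL m; positivity) (hpz m)
  have hp : ∀ m, 0 < ‖p m‖ := fun m => by
    refine norm_pos_iff.2 fun h0 => ?_
    have := hpz0 m
    rw [h0, inner_zero_left] at this
    exact lt_irrefl _ this
  set g : ℕ → Fin N → Euc d := fun m n => ‖z m‖⁻¹ ^ (L - 1) • h m n
  have hg : ∀ m n, g m n ∈ clarkeSubdiff (q n) (‖z m‖⁻¹ • z m) := fun m n =>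
    (hq n).normalized_mem (hz m) (hh m n)
  -- The power of ‖z m‖ undoes the rescaling in `g`, so that these weights reproduce p/‖p‖ exactly.
  set lam : ℕ → Fin N → ℝ := fun m n => Real.exp (-q n (z m)) * ‖z m‖ ^ (L - 1) / ‖p m‖
  have hlam0 : ∀ m n, 0 ≤ lam m n := fun m n => by
    have := Real.rpow_pos_of_pos (hρ m) (L - 1)
    positivity
  have hsum : ∀ m, ∑ n, lam m n • g m n = ‖p m‖⁻¹ • p m := fun m => by
    simp only [p, descentDir, Finset.smul_sum]
    refine Finset.sum_congr rfl fun n _ => ?_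
    simp only [lam, g, smul_smul]
    congr 1
    have := (Real.rpow_pos_of_pos (hρ m) (L - 1)).ne'
    rw [Real.inv_rpow (hρ m).le]
    field_simp
    rfl
  -- Cauchy–Schwarz and the margin bound give ‖p‖ ≥ ℒ L γ ‖z‖ ^ (L - 1).
  have hlam1 : ∀ m n, lam m n * (L * γ) ≤ Real.exp (-q n (z m)) / expLoss q (z m) := fun m n => by
    have h1 := (hpz m).trans (real_inner_le_norm _ _)
    have h2 : ‖z m‖ ^ L = ‖z m‖ ^ (L - 1) * ‖z m‖ := by
      rw [← Real.rpow_add_one (hρ m).ne', sub_add_cancel]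
    rw [h2] at h1
    have h3 : expLoss q (z m) * (L * γ * ‖z m‖ ^ (L - 1)) ≤ ‖p m‖ :=
      le_of_mul_le_mul_right (by nlinarith) (hρ m)
    simp only [lam]
    rw [le_div_iff₀ (hell m), div_mul_eq_mul_div, div_mul_eq_mul_div, div_le_iff₀ (hp m)]
    nlinarith [Real.exp_pos (-q n (z m))]
  have hlam2 : ∀ m n, lam m n ≤ 1 / (L * γ) := fun m n => by
    rw [le_div_iff₀ (by positivity)]
    exact (hlam1 m n).trans ((div_le_one (hell m)).2 (exp_neg_le_expLoss n))
  obtain ⟨B, hB, hgB⟩ := exists_uniform_norm_le hq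
  have hmem : ∀ m, (lam m, g m) ∈ (Set.univ.pi fun _ : Fin N => Set.Icc 0 (1 / (L * γ))) ×ˢ
      (Set.univ.pi fun _ : Fin N => Metric.closedBall (0 : Euc d) B) := fun m => by
    refine ⟨fun n _ => ⟨hlam0 m n, hlam2 m n⟩, fun n _ => ?_⟩
    have hne := ne_zero_of_norm_eq_one (norm_normalized (hz m))
    have := hgB n _ hne _ (hg m n)
    rw [norm_normalized (hz m), Real.one_rpow, mul_one] at this
    simpa using this
  obtain ⟨⟨lam', g'⟩, -, φ, hφ, hlim⟩ := ((isCompact_univ_pi fun _ : Fin N => isCompact_Icc).prod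
    (isCompact_univ_pi fun _ : Fin N => isCompact_closedBall (0 : Euc d) B)).tendsto_subseq hmem
  have hlaml : ∀ n, Tendsto (fun m => lam (φ m) n) atTop (𝓝 (lam' n)) :=
    tendsto_pi_nhds.1 ((continuous_fst.tendsto _).comp hlim)
  have hgl : ∀ n, Tendsto (fun m => g (φ m) n) atTop (𝓝 (g' n)) :=
    tendsto_pi_nhds.1 ((continuous_snd.tendsto _).comp hlim)
  have hzφ : Tendsto (fun m => ‖z (φ m)‖⁻¹ • z (φ m)) atTop (𝓝 v) := hzlim.comp hφ.tendsto_atTop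
  have hqlim : ∀ n, Tendsto (fun m => q n (‖z (φ m)‖⁻¹ • z (φ m))) atTop (𝓝 (q n v)) := fun n =>
    ((hq n).lip v hv).continuousAt.tendsto.comp hzφ
  have hqscale : ∀ n m, q n (z m) = ‖z m‖ ^ L * q n (‖z m‖⁻¹ • z m) := fun n m => by
    rw [← (hq n).hom _ _ (hρ m), smul_normalized (hz m)]
  refine ⟨lam', g', fun n => ge_of_tendsto' (hlaml n) fun m => hlam0 _ n, fun n => ?_, ?_, ?_, ?_⟩
  · exact ((hq n).lip v hv).mem_clarkeSubdiff_of_tendsto hzφ (hgl n) fun m => hg _ n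
  · have h1 : Tendsto (fun m => ∑ n, lam (φ m) n • g (φ m) n) atTop
        (𝓝 (∑ n, lam' n • g' n)) := tendsto_finsetSum _ fun n _ => (hlaml n).smul (hgl n)
    have h2 : Tendsto (fun m => ‖‖p m‖⁻¹ • p m - ‖z m‖⁻¹ • z m‖ ^ 2) atTop (𝓝 0) := by
      refine squeeze_zero (fun _ => by positivity)
        (fun m => norm_normalized_sub_sq_le (hε m).le (hpz0 m) (hal m)) ?_
      simpa using hε0.const_mul 2
    have h3 : Tendsto (fun m => ‖p m‖⁻¹ • p m - ‖z m‖⁻¹ • z m) atTop (𝓝 0) := by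
      rw [tendsto_zero_iff_norm_tendsto_zero]
      have := h2.sqrt
      simpa [Real.sqrt_sq] using this
    have h4 : Tendsto (fun m => ‖p m‖⁻¹ • p m) atTop (𝓝 v) := by
      simpa using h3.add hzlim
    refine tendsto_nhds_unique (h4.comp hφ.tendsto_atTop) (h1.congr fun m => ?_)
    exact hsum _
  -- Complementary slackness: if q n v > q k v, the weight of n is at most a constant times exp(q k
  -- z - q n z). By homogeneity this exponent is at most -δ ‖z‖ ^ L eventually.
  · intro n k hn
    by_contra! hlt
    apply hn
    set δ := (q n v - q k v) / 2
    have hδ : 0 < δ := by simp only [δ]; linarith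
    have hev : ∀ᶠ m in atTop, δ <
        q n (‖z (φ m)‖⁻¹ • z (φ m)) - q k (‖z (φ m)‖⁻¹ • z (φ m)) :=
      ((hqlim n).sub (hqlim k)).eventually (lt_mem_nhds (by simp only [δ]; linarith))
    have hup : ∀ᶠ m in atTop, lam (φ m) n ≤ Real.exp (-(δ * ‖z (φ m)‖ ^ L)) / (L * γ) := by
      filter_upwards [hev] with m hm
      rw [le_div_iff₀ (by positivity)]
      refine (hlam1 (φ m) n).trans ?_
      rw [div_le_iff₀ (hell _)]
      have h1 := exp_neg_le_expLoss (q := q) (θ := z (φ m)) k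
      refine le_trans ?_ (mul_le_mul_of_nonneg_left h1 (Real.exp_pos _).le)
      rw [← Real.exp_add, Real.exp_le_exp, hqscale n, hqscale k]
      nlinarith [hρL (φ m)]
    have hz0 : Tendsto (fun m => Real.exp (-(δ * ‖z (φ m)‖ ^ L)) / (L * γ)) atTop (𝓝 0) := by
      have h1 : Tendsto (fun m => δ * ‖z (φ m)‖ ^ L) atTop atTop :=
        ((tendsto_rpow_atTop hL).comp (hρlim.comp hφ.tendsto_atTop)).const_mul_atTop hδ
      have := (Real.tendsto_exp_neg_atTop_nhds_zero.comp h1).div_const (L * γ)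
      simpa using this
    exact le_antisymm (le_of_tendsto_of_tendsto (hlaml n) hz0 hup)
      (ge_of_tendsto' (hlaml n) fun m => hlam0 _ n)
  · intro n
    refine hγ.trans_le (ge_of_tendsto' (hqlim n) fun m => ?_)
    have h1 := (hγz (φ m)).trans (neg_log_expLoss_le n)
    rw [hqscale n, mul_comm] at h1
    exact le_of_mul_le_mul_left h1 (hρL _)

end Homogeneous

/-! ### From KKT directions to solutions of the kernel SVM. -/

section SupportVector

variable {d dx N : ℕ} {Φ : Euc d → Euc dx → ℝ} {xs : Fin N → Euc dx} {ys : Fin N → ℝ} {L : ℝ}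
  {v : Euc d}

/-- The scale is α = 1/(L m), with m the smallest margin at v, which makes the tightest linearized
constraint equal to 1. With S the sum of the multipliers, every feasible u has ⟨v, u⟩ ≥ S, whereas
‖α v‖² = α S. Hence ‖α v‖² + ‖u - α v‖² ≤ ‖u‖², which gives optimality and uniqueness at once. -/
theorem isMaxMarginDirection_of_stationary (hN : 0 < N) (hL : 0 < L) {φ : Euc dx → Euc d}
    {lam : Fin N → ℝ} (hlam : ∀ n, 0 ≤ lam n)
    (hinner : ∀ n, inner ℝ (φ (xs n)) v = L * Φ v (xs n))
    (hv : v = ∑ n, (lam n * ys n) • φ (xs n))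
    (hcomp : ∀ n k, lam n ≠ 0 → margin Φ xs ys n v ≤ margin Φ xs ys k v)
    (hpos : ∀ n, 0 < margin Φ xs ys n v) :
    IsMaxMarginDirection (featureKernel φ) φ xs ys v := by
  obtain ⟨n₀, -, hn₀⟩ := Finset.exists_min_image Finset.univ (fun n => margin Φ xs ys n v)
    ⟨⟨0, hN⟩, Finset.mem_univ _⟩
  set m := margin Φ xs ys n₀ v with hm
  have hm0 : 0 < m := hpos n₀
  set S := ∑ n, lam n with hS
  have hinn : ∀ u, inner ℝ v u = ∑ n, lam n * (ys n * inner ℝ u (φ (xs n))) := fun u => by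
    conv_lhs => rw [hv]
    rw [sum_inner]
    refine Finset.sum_congr rfl fun n _ => ?_
    rw [real_inner_smul_left, real_inner_comm]
    ring
  have hmarg : ∀ n, ys n * inner ℝ v (φ (xs n)) = L * margin Φ xs ys n v := fun n => by
    rw [real_inner_comm, hinner, margin]
    ring
  have hvv : inner ℝ v v = L * m * S := by
    rw [hinn, hS, Finset.mul_sum]
    refine Finset.sum_congr rfl fun n _ => ?_
    rw [hmarg]
    by_cases h0 : lam n = 0
    · simp [h0]
    · have : margin Φ xs ys n v = m := le_antisymm (hcomp n n₀ h0) (hn₀ n (Finset.mem_univ _))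
      rw [this]
      ring
  have hlow : ∀ u, SVMFeasible φ xs ys u → S ≤ inner ℝ v u := fun u hu => by
    rw [hinn]
    exact Finset.sum_le_sum fun n _ => le_mul_of_one_le_right (hlam n) (hu n)
  have hα : 0 < 1 / (L * m) := by positivity
  have hkey : ∀ u, SVMFeasible φ xs ys u →
      ‖(1 / (L * m)) • v‖ ^ 2 + ‖u - (1 / (L * m)) • v‖ ^ 2 ≤ ‖u‖ ^ 2 := fun u hu => by
    have h1 : ‖(1 / (L * m)) • v‖ ^ 2 = (1 / (L * m)) * S := by
      rw [norm_smul, mul_pow, ← real_inner_self_eq_norm_sq v, hvv, Real.norm_of_nonneg hα.le]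
      field_simp
    have h2 := mul_le_mul_of_nonneg_left (hlow u hu) hα.le
    rw [norm_sub_sq_real, real_inner_smul_right, real_inner_comm]
    linarith
  refine ⟨1 / (L * m), hα, fun _ _ => rfl, fun n => ?_, fun u hu => ?_, fun u hu hle => ?_⟩
  · rw [real_inner_smul_left, mul_left_comm, hmarg, one_div, ← div_eq_inv_mul,
      one_le_div (by positivity)]
    exact mul_le_mul_of_nonneg_left (hn₀ n (Finset.mem_univ _)) hL.le
  · have := hkey u hu
    nlinarith [sq_nonneg ‖u - (1 / (L * m)) • v‖]
  · have := hkey u hu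
    have h0 : ‖u - (1 / (L * m)) • v‖ ^ 2 ≤ 0 := by linarith
    have h1 : ‖u - (1 / (L * m)) • v‖ = 0 := by
      nlinarith [norm_nonneg (u - (1 / (L * m)) • v)]
    exact sub_eq_zero.1 (norm_eq_zero.1 h1)

theorem mem_clarkeSubdiff_of_margin (hys : ∀ n, ys n = 1 ∨ ys n = -1) {n : Fin N} {g : Euc d}
    (hg : g ∈ clarkeSubdiff (margin Φ xs ys n) v) :
    ys n • g ∈ clarkeSubdiff (fun ϑ => Φ ϑ (xs n)) v := by
  have h := smul_mem_clarkeSubdiff_const_mul (ys n) hg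
  have h1 : (fun y => ys n * margin Φ xs ys n y) = fun ϑ => Φ ϑ (xs n) := by
    funext y
    rcases hys n with h | h <;> simp [margin, h]
  rwa [h1] at h

/-- Data points sharing an input may come with different subgradients, while a feature map takes one
value per input. The value is their average weighted by the multipliers, which stays in the
subdifferential by convexity and leaves the stationarity sum unchanged. -/
theorem IsKKTDirection.exists_feature (hys : ∀ n, ys n = 1 ∨ ys n = -1) (hN : 0 < N) (hL : 0 < L)
    (hΦ : ∀ x, IsHomLip L fun ϑ => Φ ϑ x) (hv : v ≠ 0) (h : IsKKTDirection (margin Φ xs ys) v) :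
    ∃ φ : Euc dx → Euc d, (∀ x, φ x ∈ clarkeSubdiff (fun ϑ => Φ ϑ x) v) ∧
      IsMaxMarginDirection (featureKernel φ) φ xs ys v := by
  classical
  obtain ⟨lam, g, hlam, hg, hvg, hcomp, hpos⟩ := h
  have hlip : ∀ x, LipschitzNear (fun ϑ => Φ ϑ x) v := fun x => (hΦ x).lip v hv
  choose e he using fun x => (hlip x).nonempty_clarkeSubdiff
  set W : Euc dx → ℝ := fun x => ∑ n, if xs n = x then lam n else 0 with hW
  have hW0 : ∀ x, 0 ≤ W x := fun x =>
    Finset.sum_nonneg fun n _ => by split_ifs <;> simp [hlam n]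
  -- Terms with another input have weight zero; `e x` is put there only so that every point of the
  -- convex combination is a subgradient.
  set φ : Euc dx → Euc d := fun x => if W x = 0 then e x else
    ∑ n, ((if xs n = x then lam n else 0) / W x) • (if xs n = x then ys n • g n else e x) with hφ
  have hmem : ∀ x, φ x ∈ clarkeSubdiff (fun ϑ => Φ ϑ x) v := fun x => by
    simp only [hφ]
    split_ifs with h0
    · exact he x
    · refine convex_clarkeSubdiff.sum_mem (fun n _ => ?_) ?_ fun n _ => ?_
      · have := hlam n
        have := hW0 x
        split_ifs <;> positivity
      · rw [← Finset.sum_div]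
        exact div_self h0
      · split_ifs with hx
        · rw [← hx]
          exact mem_clarkeSubdiff_of_margin hys (hg n)
        · exact he x
  refine ⟨φ, hmem, isMaxMarginDirection_of_stationary (Φ := Φ) hN hL hlam (fun n => ?_) ?_
    hcomp hpos⟩
  · exact (hlip _).inner_self_of_mem_clarkeSubdiff (hΦ _).hom (hmem _)
  -- Equal inputs force equal labels, since both margins at v are positive.
  · have hsign : ∀ n k, xs k = xs n → ys n * ys k = 1 := fun n k hnk => by
      have h1 := hpos n
      have h2 := hpos k
      simp only [margin, hnk] at h1 h2
      rcases hys n with hn | hn <;> rcases hys k with hk | hk <;> rw [hn] at h1 ⊢ <;>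
        rw [hk] at h2 ⊢ <;> linarith
    have hterm : ∀ n, (lam n * ys n) • φ (xs n) =
        ∑ k, if xs k = xs n then (lam n * (lam k / W (xs k))) • g k else 0 := fun n => by
      by_cases h0 : lam n = 0
      · simp [h0]
      · have hWn : W (xs n) ≠ 0 := by
          have h1 : lam n ≤ W (xs n) := by
            have := Finset.single_le_sum (f := fun k => if xs k = xs n then lam k else 0)
              (fun k _ => by split_ifs <;> simp [hlam k]) (Finset.mem_univ n)
            simpa using this
          have h2 := lt_of_le_of_ne (hlam n) (Ne.symm h0)
          linarith
        simp only [hφ, if_neg hWn, Finset.smul_sum]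
        refine Finset.sum_congr rfl fun k _ => ?_
        split_ifs with hk
        · rw [smul_smul, smul_smul, hk]
          congr 1
          calc lam n * ys n * (lam k / W (xs n)) * ys k
              = lam n * (lam k / W (xs n)) * (ys n * ys k) := by ring
            _ = _ := by rw [hsign n k hk, mul_one]
        · simp
    rw [Finset.sum_congr rfl fun n _ => hterm n, Finset.sum_comm]
    conv_lhs => rw [hvg]
    refine Finset.sum_congr rfl fun k _ => ?_
    have h1 : ∀ n, (if xs k = xs n then (lam n * (lam k / W (xs k))) • g k else 0) =
        ((if xs n = xs k then lam n else 0) * (lam k / W (xs k))) • g k := fun n => by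
      by_cases hk : xs n = xs k
      · rw [if_pos hk, if_pos hk.symm]
      · rw [if_neg hk, if_neg (Ne.symm hk)]
        simp
    simp only [h1]
    rw [← Finset.sum_smul, ← Finset.sum_mul]
    congr 1
    change lam k = W (xs k) * (lam k / W (xs k))
    by_cases h0 : W (xs k) = 0
    · have h2 : lam k ≤ W (xs k) := by
        have := Finset.single_le_sum (f := fun n => if xs n = xs k then lam n else 0)
          (fun n _ => by split_ifs <;> simp [hlam n]) (Finset.mem_univ k)
        simpa using this
      rw [h0] at h2 ⊢
      simpa using le_antisymm h2 (hlam k)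
    · field_simp

theorem IsKKTDirection.isMaxMarginDirection_ntk (hys : ∀ n, ys n = 1 ∨ ys n = -1) (hN : 0 < N)
    (hL : 0 < L) (hΦ : ∀ x, IsHomLip L fun ϑ => Φ ϑ x)
    (hsm : ∀ x, ContDiffAt ℝ 1 (fun ϑ => Φ ϑ x) v) (h : IsKKTDirection (margin Φ xs ys) v) :
    IsMaxMarginDirection (ntk Φ v) (gradFeature Φ v) xs ys v := by
  obtain ⟨lam, g, hlam, hg, hvg, hcomp, hpos⟩ := h
  have hd : ∀ x, DifferentiableAt ℝ (fun ϑ => Φ ϑ x) v := fun x =>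
    (hsm x).differentiableAt one_ne_zero
  refine isMaxMarginDirection_of_stationary (φ := gradFeature Φ v) hN hL hlam (fun n => ?_) ?_
    hcomp hpos
  · exact inner_gradient_self (hΦ _).hom (hd _)
  · refine hvg.trans (Finset.sum_congr rfl fun n _ => ?_)
    have h1 : ys n • g n = gradFeature Φ v (xs n) := by
      have := mem_clarkeSubdiff_of_margin hys (hg n)
      rw [clarkeSubdiff_eq_singleton (hsm _)] at this
      exact this
    rw [← h1, smul_smul, mul_assoc]
    rcases hys n with h | h <;> simp [h]

end SupportVector

/-! ### Behaviour of the margins and the loss at the origin. -/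

section Continuity

variable {d N : ℕ} {q : Fin N → Euc d → ℝ} {L : ℝ}

theorem IsHomLip.map_zero {f : Euc d → ℝ} (hf : IsHomLip L f) (hL : 0 < L) : f 0 = 0 := by
  have h := hf.hom 2 0 two_pos
  rw [smul_zero] at h
  have h2 : (1 : ℝ) < 2 ^ L := Real.one_lt_rpow one_lt_two hL
  nlinarith

/-- At the origin nothing is assumed beyond homogeneity; continuity there comes from |f θ| ≤ B ‖θ‖ ^
L with L > 0. -/
theorem IsHomLip.continuous {f : Euc d → ℝ} (hf : IsHomLip L f) (hL : 0 < L) : Continuous f := by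
  rw [continuous_iff_continuousAt]
  intro θ
  by_cases hθ : θ = 0
  · subst hθ
    obtain ⟨B, hB⟩ := hf.exists_abs_le
    have h0 := hf.map_zero hL
    rw [ContinuousAt, h0]
    refine squeeze_zero_norm (a := fun θ => B * ‖θ‖ ^ L) (fun θ => ?_) ?_
    · by_cases hθ : θ = 0
      · simp [hθ, h0, Real.zero_rpow hL.ne']
      · exact hB θ hθ
    · have : Continuous fun θ : Euc d => B * ‖θ‖ ^ L :=
        continuous_const.mul (continuous_norm.rpow_const fun _ => Or.inr hL.le)
      simpa [Real.zero_rpow hL.ne'] using this.tendsto 0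
  · exact (hf.lip θ hθ).continuousAt

theorem continuous_expLoss (hq : ∀ n, IsHomLip L (q n)) (hL : 0 < L) :
    Continuous (expLoss q) := by
  unfold expLoss
  exact continuous_finsetSum _ fun n _ => Real.continuous_exp.comp ((hq n).continuous hL).neg

/-- All margins vanish at the origin, so the loss there is N ≥ 1. -/
theorem ne_zero_of_expLoss_lt_one (hN : 0 < N) (hq : ∀ n, IsHomLip L (q n)) (hL : 0 < L)
    {θ : Euc d} (h : expLoss q θ < 1) : θ ≠ 0 := by
  rintro rfl
  have h1 := exp_neg_le_expLoss (q := q) (θ := 0) ⟨0, hN⟩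
  rw [(hq _).map_zero hL] at h1
  simp at h1
  linarith

end Continuity

/-! ### Gradient flow: margin growth, divergence of the norm, aligned points. -/

section GradientFlow

variable {d N : ℕ}

theorem one_le_norm_sq_mul_div_inner_sq {p z : Euc d} (h : 0 < inner ℝ p z) :
    1 ≤ (‖p‖ ^ 2 * ‖z‖ ^ 2) / inner ℝ p z ^ 2 := by
  rw [one_le_div (by positivity), ← mul_pow]
  exact pow_le_pow_left₀ h.le (real_inner_le_norm p z) 2

/-- An arc which, from time `t₀` on, follows a gradient flow of the exponential loss for
homogeneous margins, along which the chain rule holds and whose loss at time `t₀` is below `1`. -/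
structure IsExpFlow (q : Fin N → Euc d → ℝ) (L : ℝ) (θ : ℝ → Euc d) (t₀ : ℝ) : Prop where
  N_pos : 0 < N
  L_pos : 0 < L
  homLip : ∀ n, IsHomLip L (q n)
  ac : ∀ a b, t₀ ≤ a → a ≤ b → AbsolutelyContinuousOnInterval θ a b
  loss_lt : expLoss q (θ t₀) < 1
  flow : ∀ᵐ t, t₀ ≤ t → θ t ≠ 0 → ∃ h : Fin N → Euc d, (∀ n, h n ∈ clarkeSubdiff (q n) (θ t)) ∧
    HasDerivAt θ (descentDir q (θ t) h) t ∧
    ∀ n, HasDerivAt (fun s => q n (θ s)) (inner ℝ (h n) (descentDir q (θ t) h)) t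

namespace IsExpFlow

variable {q : Fin N → Euc d → ℝ} {L : ℝ} {θ : ℝ → Euc d} {t₀ : ℝ}

theorem hasDerivAt_loss {t : ℝ} {h : Fin N → Euc d}
    (hq : ∀ n, HasDerivAt (fun s => q n (θ s)) (inner ℝ (h n) (descentDir q (θ t) h)) t) :
    HasDerivAt (fun s => expLoss q (θ s)) (-‖descentDir q (θ t) h‖ ^ 2) t := by
  have h1 : HasDerivAt (fun s => expLoss q (θ s))
      (∑ n, Real.exp (-q n (θ t)) * -(inner ℝ (h n) (descentDir q (θ t) h))) t := by
    unfold expLoss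
    exact HasDerivAt.fun_sum fun n _ => (hq n).neg.exp
  refine h1.congr_deriv ?_
  symm
  rw [← real_inner_self_eq_norm_sq]
  conv_lhs => arg 1; arg 2; unfold descentDir
  rw [sum_inner, ← Finset.sum_neg_distrib]
  exact Finset.sum_congr rfl fun n _ => by rw [real_inner_smul_left]; ring

theorem ac_margin (hf : IsExpFlow q L θ t₀) {a b : ℝ} (ha : t₀ ≤ a) (hab : a ≤ b)
    (hne : ∀ t ∈ Set.Icc a b, θ t ≠ 0) (n : Fin N) :
    AbsolutelyContinuousOnInterval (fun t => q n (θ t)) a b := by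
  refine LocallyLipschitzOn.comp_absolutelyContinuousOnInterval (hf.ac a b ha hab) ?_
  rw [Set.uIcc_of_le hab]
  rintro _ ⟨t, ht, rfl⟩
  obtain ⟨K, s, hs, hK⟩ := (hf.homLip n).lip _ (hne t ht)
  exact ⟨K, s, mem_nhdsWithin_of_mem_nhds hs, hK⟩

theorem ac_loss (hf : IsExpFlow q L θ t₀) {a b : ℝ} (ha : t₀ ≤ a) (hab : a ≤ b)
    (hne : ∀ t ∈ Set.Icc a b, θ t ≠ 0) :
    AbsolutelyContinuousOnInterval (fun t => expLoss q (θ t)) a b :=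
  AbsolutelyContinuousOnInterval.finsetSum _ fun n _ =>
    (hf.ac_margin ha hab hne n).comp_contDiffAt (f := fun y => Real.exp (-y))
      fun _ _ => by fun_prop

theorem loss_anti_of_ne_zero (hf : IsExpFlow q L θ t₀) {a b : ℝ} (ha : t₀ ≤ a) (hab : a ≤ b)
    (hne : ∀ t ∈ Set.Icc a b, θ t ≠ 0) : expLoss q (θ b) ≤ expLoss q (θ a) := by
  have := (hf.ac_loss ha hab hne).neg.le_of_ae_deriv_nonneg hab (by
    filter_upwards [hf.flow] with t ht hmem
    obtain ⟨h, -, -, hq⟩ := ht (ha.trans hmem.1) (hne t hmem)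
    exact ⟨_, (hasDerivAt_loss hq).neg, by simp⟩)
  simpa using this

theorem continuousOn_loss (hf : IsExpFlow q L θ t₀) :
    ContinuousOn (fun t => expLoss q (θ t)) (Set.Ici t₀) := by
  have h1 : ContinuousOn θ (Set.Ici t₀) := by
    intro t ht
    have ht' : t₀ ≤ t := ht
    have h2 := (hf.ac t₀ (t + 1) le_rfl (by linarith)).continuousOn
    rw [Set.uIcc_of_le (by linarith)] at h2
    refine (h2 t ⟨ht', by linarith⟩).mono_of_mem_nhdsWithin ?_
    have : Set.Iic (t + 1) ∈ 𝓝 t := Iic_mem_nhds (by linarith)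
    filter_upwards [self_mem_nhdsWithin, mem_nhdsWithin_of_mem_nhds this] with s hs hs'
    exact ⟨hs, hs'⟩
  exact (continuous_expLoss hf.homLip hf.L_pos).comp_continuousOn h1

/-- The loss is known to decrease only where θ ≠ 0, and θ ≠ 0 is known only where the loss is below
1. Before the first time T at which the loss reaches 1 both hold, and continuity at T gives a
contradiction. -/
theorem loss_lt_one (hf : IsExpFlow q L θ t₀) {t : ℝ} (ht : t₀ ≤ t) : expLoss q (θ t) < 1 := by
  by_contra! hcon
  set S := {s ∈ Set.Ici t₀ | 1 ≤ expLoss q (θ s)} with hS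
  have hSc : IsClosed S :=
    hf.continuousOn_loss.preimage_isClosed_of_isClosed isClosed_Ici isClosed_Ici
  have hbdd : BddBelow S := ⟨t₀, fun s hs => hs.1⟩
  have hT := hSc.csInf_mem ⟨t, ht, hcon⟩ hbdd
  set T := sInf S
  have hlt : ∀ s, t₀ ≤ s → s < T → expLoss q (θ s) < 1 := fun s hs hsT => by
    by_contra! h
    exact absurd (csInf_le hbdd ⟨hs, h⟩) (not_le.2 hsT)
  have hT0 : t₀ ≤ T := hT.1
  have hT1 : t₀ < T := by
    rcases hT0.eq_or_lt with h | h
    · exact absurd hT.2 (not_le.2 (h ▸ hf.loss_lt))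
    · exact h
  have hle : ∀ s ∈ Set.Ico t₀ T, expLoss q (θ s) ≤ expLoss q (θ t₀) := fun s hs =>
    hf.loss_anti_of_ne_zero le_rfl hs.1 fun r hr =>
      ne_zero_of_expLoss_lt_one hf.N_pos hf.homLip hf.L_pos (hlt r hr.1 (hr.2.trans_lt hs.2))
  have hcont : Tendsto (fun s => expLoss q (θ s)) (𝓝[Set.Ico t₀ T] T) (𝓝 (expLoss q (θ T))) :=
    (hf.continuousOn_loss T hT0).mono fun s hs => hs.1
  have : (𝓝[Set.Ico t₀ T] T).NeBot := by
    rw [nhdsWithin_Ico_eq_nhdsLT hT1]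
    infer_instance
  have := le_of_tendsto hcont (eventually_mem_nhdsWithin.mono hle)
  exact absurd hT.2 (not_le.2 (this.trans_lt hf.loss_lt))

theorem ne_zero (hf : IsExpFlow q L θ t₀) {t : ℝ} (ht : t₀ ≤ t) : θ t ≠ 0 :=
  ne_zero_of_expLoss_lt_one hf.N_pos hf.homLip hf.L_pos (hf.loss_lt_one ht)

theorem neg_log_pos (hf : IsExpFlow q L θ t₀) {t : ℝ} (ht : t₀ ≤ t) :
    0 < -Real.log (expLoss q (θ t)) := by
  have := Real.log_neg (expLoss_pos hf.N_pos) (hf.loss_lt_one ht)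
  linarith

theorem loss_anti (hf : IsExpFlow q L θ t₀) {a b : ℝ} (ha : t₀ ≤ a) (hab : a ≤ b) :
    expLoss q (θ b) ≤ expLoss q (θ a) :=
  hf.loss_anti_of_ne_zero ha hab fun _ ht => hf.ne_zero (ha.trans ht.1)

theorem loss_pos (hf : IsExpFlow q L θ t₀) (t : ℝ) : 0 < expLoss q (θ t) := expLoss_pos hf.N_pos

theorem ac_log_norm (hf : IsExpFlow q L θ t₀) {a b : ℝ} (ha : t₀ ≤ a) (hab : a ≤ b) :
    AbsolutelyContinuousOnInterval (fun t => Real.log ‖θ t‖) a b := by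
  refine (hf.ac a b ha hab).comp_contDiffAt (f := fun x => Real.log ‖x‖) fun t ht => ?_
  rw [Set.uIcc_of_le hab] at ht
  have hne := hf.ne_zero (ha.trans ht.1)
  exact (contDiffAt_norm ℝ hne).log (norm_ne_zero_iff.2 hne)

/-- The logarithm of the smoothed normalized margin. -/
def logMargin (q : Fin N → Euc d → ℝ) (L : ℝ) (z : Euc d) : ℝ :=
  Real.log (-Real.log (expLoss q z)) - L * Real.log ‖z‖

theorem ac_logMargin (hf : IsExpFlow q L θ t₀) {a b : ℝ} (ha : t₀ ≤ a) (hab : a ≤ b) :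
    AbsolutelyContinuousOnInterval (fun t => logMargin q L (θ t)) a b := by
  refine AbsolutelyContinuousOnInterval.fun_sub ?_ ((hf.ac_log_norm ha hab).const_mul L)
  refine (hf.ac_loss ha hab fun t ht => hf.ne_zero (ha.trans ht.1)).comp_contDiffAt
    (f := fun y => Real.log (-Real.log y)) fun t ht => ?_
  rw [Set.uIcc_of_le hab] at ht
  have h1 := (hf.neg_log_pos (ha.trans ht.1)).ne'
  exact ((contDiffAt_id.log (hf.loss_pos t).ne').neg).log h1

/-- The derivatives along the flow: those of the loss, of the logarithm `A` of the norm and of the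
logarithm of the smoothed normalized margin. -/
theorem ae_deriv (hf : IsExpFlow q L θ t₀) : ∀ᵐ t, t₀ ≤ t → ∃ h : Fin N → Euc d,
    (∀ n, h n ∈ clarkeSubdiff (q n) (θ t)) ∧ ∃ p, p = descentDir q (θ t) h ∧
    HasDerivAt θ p t ∧
    HasDerivAt (fun s => expLoss q (θ s)) (-‖p‖ ^ 2) t ∧
    ∃ A' Γ', HasDerivAt (fun s => Real.log ‖θ s‖) A' t ∧
    HasDerivAt (fun s => logMargin q L (θ s)) Γ' t ∧
    expLoss q (θ t) * (L * -Real.log (expLoss q (θ t))) ≤ inner ℝ p (θ t) ∧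
    0 < inner ℝ p (θ t) ∧
    A' * ‖θ t‖ ^ 2 = inner ℝ p (θ t) ∧
    L * A' * ((‖p‖ ^ 2 * ‖θ t‖ ^ 2) / inner ℝ p (θ t) ^ 2 - 1) ≤ Γ' := by
  filter_upwards [hf.flow] with t ht hmem
  have hne := hf.ne_zero hmem
  obtain ⟨h, hh, hθ, hq⟩ := ht hmem hne
  set p := descentDir q (θ t) h with hp
  have hρ : 0 < ‖θ t‖ := norm_pos_iff.2 hne
  have hℓ := hf.loss_pos t
  have hlog := hf.neg_log_pos hmem
  have hinner : inner ℝ p (θ t) = L * weightedMargin q (θ t) := inner_descentDir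
    fun n => ((hf.homLip n).lip _ hne).inner_self_of_mem_clarkeSubdiff (hf.homLip n).hom (hh n)
  have hν := le_weightedMargin (q := q) (θ := θ t)
  have hν0 : 0 < weightedMargin q (θ t) := lt_of_lt_of_le (mul_pos hℓ hlog) hν
  have hL := hf.L_pos
  have hloss := hasDerivAt_loss hq
  rw [← hp] at hloss
  have hnsq : HasDerivAt (fun s => ‖θ s‖ ^ 2) (2 * inner ℝ (θ t) p) t := hθ.norm_sq
  have hA : HasDerivAt (fun s => Real.log ‖θ s‖) (inner ℝ p (θ t) / ‖θ t‖ ^ 2) t := by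
    have h1 := (hnsq.log (by positivity)).div_const 2
    have h2 : (fun s => Real.log (‖θ s‖ ^ 2) / 2) = fun s => Real.log ‖θ s‖ := by
      funext s
      rw [Real.log_pow]
      push_cast
      ring
    rw [h2] at h1
    refine h1.congr_deriv ?_
    rw [real_inner_comm]
    field_simp
  have hΓ : HasDerivAt (fun s => logMargin q L (θ s)) (-(-‖p‖ ^ 2 / expLoss q (θ t)) /
      -Real.log (expLoss q (θ t)) - L * (inner ℝ p (θ t) / ‖θ t‖ ^ 2)) t :=
    ((hloss.log hℓ.ne').neg.log hlog.ne').sub (hA.const_mul L)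
  refine ⟨h, hh, p, rfl, hθ, hloss, _, _, hA, hΓ, ?_, ?_, ?_, ?_⟩
  · rw [hinner]
    nlinarith
  · rw [hinner]
    positivity
  · field_simp
  · rw [hinner]
    -- The true derivative is ‖p‖²/(ℒ log(1/ℒ)) - L A'. Replacing ℒ log(1/ℒ) by the larger weighted
    -- margin ν, for which ⟨p, θ⟩ = L ν, gives the stated bound exactly.
    have h1 : L * (L * weightedMargin q (θ t) / ‖θ t‖ ^ 2) *
        (‖p‖ ^ 2 * ‖θ t‖ ^ 2 / (L * weightedMargin q (θ t)) ^ 2 - 1) =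
        ‖p‖ ^ 2 / weightedMargin q (θ t) - L * (L * weightedMargin q (θ t) / ‖θ t‖ ^ 2) := by
      field_simp
    rw [h1]
    have h2 : -(-‖p‖ ^ 2 / expLoss q (θ t)) / -Real.log (expLoss q (θ t)) =
        ‖p‖ ^ 2 / (expLoss q (θ t) * -Real.log (expLoss q (θ t))) := by
      field_simp
    rw [h2]
    gcongr

theorem log_norm_mono (hf : IsExpFlow q L θ t₀) {a b : ℝ} (ha : t₀ ≤ a) (hab : a ≤ b) :
    Real.log ‖θ a‖ ≤ Real.log ‖θ b‖ := by
  refine AbsolutelyContinuousOnInterval.le_of_ae_deriv_nonneg (f := fun t => Real.log ‖θ t‖) hab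
    (hf.ac_log_norm ha hab) ?_
  filter_upwards [hf.ae_deriv] with t ht hmem
  obtain ⟨h, -, p, -, -, -, A', Γ', hA, -, -, hpos, hA', -⟩ := ht (ha.trans hmem.1)
  refine ⟨A', hA, ?_⟩
  have := norm_pos_iff.2 (hf.ne_zero (ha.trans hmem.1))
  have h1 : 0 < A' * ‖θ t‖ ^ 2 := hA' ▸ hpos
  exact (pos_of_mul_pos_left h1 (by positivity)).le

theorem norm_mono (hf : IsExpFlow q L θ t₀) {a b : ℝ} (ha : t₀ ≤ a) (hab : a ≤ b) :
    ‖θ a‖ ≤ ‖θ b‖ :=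
  (Real.log_le_log_iff (norm_pos_iff.2 (hf.ne_zero ha))
    (norm_pos_iff.2 (hf.ne_zero (ha.trans hab)))).1 (hf.log_norm_mono ha hab)

theorem logMargin_mono (hf : IsExpFlow q L θ t₀) {a b : ℝ} (ha : t₀ ≤ a) (hab : a ≤ b) :
    logMargin q L (θ a) ≤ logMargin q L (θ b) := by
  refine AbsolutelyContinuousOnInterval.le_of_ae_deriv_nonneg
    (f := fun t => logMargin q L (θ t)) hab (hf.ac_logMargin ha hab) ?_
  filter_upwards [hf.ae_deriv] with t ht hmem
  obtain ⟨h, -, p, -, -, -, A', Γ', hA, hΓ, -, hpos, hA', hle⟩ := ht (ha.trans hmem.1)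
  refine ⟨Γ', hΓ, le_trans ?_ hle⟩
  have := norm_pos_iff.2 (hf.ne_zero (ha.trans hmem.1))
  have h1 : 0 < A' * ‖θ t‖ ^ 2 := hA' ▸ hpos
  have h2 := pos_of_mul_pos_left h1 (by positivity)
  have h3 := one_le_norm_sq_mul_div_inner_sq hpos
  have := hf.L_pos
  exact mul_nonneg (by positivity) (by linarith)

/-- The smoothed normalized margin at the starting time. -/
def initMargin (q : Fin N → Euc d → ℝ) (L : ℝ) (z : Euc d) : ℝ := Real.exp (logMargin q L z)

theorem exp_logMargin {z : Euc d} (hz : z ≠ 0) (h : 0 < -Real.log (expLoss q z)) :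
    Real.exp (logMargin q L z) * ‖z‖ ^ L = -Real.log (expLoss q z) := by
  have hρ := norm_pos_iff.2 hz
  rw [logMargin, Real.exp_sub, Real.exp_log h, mul_comm L, ← Real.rpow_def_of_pos hρ]
  exact div_mul_cancel₀ _ (Real.rpow_pos_of_pos hρ L).ne'

theorem initMargin_mul_le (hf : IsExpFlow q L θ t₀) {t : ℝ} (ht : t₀ ≤ t) :
    initMargin q L (θ t₀) * ‖θ t‖ ^ L ≤ -Real.log (expLoss q (θ t)) := by
  rw [← exp_logMargin (L := L) (hf.ne_zero ht) (hf.neg_log_pos ht)]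
  have := Real.exp_le_exp.2 (hf.logMargin_mono le_rfl ht)
  exact mul_le_mul_of_nonneg_right this (by positivity)

theorem bddAbove_logMargin (hf : IsExpFlow q L θ t₀) :
    ∃ M, ∀ t, t₀ ≤ t → logMargin q L (θ t) ≤ M := by
  obtain ⟨B, hB, hqB⟩ := exists_uniform_abs_le hf.homLip
  refine ⟨Real.log B, fun t ht => ?_⟩
  rw [Real.le_log_iff_exp_le hB]
  have hρ := Real.rpow_pos_of_pos (norm_pos_iff.2 (hf.ne_zero ht)) L
  refine le_of_mul_le_mul_right ?_ hρ
  rw [exp_logMargin (hf.ne_zero ht) (hf.neg_log_pos ht)]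
  exact (neg_log_expLoss_le ⟨0, hf.N_pos⟩).trans
    ((le_abs_self _).trans (hqB _ _ (hf.ne_zero ht)))

/-- On a bounded trajectory the loss is at least some c > 0, hence ‖p‖ ≥ δ > 0, and the loss,
falling at rate at least δ², would reach zero in finite time. -/
theorem exists_lt_norm (hf : IsExpFlow q L θ t₀) (R : ℝ) : ∃ t, t₀ ≤ t ∧ R < ‖θ t‖ := by
  by_contra! hR
  obtain ⟨B, hB, hqB⟩ := exists_uniform_abs_le hf.homLip
  have hL := hf.L_pos
  have hρ0 : ∀ t, t₀ ≤ t → 0 < ‖θ t‖ := fun t ht => norm_pos_iff.2 (hf.ne_zero ht)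
  have hR0 : 0 < R := (hρ0 t₀ le_rfl).trans_le (hR t₀ le_rfl)
  set c := Real.exp (-(B * R ^ L))
  have hc : ∀ t, t₀ ≤ t → c ≤ expLoss q (θ t) := fun t ht => by
    refine le_trans ?_ (exp_neg_le_expLoss ⟨0, hf.N_pos⟩)
    rw [Real.exp_le_exp, neg_le_neg_iff]
    refine (le_abs_self _).trans ((hqB _ _ (hf.ne_zero ht)).trans ?_)
    gcongr
    exact hR t ht
  have hc0 : 0 < c := Real.exp_pos _
  set l := -Real.log (expLoss q (θ t₀))
  have hl0 : 0 < l := hf.neg_log_pos le_rfl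
  set δ := c * (L * l) / R
  have hδ : 0 < δ := by positivity
  have hdecr : ∀ t, t₀ ≤ t → expLoss q (θ t) - expLoss q (θ t₀) ≤ -δ ^ 2 * (t - t₀) := by
    intro t ht
    refine (hf.ac_loss le_rfl ht fun s hs => hf.ne_zero hs.1).sub_le_mul_of_ae_deriv_le ht ?_
    filter_upwards [hf.ae_deriv] with s hs hmem
    obtain ⟨h, -, p, -, -, hloss, -, -, -, -, hinn, -⟩ := hs hmem.1
    refine ⟨_, hloss, neg_le_neg (pow_le_pow_left₀ hδ.le ?_ 2)⟩
    have h1 := hinn.trans (real_inner_le_norm _ _)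
    have h2 : l ≤ -Real.log (expLoss q (θ s)) :=
      neg_le_neg (Real.log_le_log (hf.loss_pos s) (hf.loss_anti le_rfl hmem.1))
    have h3 : c * (L * l) ≤ expLoss q (θ s) * (L * -Real.log (expLoss q (θ s))) := by
      have := hc s hmem.1
      have := (hf.loss_pos s).le
      gcongr
    rw [div_le_iff₀ hR0]
    refine (h3.trans h1).trans ?_
    gcongr
    exact hR s hmem.1
  have h1 := hdecr (t₀ + expLoss q (θ t₀) / δ ^ 2) (by
    have := hf.loss_pos t₀
    have : 0 ≤ expLoss q (θ t₀) / δ ^ 2 := by positivity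
    linarith)
  have h2 : -δ ^ 2 * (t₀ + expLoss q (θ t₀) / δ ^ 2 - t₀) = -expLoss q (θ t₀) := by
    field_simp
    ring
  have := hf.loss_pos (t₀ + expLoss q (θ t₀) / δ ^ 2)
  linarith

/-- The homogeneous bounds give ‖p‖ ≤ ℒ B ‖θ‖ ^ (L - 1), and the margin bound gives A' ‖θ‖ ≥ ℒ L γ
‖θ‖ ^ (L - 1) with A = log ‖θ‖. So the direction moves no faster than a constant times A'. -/
theorem exists_norm_normalized_sub_le (hf : IsExpFlow q L θ t₀) :
    ∃ C, 0 < C ∧ ∀ a b, t₀ ≤ a → a ≤ b →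
      ‖‖θ b‖⁻¹ • θ b - ‖θ a‖⁻¹ • θ a‖ ≤ C * (Real.log ‖θ b‖ - Real.log ‖θ a‖) := by
  obtain ⟨B, hB, hgB⟩ := exists_uniform_norm_le hf.homLip
  set γ := initMargin q L (θ t₀) with hγdef
  have hγ : 0 < γ := Real.exp_pos _
  have hL := hf.L_pos
  -- The factor 2 accounts for the two terms p/‖θ‖ and A' θ/‖θ‖ of the derivative of the direction,
  -- each of norm at most ‖p‖/‖θ‖.
  set C := 2 * (B / (L * γ))
  have hC : 0 < C := by positivity
  refine ⟨C, hC, fun a b ha hab => ?_⟩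
  have hne : ∀ t ∈ Set.Icc a b, θ t ≠ 0 := fun t ht => hf.ne_zero (ha.trans ht.1)
  -- Testing against unit vectors reduces the claim to real functions; at the end u is the
  -- normalized difference itself.
  have hdir : ∀ u : Euc d, ‖u‖ = 1 →
      inner ℝ u (‖θ b‖⁻¹ • θ b) - inner ℝ u (‖θ a‖⁻¹ • θ a) ≤
        C * (Real.log ‖θ b‖ - Real.log ‖θ a‖) := by
    intro u hu
    have hac : AbsolutelyContinuousOnInterval (fun t => inner ℝ u (‖θ t‖⁻¹ • θ t)) a b := by
      refine (hf.ac a b ha hab).comp_contDiffAt (f := fun x => inner ℝ u (‖x‖⁻¹ • x))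
        fun t ht => ?_
      rw [Set.uIcc_of_le hab] at ht
      have h0 := hne t ht
      have h1 : ContDiffAt ℝ 1 (fun x : Euc d => ‖x‖⁻¹) (θ t) :=
        (contDiffAt_norm ℝ h0).inv (norm_ne_zero_iff.2 h0)
      exact contDiffAt_const.inner ℝ (h1.smul contDiffAt_id)
    have := (((hf.ac_log_norm ha hab).const_mul C).fun_sub hac).le_of_ae_deriv_nonneg hab (by
      filter_upwards [hf.ae_deriv] with t ht hmem
      have htt := ha.trans hmem.1
      obtain ⟨h, hh, p, hp, hθ, -, A', Γ', hA, -, hinn, hpos, hA', -⟩ := ht htt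
      have h0 := hf.ne_zero htt
      have hρ := norm_pos_iff.2 h0
      have hinv : HasDerivAt (fun s => ‖θ s‖⁻¹) (-A' * ‖θ t‖⁻¹) t := by
        have h1 := hA.neg.exp
        have h2 : ∀ᶠ s in 𝓝 t, Real.exp (-Real.log ‖θ s‖) = ‖θ s‖⁻¹ := by
          filter_upwards [hθ.continuousAt.eventually_ne h0] with s hs
          rw [Real.exp_neg, Real.exp_log (norm_pos_iff.2 hs)]
        have h3 := h1.congr_of_eventuallyEq (h2.mono fun s hs => hs.symm)
        refine h3.congr_deriv ?_
        rw [Pi.neg_apply, Real.exp_neg, Real.exp_log hρ]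
        ring
      have hu' := (hasDerivAt_const t u).inner ℝ (hinv.smul hθ)
      refine ⟨_, (hA.const_mul C).sub hu', ?_⟩
      have hpB : ‖p‖ ≤ expLoss q (θ t) * (B * ‖θ t‖ ^ (L - 1)) := by
        rw [hp]
        exact norm_descentDir_le fun n => hgB n _ h0 _ (hh n)
      have hrpow : ‖θ t‖ ^ L = ‖θ t‖ ^ (L - 1) * ‖θ t‖ := by
        rw [← Real.rpow_add_one hρ.ne', sub_add_cancel]
      have hlow : expLoss q (θ t) * (L * (γ * ‖θ t‖ ^ L)) ≤ A' * ‖θ t‖ ^ 2 := by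
        rw [hA']
        refine le_trans ?_ hinn
        have := hf.initMargin_mul_le htt
        have := (hf.loss_pos t).le
        gcongr
      have hA0 : 0 < A' := pos_of_mul_pos_left (hA' ▸ hpos) (by positivity)
      have hAρ : A' * ‖θ t‖ ≤ ‖p‖ := by
        have h1 := real_inner_le_norm p (θ t)
        rw [← hA', sq, ← mul_assoc] at h1
        exact le_of_mul_le_mul_right h1 hρ
      have hpA : 2 * ‖p‖ ≤ C * A' * ‖θ t‖ := by
        have h1 : expLoss q (θ t) * (L * γ * ‖θ t‖ ^ (L - 1)) ≤ A' * ‖θ t‖ := by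
          refine le_of_mul_le_mul_right ?_ hρ
          rw [hrpow] at hlow
          nlinarith
        have h2 : ‖p‖ ≤ B / (L * γ) * (A' * ‖θ t‖) := by
          rw [div_mul_eq_mul_div, le_div_iff₀ (by positivity)]
          calc ‖p‖ * (L * γ) ≤ expLoss q (θ t) * (B * ‖θ t‖ ^ (L - 1)) * (L * γ) := by gcongr
            _ = B * (expLoss q (θ t) * (L * γ * ‖θ t‖ ^ (L - 1))) := by ring
            _ ≤ B * (A' * ‖θ t‖) := by gcongr
        simp only [C]
        linarith
      have hb : inner ℝ u (‖θ t‖⁻¹ • p + (-A' * ‖θ t‖⁻¹) • θ t) ≤ C * A' := by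
        refine (real_inner_le_norm _ _).trans ?_
        rw [hu, one_mul]
        refine (norm_add_le _ _).trans ?_
        rw [norm_smul, norm_smul, norm_inv, norm_norm, norm_mul, norm_neg, norm_inv, norm_norm,
          Real.norm_of_nonneg hA0.le, mul_assoc, inv_mul_cancel₀ hρ.ne', mul_one,
          inv_mul_eq_div]
        have h1 : ‖p‖ / ‖θ t‖ ≤ C * A' / 2 := by
          rw [div_le_iff₀ hρ]
          linarith
        have h2 : A' ≤ ‖p‖ / ‖θ t‖ := (le_div_iff₀ hρ).2 hAρ
        linarith
      simp only [inner_zero_left, add_zero]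
      linarith)
    linarith
  by_cases hz : ‖θ b‖⁻¹ • θ b - ‖θ a‖⁻¹ • θ a = 0
  · rw [hz, norm_zero]
    exact mul_nonneg hC.le (sub_nonneg.2 (hf.log_norm_mono ha hab))
  · have h1 := hdir _ (norm_normalized hz)
    rw [← inner_sub_right, real_inner_smul_left, real_inner_self_eq_norm_sq, sq, ← mul_assoc,
      inv_mul_cancel₀ (norm_ne_zero_iff.2 hz), one_mul] at h1
    exact h1

theorem hasAlignedPoints (hf : IsExpFlow q L θ t₀) {v : Euc d} (hv : IsLimitDirection θ v) :
    HasAlignedPoints q L (initMargin q L (θ t₀)) v := by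
  intro ε hε
  have hL := hf.L_pos
  obtain ⟨C, hC, hCle⟩ := hf.exists_norm_normalized_sub_le
  obtain ⟨M, hM⟩ := hf.bddAbove_logMargin
  -- While log‖θ‖ grows by w, the direction moves by at most C w = ε/2.
  set w := ε / (2 * C)
  have hw : 0 < w := by positivity
  have hCw : C * w = ε / 2 := by
    simp only [w]
    field_simp
  -- If growth by `L * w * ε` were possible from every time on, iterating it would exceed the upper
  -- bound `M`.
  obtain ⟨T, hT, hTle⟩ : ∃ T, t₀ ≤ T ∧ ∀ t, T ≤ t →
      logMargin q L (θ t) - logMargin q L (θ T) < L * w * ε := by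
    by_contra! hcon
    have hstep : ∀ k : ℕ, ∃ t, t₀ ≤ t ∧ logMargin q L (θ t₀) + k * (L * w * ε) ≤
        logMargin q L (θ t) := by
      intro k
      induction k with
      | zero => exact ⟨t₀, le_rfl, by simp⟩
      | succ k ih =>
        obtain ⟨t, ht, hle⟩ := ih
        obtain ⟨s, hs, hsle⟩ := hcon t ht
        refine ⟨s, ht.trans hs, ?_⟩
        push_cast
        linarith
    obtain ⟨k, hk⟩ := exists_nat_gt ((M - logMargin q L (θ t₀)) / (L * w * ε))
    obtain ⟨t, ht, hle⟩ := hstep k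
    rw [div_lt_iff₀ (by positivity)] at hk
    have := hM t ht
    linarith
  obtain ⟨T', hT', hRT'⟩ := hf.exists_lt_norm (1 / ε)
  obtain ⟨t₁, ht₁, hclose⟩ := (frequently_atTop.1
    ((mapClusterPt_iff_frequently.1 hv) _ (Metric.ball_mem_nhds v (half_pos hε)))) (max T T')
  rw [Metric.mem_ball, dist_eq_norm] at hclose
  have htT : T ≤ t₁ := (le_max_left _ _).trans ht₁
  have htT' : T' ≤ t₁ := (le_max_right _ _).trans ht₁
  have ht₀₁ : t₀ ≤ t₁ := hT.trans htT
  obtain ⟨s, hs, hsA⟩ : ∃ s, t₁ ≤ s ∧ Real.log ‖θ s‖ - Real.log ‖θ t₁‖ = w := by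
    obtain ⟨S, hS, hSR⟩ := hf.exists_lt_norm (Real.exp (Real.log ‖θ t₁‖ + w))
    have hS1 : Real.log ‖θ t₁‖ + w < Real.log ‖θ S‖ := by
      rw [Real.lt_log_iff_exp_lt (norm_pos_iff.2 (hf.ne_zero hS))]
      exact hSR
    have htS : t₁ ≤ S := by
      by_contra! h
      have := hf.log_norm_mono hS h.le
      linarith
    have hcont := (hf.ac_log_norm ht₀₁ htS).continuousOn
    rw [Set.uIcc_of_le htS] at hcont
    obtain ⟨s, hs, hsw⟩ := intermediate_value_Icc htS hcont
      (show Real.log ‖θ t₁‖ + w ∈ _ from ⟨by linarith, hS1.le⟩)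
    exact ⟨s, hs.1, by simp only at hsw; linarith⟩
  by_contra hcon
  have hcon' : ∀ (z : Euc d) (h : Fin N → Euc d), z ≠ 0 → (∀ n, h n ∈ clarkeSubdiff (q n) z) →
      initMargin q L (θ t₀) * ‖z‖ ^ L ≤ -Real.log (expLoss q z) → ‖‖z‖⁻¹ • z - v‖ < ε →
      1 / ε < ‖z‖ → (1 + ε) * inner ℝ (descentDir q z h) z ^ 2 <
        ‖descentDir q z h‖ ^ 2 * ‖z‖ ^ 2 := by
    intro z h h1 h2 h3 h4 h5
    by_contra! h6
    exact hcon ⟨z, h, h1, h2, h3, h4, h5, h6⟩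
  -- Misalignment by ε on the whole window makes the log margin grow at least L ε times as fast as
  -- log‖θ‖, a total of at least `L * w * ε`.
  have hgrow := ((hf.ac_logMargin ht₀₁ hs).fun_sub
    ((hf.ac_log_norm ht₀₁ hs).const_mul (L * ε))).le_of_ae_deriv_nonneg hs (by
    filter_upwards [hf.ae_deriv] with t ht hmem
    have htt := ht₀₁.trans hmem.1
    obtain ⟨h, hh, p, hp, -, -, A', Γ', hA, hΓ, hinn, hpos, hA', hΓ'⟩ := ht htt
    refine ⟨_, hΓ.sub (hA.const_mul _), ?_⟩
    have h0 := hf.ne_zero htt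
    have hρ := norm_pos_iff.2 h0
    have hA0 : 0 < A' := pos_of_mul_pos_left (hA' ▸ hpos) (by positivity)
    have hdist : ‖‖θ t‖⁻¹ • θ t - v‖ < ε := by
      have h1 := hCle t₁ t ht₀₁ hmem.1
      have h2 := hf.log_norm_mono htt hmem.2
      have h3 : C * (Real.log ‖θ t‖ - Real.log ‖θ t₁‖) ≤ C * w :=
        mul_le_mul_of_nonneg_left (by linarith) hC.le
      have h4 := norm_sub_le_norm_sub_add_norm_sub (‖θ t‖⁻¹ • θ t) (‖θ t₁‖⁻¹ • θ t₁) v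
      linarith
    have hbig : 1 / ε < ‖θ t‖ := hRT'.trans_le (hf.norm_mono hT' (htT'.trans hmem.1))
    have hlt := hcon' _ h h0 hh (hf.initMargin_mul_le htt) hdist hbig
    rw [← hp] at hlt
    have h1 : ε ≤ ‖p‖ ^ 2 * ‖θ t‖ ^ 2 / inner ℝ p (θ t) ^ 2 - 1 := by
      rw [le_sub_iff_add_le, le_div_iff₀ (by positivity)]
      linarith
    have h2 := mul_le_mul_of_nonneg_left h1 (mul_pos hL hA0).le
    linarith)
  have h1 := hTle s (htT.trans hs)
  have h2 := hf.logMargin_mono hT htT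
  have h3 : L * ε * (Real.log ‖θ s‖ - Real.log ‖θ t₁‖) = L * w * ε := by
    rw [hsA]
    ring
  linarith

theorem isKKTDirection (hf : IsExpFlow q L θ t₀) {v : Euc d} (hv : IsLimitDirection θ v) :
    IsKKTDirection q v :=
  (hf.hasAlignedPoints hv).isKKTDirection hf.N_pos hf.L_pos hf.homLip (Real.exp_pos _)

end IsExpFlow

end GradientFlow

/-! ### Application of the flow results to networks. -/

section Network

variable {d dx N : ℕ} {Φ : Euc d → Euc dx → ℝ} {xs : Fin N → Euc dx} {ys : Fin N → ℝ} {L : ℝ}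

theorem trainLoss_eq : trainLoss Φ xs ys = expLoss (margin Φ xs ys) := rfl

theorem IsHomLip.margin (hΦ : ∀ x, IsHomLip L fun ϑ => Φ ϑ x) (n : Fin N) :
    IsHomLip L (margin Φ xs ys n) where
  hom c θ hc := by
    simp only [HomNet.margin, (hΦ (xs n)).hom c θ hc]
    ring
  lip θ hθ := ((hΦ (xs n)).lip θ hθ).comp_contDiffAt (g := fun y => ys n * y) (by fun_prop)

theorem IsSmoothNet.contDiffAt (hs : IsSmoothNet Φ) (x : Euc dx) {θ : Euc d} (hθ : θ ≠ 0) :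
    ContDiffAt ℝ 2 (fun ϑ => Φ ϑ x) θ :=
  (hs x).contDiffAt (isOpen_compl_singleton.mem_nhds hθ)

theorem IsSmoothNet.isHomLip (hs : IsSmoothNet Φ) (hΦ : IsHomogeneousNet Φ L) (x : Euc dx) :
    IsHomLip L fun ϑ => Φ ϑ x where
  hom c θ hc := hΦ c θ x hc
  lip _ hθ := LipschitzNear.of_contDiffAt ((hs.contDiffAt x hθ).of_le one_le_two)

theorem IsRegularNet.isHomLip (hr : IsRegularNet Φ) (hΦ : IsHomogeneousNet Φ L) (x : Euc dx) :
    IsHomLip L fun ϑ => Φ ϑ x where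
  hom c θ hc := hΦ c θ x hc
  lip θ _ := (hr x).1 θ

/-- The chain rule is asked for only at nonzero points where θ is differentiable, so that networks
smooth off the origin and networks admitting a chain rule are covered by one statement. -/
theorem IsGradientFlow.isExpFlow {θ : ℝ → Euc d} {t₀ : ℝ} (hN : 0 < N) (hL : 0 < L)
    (hΦ : ∀ x, IsHomLip L fun ϑ => Φ ϑ x) (hys : ∀ n, ys n = 1 ∨ ys n = -1)
    (hθ : IsGradientFlow (trainLoss Φ xs ys) θ) (ht₀ : 0 ≤ t₀)
    (hloss : trainLoss Φ xs ys (θ t₀) < 1)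
    (hchain : ∀ n : Fin N, ∀ᵐ t : ℝ, 0 < t → θ t ≠ 0 → DifferentiableAt ℝ θ t →
      ∀ h ∈ clarkeSubdiff (fun ϑ => Φ ϑ (xs n)) (θ t),
        HasDerivAt (fun s => Φ (θ s) (xs n)) (inner ℝ h (deriv θ t)) t) :
    IsExpFlow (margin Φ xs ys) L θ t₀ where
  N_pos := hN
  L_pos := hL
  homLip := IsHomLip.margin hΦ
  ac a b ha hab := hθ.1 a b (ht₀.trans ha) hab
  loss_lt := hloss
  flow := by
    have h0 : ∀ᵐ t : ℝ, t ≠ 0 := by simp [ae_iff]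
    filter_upwards [hθ.2, ae_all_iff.2 hchain, h0] with t ht hchain ht0 hmem hne
    obtain ⟨v, hv, hvmem⟩ := ht (ht₀.trans hmem)
    obtain ⟨h, hh, hvh⟩ := exists_descentDir_of_mem_clarkeSubdiff
      (fun n => (IsHomLip.margin (ys := ys) hΦ n).lip _ hne) hvmem
    obtain rfl := neg_injective hvh
    refine ⟨h, hh, hv, fun n => ?_⟩
    have h1 := hchain n (lt_of_le_of_ne (ht₀.trans hmem) (Ne.symm ht0)) hne hv.differentiableAt _
      (mem_clarkeSubdiff_of_margin hys (hh n))
    refine (h1.const_mul (ys n)).congr_deriv ?_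
    rw [hv.deriv, real_inner_smul_left, ← mul_assoc]
    rcases hys n with h | h <;> simp [h]

theorem IsLimitDirection.ne_zero {T : Type} [Preorder T] {θ : T → Euc d} {v : Euc d}
    (hv : IsLimitDirection θ v) (hθ : ∀ᶠ t in atTop, θ t ≠ 0) : v ≠ 0 := by
  rintro rfl
  obtain ⟨t, ht, hne⟩ := ((mapClusterPt_iff_frequently.1 hv) _
    (Metric.ball_mem_nhds 0 zero_lt_one)).and_eventually hθ |>.exists
  rw [mem_ball_zero_iff, norm_normalized hne] at ht
  exact lt_irrefl _ ht

theorem isMaxMarginDirection_of_smooth_flow {θ : ℝ → Euc d} {t₀ : ℝ} {v : Euc d} (hN : 0 < N)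
    (hL : 0 < L) (hys : ∀ n, ys n = 1 ∨ ys n = -1) (hΦ : IsHomogeneousNet Φ L)
    (hs : IsSmoothNet Φ) (hθ : IsGradientFlow (trainLoss Φ xs ys) θ) (ht₀ : 0 ≤ t₀)
    (hloss : trainLoss Φ xs ys (θ t₀) < 1) (hv : IsLimitDirection θ v) :
    IsMaxMarginDirection (ntk Φ v) (gradFeature Φ v) xs ys v := by
  have hf : IsExpFlow (margin Φ xs ys) L θ t₀ :=
    hθ.isExpFlow hN hL (hs.isHomLip hΦ) hys ht₀ hloss fun n =>
      Eventually.of_forall fun t _ hne hd h hh => by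
        have hC := (hs.contDiffAt (xs n) hne).of_le one_le_two
        rw [clarkeSubdiff_eq_singleton hC, Set.mem_singleton_iff] at hh
        subst hh
        rw [inner_gradient_left]
        exact (hC.differentiableAt one_ne_zero).hasFDerivAt.comp_hasDerivAt t hd.hasDerivAt
  have hv0 : v ≠ 0 := hv.ne_zero ((eventually_ge_atTop t₀).mono fun t ht => hf.ne_zero ht)
  exact (hf.isKKTDirection hv).isMaxMarginDirection_ntk hys hN hL (hs.isHomLip hΦ) fun x =>
    (hs.contDiffAt x hv0).of_le one_le_two

theorem exists_isMaxMarginDirection_of_regular_flow {θ : ℝ → Euc d} {t₀ : ℝ} {v : Euc d}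
    (hN : 0 < N) (hL : 0 < L) (hys : ∀ n, ys n = 1 ∨ ys n = -1) (hΦ : IsHomogeneousNet Φ L)
    (hr : IsRegularNet Φ) (hθ : IsGradientFlow (trainLoss Φ xs ys) θ) (ht₀ : 0 ≤ t₀)
    (hloss : trainLoss Φ xs ys (θ t₀) < 1) (hv : IsLimitDirection θ v) :
    ∃ h : Euc dx → Euc d, (∀ x, h x ∈ clarkeSubdiff (fun ϑ => Φ ϑ x) v) ∧
      IsMaxMarginDirection (featureKernel h) h xs ys v := by
  have hf : IsExpFlow (margin Φ xs ys) L θ t₀ :=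
    hθ.isExpFlow hN hL (hr.isHomLip hΦ) hys ht₀ hloss fun n => by
      filter_upwards [(hr (xs n)).2 θ hθ.1] with t ht hpos _ _
      exact ht hpos
  have hv0 : v ≠ 0 := hv.ne_zero ((eventually_ge_atTop t₀).mono fun t ht => hf.ne_zero ht)
  exact (hf.isKKTDirection hv).exists_feature hys hN hL (hr.isHomLip hΦ) hv0

end Network

/-! ### The functions φ and κ of the learning rate bound. -/

section Phi

variable {L x₀ : ℝ}

theorem log_one_div (x : ℝ) : Real.log (1 / x) = -Real.log x := by
  rw [one_div, Real.log_inv]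

theorem neg_log_pos_of_mem {x : ℝ} (h0 : 0 < x) (h1 : x < 1) : 0 < -Real.log x := by
  have := Real.log_neg h0 h1
  linarith

/-- The function whose running supremum is `-φ'`. -/
def phiSlope (L x₀ w : ℝ) : ℝ :=
  (1 + 2 * (1 + lam w / L) * mu x₀ w) / (w * Real.log (1 / w))

theorem phiDeriv_eq (x : ℝ) : phiDeriv L x₀ x = -sSup (phiSlope L x₀ '' Set.Icc x x₀) := rfl

/-- The first term cancels the singularity added in the integrand of φ; the remaining ones are
integrable at 0. -/
theorem phiSlope_eq {w : ℝ} (h0 : 0 < w) (h1 : w < 1) : phiSlope L x₀ w =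
    1 / (w * -Real.log w) + -Real.log x₀ * (1 / (w * (-Real.log w) ^ 2)) +
      -Real.log x₀ / L * (1 / (w * (-Real.log w) ^ 3)) := by
  have hl := (neg_log_pos_of_mem h0 h1).ne'
  rw [phiSlope, lam, mu, log_one_div, log_one_div]
  have hw := h0.ne'
  generalize -Real.log w = l at hl ⊢
  generalize -Real.log x₀ = c
  simp only [div_eq_mul_inv]
  generalize L⁻¹ = i
  field_simp
  ring

theorem continuousOn_phiSlope : ContinuousOn (phiSlope L x₀) (Set.Ioo 0 1) := by
  have hlog : ContinuousOn Real.log (Set.Ioo 0 1) :=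
    Real.continuousOn_log.mono fun w hw => hw.1.ne'
  have hterm : ∀ k : ℕ, ContinuousOn (fun w : ℝ => 1 / (w * (-Real.log w) ^ k)) (Set.Ioo 0 1) :=
    fun k => continuousOn_const.div (continuousOn_id.mul (hlog.neg.pow k)) fun w hw =>
      mul_ne_zero hw.1.ne' (pow_ne_zero _ (neg_log_pos_of_mem hw.1 hw.2).ne')
  have h1 := hterm 1
  simp only [pow_one] at h1
  refine ((h1.add ((hterm 2).const_mul (-Real.log x₀))).add
    ((hterm 3).const_mul (-Real.log x₀ / L))).congr fun w hw => ?_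
  exact phiSlope_eq hw.1 hw.2

section

variable (hL : 0 < L) (h0 : 0 < x₀) (h1 : x₀ < 1)
include h1

theorem bddAbove_phiSlope {x : ℝ} (hx : 0 < x) : BddAbove (phiSlope L x₀ '' Set.Icc x x₀) :=
  (isCompact_Icc.image_of_continuousOn (continuousOn_phiSlope.mono fun _ hw =>
    ⟨hx.trans_le hw.1, hw.2.trans_lt h1⟩)).bddAbove

theorem phiSlope_le_neg_phiDeriv {x : ℝ} (hx : 0 < x) (hx0 : x ≤ x₀) :
    phiSlope L x₀ x ≤ -phiDeriv L x₀ x := by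
  rw [phiDeriv_eq, neg_neg]
  exact le_csSup (bddAbove_phiSlope h1 hx) ⟨x, ⟨le_rfl, hx0⟩, rfl⟩

theorem monotoneOn_phiDeriv : MonotoneOn (phiDeriv L x₀) (Set.Ioc 0 x₀) := by
  intro x hx y hy hxy
  rw [phiDeriv_eq, phiDeriv_eq, neg_le_neg_iff]
  exact csSup_le_csSup (bddAbove_phiSlope h1 hx.1) ⟨_, y, ⟨le_rfl, hy.2⟩, rfl⟩
    (Set.image_mono (Set.Icc_subset_Icc_left hxy))

include hL h0

theorem lt_phiSlope {x : ℝ} (hx : 0 < x) (hx0 : x ≤ x₀) :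
    1 / (x * -Real.log x) < phiSlope L x₀ x := by
  have hl := neg_log_pos_of_mem hx (hx0.trans_lt h1)
  have hl0 := neg_log_pos_of_mem h0 h1
  rw [phiSlope_eq hx (hx0.trans_lt h1)]
  have : 0 < -Real.log x₀ * (1 / (x * (-Real.log x) ^ 2)) := by positivity
  have : 0 < -Real.log x₀ / L * (1 / (x * (-Real.log x) ^ 3)) := by positivity
  linarith

/-- Near `0`, the deviation of `φ'` from `-1 / (w log (1/w))` is of the order of
`1 / (w log² (1/w))`. -/
theorem exists_neg_phiDeriv_le : ∃ x₁ D, 0 < x₁ ∧ x₁ ≤ x₀ ∧ 0 ≤ D ∧ ∀ w ∈ Set.Ioc 0 x₁,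
    -phiDeriv L x₀ w ≤ 1 / (w * -Real.log w) + D * (1 / (w * (-Real.log w) ^ 2)) := by
  have hl0 := neg_log_pos_of_mem h0 h1
  have hpos : ∀ x, 0 < x → x < 1 → 0 < Real.negMulLog x := fun x hx hx1 => by
    have := neg_log_pos_of_mem hx hx1
    rw [Real.negMulLog_eq_neg]
    nlinarith
  have hlim : Tendsto Real.negMulLog (𝓝 0) (𝓝 0) := by
    simpa using Real.continuous_negMulLog.tendsto 0
  have hlim2 : Tendsto (fun w => Real.negMulLog √w) (𝓝 0) (𝓝 0) := by
    simpa [Function.comp_def] using (Real.continuous_negMulLog.comp Real.continuous_sqrt).tendsto 0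
  have hs0 : 0 < √x₀ := Real.sqrt_pos.2 h0
  have hs1 : √x₀ < 1 := by
    rw [Real.sqrt_lt' one_pos]
    simpa using h1
  have hev : ∀ᶠ w in 𝓝 (0 : ℝ), Real.negMulLog w < Real.negMulLog x₀ ∧
      Real.negMulLog √w < Real.negMulLog √x₀ :=
    (hlim.eventually (gt_mem_nhds (hpos _ h0 h1))).and
      (hlim2.eventually (gt_mem_nhds (hpos _ hs0 hs1)))
  obtain ⟨r, hr, hball⟩ := Metric.eventually_nhds_iff.1 hev
  refine ⟨min (r / 2) x₀, -Real.log x₀ + 1 / L, by positivity, min_le_right _ _, by positivity,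
    fun w hw => ?_⟩
  have hw0 : 0 < w := hw.1
  have hwx : w ≤ x₀ := hw.2.trans (min_le_right _ _)
  have hwr := hball (show dist w 0 < r by
    rw [Real.dist_eq, sub_zero, abs_of_pos hw0]
    have := hw.2.trans (min_le_left _ _)
    linarith)
  rw [phiDeriv_eq, neg_neg]
  refine csSup_le ⟨_, w, ⟨le_rfl, hwx⟩, rfl⟩ ?_
  rintro _ ⟨v, hv, rfl⟩
  have hv0 : 0 < v := hw0.trans_le hv.1
  have hv1 : v < 1 := hv.2.trans_lt h1
  have hlv := neg_log_pos_of_mem hv0 hv1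
  have hlw := neg_log_pos_of_mem hw0 (hwx.trans_lt h1)
  have hlvx : -Real.log x₀ ≤ -Real.log v := neg_le_neg (Real.log_le_log hv0 hv.2)
  -- w log(1/w) is not monotone on (0, 1), but it is concave, so its minimum over [w, x₀] is at an
  -- endpoint, namely at w once w is small.
  have hA : w * -Real.log w ≤ v * -Real.log v := by
    have := Real.concaveOn_negMulLog.min_le_of_mem_Icc (Set.mem_Ici.2 hw0.le)
      (Set.mem_Ici.2 h0.le) hv
    rw [min_eq_left hwr.1.le] at this
    simpa [Real.negMulLog] using this
  have hB : w * (-Real.log w) ^ 2 ≤ v * (-Real.log v) ^ 2 := by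
    have := Real.concaveOn_negMulLog.min_le_of_mem_Icc (Set.mem_Ici.2 (Real.sqrt_nonneg w))
      (Set.mem_Ici.2 hs0.le) ⟨Real.sqrt_le_sqrt hv.1, Real.sqrt_le_sqrt hv.2⟩
    rw [min_eq_left hwr.2.le] at this
    -- Passing to square roots reduces y log²(1/y) to the same concavity argument.
    have hsq : ∀ y : ℝ, 0 < y → y * (-Real.log y) ^ 2 = 4 * Real.negMulLog √y ^ 2 := fun y hy => by
      simp only [Real.negMulLog, Real.log_sqrt hy.le]
      nth_rw 1 [← Real.sq_sqrt hy.le]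
      ring
    rw [hsq w hw0, hsq v hv0]
    have h2 : 0 ≤ Real.negMulLog √w := Real.negMulLog_nonneg (Real.sqrt_nonneg _) (by
      rw [Real.sqrt_le_one]
      linarith)
    gcongr
  rw [phiSlope_eq hv0 hv1]
  have e1 : 1 / (v * -Real.log v) ≤ 1 / (w * -Real.log w) := by gcongr
  have e2 : 1 / (v * (-Real.log v) ^ 2) ≤ 1 / (w * (-Real.log w) ^ 2) := by gcongr
  have e3 : -Real.log x₀ / L * (1 / (v * (-Real.log v) ^ 3)) ≤
      1 / L * (1 / (v * (-Real.log v) ^ 2)) := by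
    rw [div_mul_div_comm, div_mul_div_comm, div_le_div_iff₀ (by positivity) (by positivity)]
    have : 0 ≤ L * v * (-Real.log v) ^ 2 := by positivity
    nlinarith
  have e4 := mul_le_mul_of_nonneg_left e2 hl0.le
  have e5 := mul_le_mul_of_nonneg_left e2 (show 0 ≤ 1 / L by positivity)
  linarith

/-- The integral in the definition of `φ` exists. -/
theorem intervalIntegrable_phi_integrand {x : ℝ} (hx : 0 < x) (hx0 : x ≤ x₀) :
    IntervalIntegrable (fun w => phiDeriv L x₀ w + 1 / (w * Real.log (1 / w))) volume 0 x := by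
  simp only [log_one_div]
  have hlog : ContinuousOn Real.log (Set.Ioo 0 1) :=
    Real.continuousOn_log.mono fun w hw => hw.1.ne'
  have hrec : ContinuousOn (fun w : ℝ => 1 / (w * -Real.log w)) (Set.Ioo 0 1) :=
    continuousOn_const.div (continuousOn_id.mul hlog.neg) fun w hw =>
      mul_ne_zero hw.1.ne' (neg_log_pos_of_mem hw.1 hw.2).ne'
  have hmono := monotoneOn_phiDeriv (L := L) h1
  have hpart : ∀ a b, 0 < a → a ≤ b → b ≤ x₀ → IntervalIntegrable
      (fun w => phiDeriv L x₀ w + 1 / (w * -Real.log w)) volume a b := by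
    intro a b ha hab hb
    refine IntervalIntegrable.add ?_ ?_
    · refine MonotoneOn.intervalIntegrable (hmono.mono ?_)
      rw [Set.uIcc_of_le hab]
      exact fun w hw => ⟨ha.trans_le hw.1, hw.2.trans hb⟩
    · refine ContinuousOn.intervalIntegrable (hrec.mono ?_)
      rw [Set.uIcc_of_le hab]
      exact fun w hw => ⟨ha.trans_le hw.1, (hw.2.trans hb).trans_lt h1⟩
  obtain ⟨x₁, D, hx₁, hx₁0, hD, hbound⟩ := exists_neg_phiDeriv_le hL h0 h1
  set b := min x₁ x
  have hb : 0 < b := lt_min hx₁ hx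
  have hbx₁ : b ≤ x₁ := min_le_left _ _
  have hb1 : b < 1 := hbx₁.trans_lt (hx₁0.trans_lt h1)
  refine IntervalIntegrable.trans ?_ (hpart b x hb (min_le_right _ _) hx0)
  rw [intervalIntegrable_iff_integrableOn_Ioc_of_le hb.le]
  have hdom : IntegrableOn (fun w : ℝ => 1 / (w * (-Real.log w) ^ 2)) (Set.Ioc 0 b) := by
    refine intervalIntegral.integrableOn_deriv_of_nonneg (g := fun w => (-Real.log w)⁻¹) ?_ ?_ ?_
    · intro w hw
      rcases hw.1.eq_or_lt with rfl | hw0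
      · refine ContinuousAt.continuousWithinAt (continuousAt_iff_punctured_nhds.2 ?_)
        -- The convention log 0 = 0, 0⁻¹ = 0 gives the antiderivative 1/log(1/w) the value 0 at w =
        -- 0, which is also its limit.
        simp only [Real.log_zero, neg_zero, inv_zero]
        exact (tendsto_neg_atBot_atTop.comp Real.tendsto_log_nhdsNE_zero).inv_tendsto_atTop
      · exact ((Real.continuousAt_log hw0.ne').neg.inv₀
          (neg_log_pos_of_mem hw0 (hw.2.trans_lt hb1)).ne').continuousWithinAt
    · intro w hw
      have hl := (neg_log_pos_of_mem hw.1 (hw.2.trans hb1)).ne'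
      refine ((Real.hasDerivAt_log hw.1.ne').neg.inv hl).congr_deriv ?_
      have := hw.1.ne'
      simp only [Pi.neg_apply]
      field_simp
    · intro w hw
      have := hw.1
      positivity
  refine (hdom.const_mul D).mono' ?_ ?_
  · refine AEStronglyMeasurable.add ?_ ?_
    · refine (aemeasurable_restrict_of_monotoneOn measurableSet_Ioc (hmono.mono ?_)).aestronglyMeasurable
      exact fun w hw => ⟨hw.1, hw.2.trans (hbx₁.trans hx₁0)⟩
    · refine (hrec.mono ?_).aestronglyMeasurable measurableSet_Ioc
      exact fun w hw => ⟨hw.1, hw.2.trans_lt hb1⟩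
  · refine (ae_restrict_iff' measurableSet_Ioc).2 (Eventually.of_forall fun w hw => ?_)
    have hwx : w ≤ x₁ := hw.2.trans hbx₁
    have e1 := hbound w ⟨hw.1, hwx⟩
    have e2 := phiSlope_le_neg_phiDeriv (L := L) h1 hw.1 (hwx.trans hx₁0)
    have e3 := lt_phiSlope hL h0 h1 hw.1 (hwx.trans hx₁0)
    rw [Real.norm_of_nonpos (by linarith)]
    linarith

theorem phi_lt {x : ℝ} (hx : 0 < x) (hx0 : x ≤ x₀) : phi L x₀ x < Real.log (-Real.log x) := by
  have hint := intervalIntegrable_phi_integrand hL h0 h1 hx hx0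
  have hpos : 0 < ∫ w in (0 : ℝ)..x, -(phiDeriv L x₀ w + 1 / (w * Real.log (1 / w))) := by
    refine intervalIntegral.intervalIntegral_pos_of_pos_on hint.neg (fun w hw => ?_) hx
    have hwx := hw.2.le.trans hx0
    have e2 := phiSlope_le_neg_phiDeriv (L := L) h1 hw.1 hwx
    have e3 := lt_phiSlope hL h0 h1 hw.1 hwx
    rw [log_one_div]
    linarith
  rw [intervalIntegral.integral_neg] at hpos
  rw [phi, log_one_div]
  linarith

/-- The log log terms cancel against the integral of 1/(w log(1/w)), leaving the integral of φ' over
[y, x], and φ' is nondecreasing. The running supremum in `phiDeriv` is there to make φ convex. -/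
theorem phi_sub_le {x y : ℝ} (hy : 0 < y) (hyx : y ≤ x) (hx0 : x ≤ x₀) :
    phi L x₀ x - phi L x₀ y ≤ phiDeriv L x₀ x * (x - y) := by
  have hx := hy.trans_le hyx
  have hintx := intervalIntegrable_phi_integrand hL h0 h1 hx hx0
  have hinty := intervalIntegrable_phi_integrand hL h0 h1 hy (hyx.trans hx0)
  have hintxy := hinty.symm.trans hintx
  have hsub := intervalIntegral.integral_interval_sub_left hintx hinty
  have hmono : MonotoneOn (phiDeriv L x₀) (Set.uIcc y x) := by
    rw [Set.uIcc_of_le hyx]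
    exact (monotoneOn_phiDeriv h1).mono fun w hw => ⟨hy.trans_le hw.1, hw.2.trans hx0⟩
  have hφint : IntervalIntegrable (phiDeriv L x₀) volume y x := hmono.intervalIntegrable
  have hrec : IntervalIntegrable (fun w => 1 / (w * Real.log (1 / w))) volume y x := by
    have := hintxy.sub hφint
    simpa using this
  have hF : ∫ w in y..x, 1 / (w * Real.log (1 / w)) =
      -Real.log (-Real.log x) - -Real.log (-Real.log y) := by
    refine intervalIntegral.integral_eq_sub_of_hasDerivAt (f := fun w => -Real.log (-Real.log w))
      (fun w hw => ?_) hrec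
    rw [Set.uIcc_of_le hyx] at hw
    have hw0 : 0 < w := hy.trans_le hw.1
    have hl := (neg_log_pos_of_mem hw0 ((hw.2.trans hx0).trans_lt h1)).ne'
    refine (((Real.hasDerivAt_log hw0.ne').neg.log hl).neg).congr_deriv ?_
    rw [log_one_div]
    simp only [Pi.neg_apply]
    field_simp
  have hle : ∫ w in y..x, phiDeriv L x₀ w ≤ phiDeriv L x₀ x * (x - y) := by
    have := intervalIntegral.integral_mono_on hyx hφint
      (intervalIntegrable_const (c := phiDeriv L x₀ x)) fun w hw =>
        hmono (Set.uIcc_of_le hyx ▸ hw) (Set.uIcc_of_le hyx ▸ ⟨hyx, le_rfl⟩) hw.2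
    simpa [mul_comm] using this
  rw [intervalIntegral.integral_add hφint hrec, hF] at hsub
  rw [phi, phi, log_one_div, log_one_div]
  linarith

end

/-- With s = log(1/y) and a = 2 - 2/L, the left side is exp(a log s - s). For a ≤ 0 this decreases
in s. For a > 0 it peaks at s = a and decreases beyond, so κ is either its value at x or the peak
value. -/
theorem rpow_neg_log_le_kappa (hL : 0 < L) {x y : ℝ} (hy : 0 < y) (hyx : y ≤ x) (hx : x < 1) :
    y * (-Real.log y) ^ (2 - 2 / L) ≤ kappa L x := by
  have hx0 := hy.trans_le hyx
  set a := 2 - 2 / L with ha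
  set s := -Real.log y with hs
  set t := -Real.log x with ht
  have hts : t ≤ s := neg_le_neg (Real.log_le_log hy hyx)
  have ht0 : 0 < t := neg_log_pos_of_mem hx0 hx
  have hs0 : 0 < s := ht0.trans_le hts
  have hye : y = Real.exp (-s) := by rw [hs, neg_neg, Real.exp_log hy]
  have hxe : x = Real.exp (-t) := by rw [ht, neg_neg, Real.exp_log hx0]
  have hform : ∀ r : ℝ, 0 < r → Real.exp (-r) * r ^ a = Real.exp (a * Real.log r - r) :=
    fun r hr => by
      rw [Real.rpow_def_of_pos hr, ← Real.exp_add]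
      congr 1
      ring
  have hlog : ∀ r r' : ℝ, 0 < r → 0 < r' → Real.log r' - Real.log r ≤ r' / r - 1 :=
    fun r r' hr hr' => by
      rw [← Real.log_div hr'.ne' hr.ne']
      exact Real.log_le_sub_one_of_pos (by positivity)
  rw [kappa, log_one_div, ← ht, ← ha]
  by_cases hL1 : L ≤ 1
  · rw [if_pos (Or.inl hL1)]
    have ha0 : a ≤ 0 := by
      rw [ha, sub_nonpos, le_div_iff₀ hL]
      linarith
    have := Real.rpow_le_rpow_of_nonpos ht0 hts ha0
    gcongr
  · have ha0 : 0 < a := by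
      rw [ha, sub_pos, div_lt_iff₀ hL]
      linarith
    by_cases hxs : x ≤ Real.exp (2 / L - 2)
    · rw [if_pos (Or.inr hxs), hye, hxe, hform s hs0, hform t ht0, Real.exp_le_exp]
      have hat : a ≤ t := by
        rw [hxe, Real.exp_le_exp] at hxs
        linarith
      have e1 := mul_le_mul_of_nonneg_left (hlog t s ht0 hs0) ha0.le
      have e2 : a * (s / t - 1) ≤ s - t := by
        have : a * (s / t - 1) = a / t * (s - t) := by field_simp
        rw [this]
        exact mul_le_of_le_one_left (by linarith) ((div_le_one ht0).2 hat)
      linarith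
    · rw [if_neg (by tauto), hye, hform s hs0, Real.exp_le_exp]
      have e1 := mul_le_mul_of_nonneg_left (hlog a s ha0 hs0) ha0.le
      have e2 : a * (s / a - 1) = s - a := by field_simp
      linarith

theorem kappa_pos {x : ℝ} (h0 : 0 < x) (h1 : x < 1) : 0 < kappa L x := by
  have := neg_log_pos_of_mem h0 h1
  rw [kappa, log_one_div]
  split_ifs <;> positivity

end Phi

/-! ### Curvature of the loss, and its descent along a gradient step. -/

section Curvature

variable {d N : ℕ}

/-- The bound on the second derivative is required on [0, T) only, because the continuity argument
of `loss_segment_le` supplies it only strictly before T. -/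
theorem le_of_second_deriv_le {G G' G'' : ℝ → ℝ} {T M : ℝ} (hT : 0 ≤ T)
    (hG : ∀ t ∈ Set.Icc 0 T, HasDerivAt G (G' t) t)
    (hG' : ∀ t ∈ Set.Icc 0 T, HasDerivAt G' (G'' t) t) (hM : ∀ t ∈ Set.Ico 0 T, G'' t ≤ M) :
    G T ≤ G 0 + G' 0 * T + M * T ^ 2 / 2 := by
  have h1 : ∀ t ∈ Set.Icc 0 T, G' t ≤ G' 0 + M * t := by
    intro t ht
    refine image_le_of_deriv_right_le_deriv_boundary (f := G') (f' := G'') (a := 0) (b := T)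
      (B := fun t => G' 0 + M * t) (B' := fun _ => M)
      (fun s hs => (hG' s hs).continuousAt.continuousWithinAt)
      (fun s hs => (hG' s ⟨hs.1, hs.2.le⟩).hasDerivWithinAt) (by simp) (by fun_prop)
      (fun s _ => ?_) (fun s hs => hM s hs) ht
    simpa using (((hasDerivAt_id s).const_mul M).const_add (G' 0)).hasDerivWithinAt
  have h2 := image_le_of_deriv_right_le_deriv_boundary (f := G) (f' := G') (a := 0) (b := T)
      (B := fun t => G 0 + G' 0 * t + M * t ^ 2 / 2) (B' := fun t => G' 0 + M * t)
      (fun s hs => (hG s hs).continuousAt.continuousWithinAt)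
      (fun s hs => (hG s ⟨hs.1, hs.2.le⟩).hasDerivWithinAt) (by simp) (by fun_prop)
      (fun s _ => by
        have h3 := ((hasDerivAt_id s).const_mul (G' 0)).const_add (G 0)
        have h4 := (((hasDerivAt_id s).pow 2).const_mul M).div_const 2
        refine ((h3.add h4).congr_deriv ?_).hasDerivWithinAt
        simp
        ring) (fun s hs => h1 s ⟨hs.1, hs.2.le⟩) (Set.right_mem_Icc.2 hT)
  exact h2

/-- The left side is (ρ ^ L) ^ (2 - 2/L) with Λ/b ≤ ρ ^ L ≤ Λ/γ. The sign of the exponent decides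
which end matters, whence the maximum in C_η. -/
theorem rpow_two_mul_sub_two_le {L ρ γ b Λ : ℝ} (hL : 0 < L) (hρ : 0 < ρ) (hγ : 0 < γ)
    (hb : 0 < b) (h1 : γ * ρ ^ L ≤ Λ) (h2 : Λ ≤ b * ρ ^ L) :
    ρ ^ (2 * L - 2) ≤ max (γ ^ (-2 + 2 / L)) (b ^ (-2 + 2 / L)) * Λ ^ (2 - 2 / L) := by
  have hρL := Real.rpow_pos_of_pos hρ L
  have hΛ : 0 < Λ := lt_of_lt_of_le (by positivity) h1
  have e1 : ρ ^ (2 * L - 2) = (ρ ^ L) ^ (2 - 2 / L) := by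
    rw [← Real.rpow_mul hρ.le]
    congr 1
    field_simp
  have e2 : ∀ c : ℝ, 0 < c → (Λ / c) ^ (2 - 2 / L) = c ^ (-2 + 2 / L) * Λ ^ (2 - 2 / L) := by
    intro c hc
    rw [Real.div_rpow hΛ.le hc.le, show -2 + 2 / L = -(2 - 2 / L) by ring, Real.rpow_neg hc.le]
    ring
  have hΛs := Real.rpow_pos_of_pos hΛ (2 - 2 / L)
  rw [e1]
  rcases le_total 0 (2 - 2 / L) with hs | hs
  · refine (Real.rpow_le_rpow hρL.le ((le_div_iff₀ hγ).2 ?_) hs).trans ((e2 γ hγ).le.trans ?_)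
    · linarith
    · exact mul_le_mul_of_nonneg_right (le_max_left _ _) hΛs.le
  · refine (Real.rpow_le_rpow_of_nonpos (by positivity) ((div_le_iff₀ hb).2 ?_) hs).trans
      ((e2 b hb).le.trans ?_)
    · linarith
    · exact mul_le_mul_of_nonneg_right (le_max_right _ _) hΛs.le

theorem expLoss_second_deriv_le (q : Fin N → Euc d → ℝ) (z w : Euc d) :
    ∑ n, Real.exp (-q n z) * (inner ℝ (∇ (q n) z) w ^ 2 - inner ℝ (fderiv ℝ (∇ (q n)) z w) w) ≤
      (∑ n, Real.exp (-q n z) * (‖∇ (q n) z‖ ^ 2 + ‖fderiv ℝ (∇ (q n)) z‖)) * ‖w‖ ^ 2 := by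
  rw [Finset.sum_mul]
  refine Finset.sum_le_sum fun n _ => ?_
  rw [mul_assoc]
  refine mul_le_mul_of_nonneg_left ?_ (Real.exp_pos _).le
  have e1 : inner ℝ (∇ (q n) z) w ^ 2 ≤ (‖∇ (q n) z‖ * ‖w‖) ^ 2 := by
    rw [sq_le_sq, abs_of_nonneg (a := ‖∇ (q n) z‖ * ‖w‖) (by positivity)]
    exact abs_real_inner_le_norm _ _
  have e2 : -inner ℝ (fderiv ℝ (∇ (q n)) z w) w ≤ ‖fderiv ℝ (∇ (q n)) z‖ * ‖w‖ * ‖w‖ := by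
    refine (neg_le_abs _).trans ((abs_real_inner_le_norm _ _).trans ?_)
    gcongr
    exact ContinuousLinearMap.le_opNorm _ _
  nlinarith

/-- Twice continuously differentiable homogeneous margins, with bounds for the values, gradients and
Hessians on the unit sphere. -/
structure SmoothBounds (q : Fin N → Euc d → ℝ) (L b₀ b₁ b₂ : ℝ) : Prop where
  N_pos : 0 < N
  L_pos : 0 < L
  homLip : ∀ n, IsHomLip L (q n)
  contDiffAt : ∀ n θ, θ ≠ 0 → ContDiffAt ℝ 2 (q n) θ
  val_le : ∀ n θ, θ ≠ 0 → q n θ ≤ b₀ * ‖θ‖ ^ L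
  grad_le : ∀ n θ, θ ≠ 0 → ‖∇ (q n) θ‖ ≤ b₁ * ‖θ‖ ^ (L - 1)
  hess_le : ∀ n θ, θ ≠ 0 → ‖fderiv ℝ (∇ (q n)) θ‖ ≤ b₂ * ‖θ‖ ^ (L - 2)
  b₀_pos : 0 < b₀
  b₁_nonneg : 0 ≤ b₁
  b₂_nonneg : 0 ≤ b₂

/-- The negative gradient of the exponential loss. -/
def gradDir (q : Fin N → Euc d → ℝ) (θ : Euc d) : Euc d := descentDir q θ fun n => ∇ (q n) θ

/-- The constant `C_η`, in terms of its ingredients. -/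
def rateConst (L ρ₀ γ b₀ b₁ b₂ : ℝ) : ℝ :=
  1 / 2 * (b₁ ^ 2 + ρ₀ ^ (-L) * b₂) * max (γ ^ (-2 + 2 / L)) (b₀ ^ (-2 + 2 / L))

namespace SmoothBounds

variable {q : Fin N → Euc d → ℝ} {L b₀ b₁ b₂ : ℝ} (hb : SmoothBounds q L b₀ b₁ b₂)
include hb

theorem differentiableAt {n : Fin N} {θ : Euc d} (hθ : θ ≠ 0) : DifferentiableAt ℝ (q n) θ :=
  (hb.contDiffAt n θ hθ).differentiableAt two_ne_zero

theorem hasFDerivAt_gradient {n : Fin N} {θ : Euc d} (hθ : θ ≠ 0) :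
    HasFDerivAt (∇ (q n)) (fderiv ℝ (∇ (q n)) θ) θ := by
  have h1 : ContDiffAt ℝ 1 (fderiv ℝ (q n)) θ :=
    (hb.contDiffAt n θ hθ).fderiv_right (m := 1) (by norm_num)
  have h2 : DifferentiableAt ℝ (∇ (q n)) θ :=
    (InnerProductSpace.toDual ℝ (Euc d)).symm.toContinuousLinearEquiv.differentiableAt.comp θ
      (h1.differentiableAt one_ne_zero)
  exact h2.hasFDerivAt

theorem hasGradientAt {θ : Euc d} (hθ : θ ≠ 0) : HasGradientAt (expLoss q) (-gradDir q θ) θ :=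
  hasGradientAt_expLoss fun _ => (hb.differentiableAt hθ).hasGradientAt

theorem inner_gradDir {θ : Euc d} (hθ : θ ≠ 0) :
    inner ℝ (gradDir q θ) θ = L * weightedMargin q θ :=
  inner_descentDir fun n => inner_gradient_self (hb.homLip n).hom (hb.differentiableAt hθ)

theorem loss_pos (θ : Euc d) : 0 < expLoss q θ := expLoss_pos hb.N_pos

theorem neg_log_pos {θ : Euc d} (h : expLoss q θ < 1) : 0 < -Real.log (expLoss q θ) :=
  neg_log_pos_of_mem (hb.loss_pos θ) h

theorem ne_zero {θ : Euc d} (h : expLoss q θ < 1) : θ ≠ 0 :=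
  ne_zero_of_expLoss_lt_one hb.N_pos hb.homLip hb.L_pos h

theorem weightedMargin_pos {θ : Euc d} (h : expLoss q θ < 1) : 0 < weightedMargin q θ :=
  lt_of_lt_of_le (mul_pos (hb.loss_pos θ) (hb.neg_log_pos h)) le_weightedMargin

theorem inner_gradDir_pos {θ : Euc d} (h : expLoss q θ < 1) : 0 < inner ℝ (gradDir q θ) θ := by
  rw [hb.inner_gradDir (hb.ne_zero h)]
  exact mul_pos hb.L_pos (hb.weightedMargin_pos h)

theorem neg_log_le {θ : Euc d} (hθ : θ ≠ 0) : -Real.log (expLoss q θ) ≤ b₀ * ‖θ‖ ^ L :=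
  (neg_log_expLoss_le ⟨0, hb.N_pos⟩).trans (hb.val_le _ _ hθ)

theorem norm_sq_le_norm_add_sq {z : Euc d} (hz : expLoss q z < 1) {c : ℝ} (hc : 0 ≤ c) :
    ‖z‖ ^ 2 ≤ ‖z + c • gradDir q z‖ ^ 2 := by
  rw [norm_add_sq_real, real_inner_smul_right, real_inner_comm]
  have := mul_nonneg hc (hb.inner_gradDir_pos hz).le
  nlinarith [sq_nonneg ‖c • gradDir q z‖]

theorem norm_le_norm_add {z : Euc d} (hz : expLoss q z < 1) {c : ℝ} (hc : 0 ≤ c) :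
    ‖z‖ ≤ ‖z + c • gradDir q z‖ :=
  le_of_sq_le_sq (hb.norm_sq_le_norm_add_sq hz hc) (norm_nonneg _)

theorem add_smul_ne_zero {z : Euc d} (hz : expLoss q z < 1) {c : ℝ} (hc : 0 ≤ c) :
    z + c • gradDir q z ≠ 0 :=
  norm_pos_iff.1 ((norm_pos_iff.2 (hb.ne_zero hz)).trans_le (hb.norm_le_norm_add hz hc))

/-- The Hessian of the exponential loss in terms of its value. -/
theorem curvature_le {z : Euc d} {ρ₀ γ : ℝ} (hρ₀ : 0 < ρ₀) (hρ : ρ₀ ≤ ‖z‖) (hγ : 0 < γ)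
    (hm : γ * ‖z‖ ^ L ≤ -Real.log (expLoss q z)) :
    ∑ n, Real.exp (-q n z) * (‖∇ (q n) z‖ ^ 2 + ‖fderiv ℝ (∇ (q n)) z‖) ≤
      2 * rateConst L ρ₀ γ b₀ b₁ b₂ *
        (expLoss q z * (-Real.log (expLoss q z)) ^ (2 - 2 / L)) := by
  have hz0 : 0 < ‖z‖ := hρ₀.trans_le hρ
  have hz : z ≠ 0 := norm_pos_iff.1 hz0
  have hpow := rpow_two_mul_sub_two_le hb.L_pos hz0 hγ hb.b₀_pos hm (hb.neg_log_le hz)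
  have hc : 0 ≤ b₁ ^ 2 + ρ₀ ^ (-L) * b₂ := by
    have := hb.b₂_nonneg
    positivity
  have hterm : ∀ n, ‖∇ (q n) z‖ ^ 2 + ‖fderiv ℝ (∇ (q n)) z‖ ≤
      (b₁ ^ 2 + ρ₀ ^ (-L) * b₂) * ‖z‖ ^ (2 * L - 2) := fun n => by
    have e1 : ‖∇ (q n) z‖ ^ 2 ≤ b₁ ^ 2 * ‖z‖ ^ (2 * L - 2) := by
      refine (pow_le_pow_left₀ (norm_nonneg _) (hb.grad_le n z hz) 2).trans_eq ?_
      rw [mul_pow, ← Real.rpow_mul_natCast hz0.le]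
      congr 2
      push_cast
      ring
    have e2 : ‖fderiv ℝ (∇ (q n)) z‖ ≤ ρ₀ ^ (-L) * b₂ * ‖z‖ ^ (2 * L - 2) := by
      refine (hb.hess_le n z hz).trans ?_
      have h1 : ‖z‖ ^ (L - 2) = ‖z‖ ^ (-L) * ‖z‖ ^ (2 * L - 2) := by
        rw [← Real.rpow_add hz0]
        congr 1
        ring
      have h2 : ‖z‖ ^ (-L) ≤ ρ₀ ^ (-L) :=
        Real.rpow_le_rpow_of_nonpos hρ₀ hρ (neg_nonpos.2 hb.L_pos.le)
      have h3 := mul_le_mul_of_nonneg_left h2 hb.b₂_nonneg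
      have h4 := mul_le_mul_of_nonneg_right h3 (Real.rpow_pos_of_pos hz0 (2 * L - 2)).le
      rw [h1]
      linarith
    linarith
  calc ∑ n, Real.exp (-q n z) * (‖∇ (q n) z‖ ^ 2 + ‖fderiv ℝ (∇ (q n)) z‖)
      ≤ ∑ n, Real.exp (-q n z) * ((b₁ ^ 2 + ρ₀ ^ (-L) * b₂) * ‖z‖ ^ (2 * L - 2)) :=
        Finset.sum_le_sum fun n _ => mul_le_mul_of_nonneg_left (hterm n) (Real.exp_pos _).le
    _ = expLoss q z * ((b₁ ^ 2 + ρ₀ ^ (-L) * b₂) * ‖z‖ ^ (2 * L - 2)) := by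
        rw [← Finset.sum_mul]
        rfl
    _ ≤ expLoss q z * ((b₁ ^ 2 + ρ₀ ^ (-L) * b₂) *
          (max (γ ^ (-2 + 2 / L)) (b₀ ^ (-2 + 2 / L)) *
            (-Real.log (expLoss q z)) ^ (2 - 2 / L))) := by
        have := (hb.loss_pos z).le
        gcongr
    _ = _ := by
        rw [rateConst]
        ring

theorem rateConst_nonneg {ρ₀ γ : ℝ} (hρ₀ : 0 < ρ₀) : 0 ≤ rateConst L ρ₀ γ b₀ b₁ b₂ := by
  have := hb.b₂_nonneg
  have := hb.b₀_pos
  have : 0 ≤ max (γ ^ (-2 + 2 / L)) (b₀ ^ (-2 + 2 / L)) :=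
    le_max_of_le_right (by positivity)
  rw [rateConst]
  positivity

theorem hasDerivAt_expLoss_line {z w : Euc d} {α : ℝ} (hne : z + α • w ≠ 0) :
    HasDerivAt (fun s : ℝ => expLoss q (z + s • w))
      (-∑ n, Real.exp (-q n (z + α • w)) * inner ℝ (∇ (q n) (z + α • w)) w) α := by
  have hline : HasDerivAt (fun s : ℝ => z + s • w) w α := by
    simpa using ((hasDerivAt_id α).smul_const w).const_add z
  have h1 := (hb.hasGradientAt hne).hasFDerivAt.comp_hasDerivAt α hline
  refine h1.congr_deriv ?_
  rw [InnerProductSpace.toDual_apply_apply, inner_neg_left, gradDir, descentDir, sum_inner]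
  simp only [real_inner_smul_left]

theorem hasDerivAt_expLoss_line_two {z w : Euc d} {α : ℝ} (hne : z + α • w ≠ 0) :
    HasDerivAt
      (fun s : ℝ => -∑ n, Real.exp (-q n (z + s • w)) * inner ℝ (∇ (q n) (z + s • w)) w)
      (∑ n, Real.exp (-q n (z + α • w)) * (inner ℝ (∇ (q n) (z + α • w)) w ^ 2 -
        inner ℝ (fderiv ℝ (∇ (q n)) (z + α • w) w) w)) α := by
  have hline : HasDerivAt (fun s : ℝ => z + s • w) w α := by
    simpa using ((hasDerivAt_id α).smul_const w).const_add z
  have h1 : ∀ n, HasDerivAt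
      (fun s : ℝ => Real.exp (-q n (z + s • w)) * inner ℝ (∇ (q n) (z + s • w)) w)
      (-(Real.exp (-q n (z + α • w)) * (inner ℝ (∇ (q n) (z + α • w)) w ^ 2 -
        inner ℝ (fderiv ℝ (∇ (q n)) (z + α • w) w) w))) α := fun n => by
    have e1 : HasDerivAt (fun s : ℝ => q n (z + s • w)) (inner ℝ (∇ (q n) (z + α • w)) w) α := by
      rw [inner_gradient_left]
      exact (hb.differentiableAt hne).hasFDerivAt.comp_hasDerivAt α hline
    have e2 : HasDerivAt (fun s : ℝ => ∇ (q n) (z + s • w))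
        (fderiv ℝ (∇ (q n)) (z + α • w) w) α := by
      have := (hb.hasFDerivAt_gradient (n := n) hne).comp_hasDerivAt α hline
      exact this
    refine (e1.neg.exp.mul (e2.inner ℝ (hasDerivAt_const α w))).congr_deriv ?_
    simp only [inner_zero_right, zero_add, Pi.neg_apply]
    ring
  refine (HasDerivAt.fun_sum fun n _ => h1 n).neg.congr_deriv ?_
  rw [Finset.sum_neg_distrib, neg_neg]

/-- Descent along a gradient step. The Hessian bound along the step needs the smoothed margin at the
intermediate points, which `hmargin` provides once the loss there is under control. -/
theorem loss_segment_le {z : Euc d} {ρ₀ γ η μ K : ℝ} (hρ₀ : 0 < ρ₀) (hρ : ρ₀ ≤ ‖z‖)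
    (hz : expLoss q z < 1) (hγ : 0 < γ) (hη : 0 ≤ η)
    (hK : ∀ y, 0 < y → y ≤ expLoss q z → y * (-Real.log y) ^ (2 - 2 / L) ≤ K)
    (hμ : η * (rateConst L ρ₀ γ b₀ b₁ b₂ * K) ≤ μ) (hμ2 : μ ≤ 1 / 2)
    (hmargin : ∀ α ∈ Set.Icc (0 : ℝ) 1, expLoss q (z + (α * η) • gradDir q z) ≤
      expLoss q z - α * η * (1 - α * μ) * ‖gradDir q z‖ ^ 2 →
      γ * ‖z + (α * η) • gradDir q z‖ ^ L <
        -Real.log (expLoss q (z + (α * η) • gradDir q z))) :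
    ∀ α ∈ Set.Icc (0 : ℝ) 1, expLoss q (z + (α * η) • gradDir q z) ≤
      expLoss q z - α * η * (1 - α * μ) * ‖gradDir q z‖ ^ 2 := by
  -- For η > 0 the loss has strictly negative derivative at the start of the segment, which the
  -- argument below uses.
  rcases hη.eq_or_lt with rfl | hη0
  · intro α _
    simp
  set p := gradDir q z with hp
  have hpz := hb.inner_gradDir_pos hz
  have hp0 : 0 < ‖p‖ := by
    refine norm_pos_iff.2 fun h0 => ?_
    rw [← hp, h0, inner_zero_left] at hpz
    exact lt_irrefl _ hpz
  set G : ℝ → ℝ := fun α => expLoss q (z + α • η • p) with hG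
  have hG0 : G 0 = expLoss q z := by simp [hG]
  have hnorm : ∀ α : ℝ, z + (α * η) • p = z + α • η • p := fun α => by rw [smul_smul]
  simp only [hnorm] at hmargin ⊢
  have hne : ∀ α : ℝ, 0 ≤ α → z + α • η • p ≠ 0 := fun α hα => by
    rw [← hnorm]
    exact hb.add_smul_ne_zero hz (mul_nonneg hα hη)
  have hge : ∀ α : ℝ, 0 ≤ α → ρ₀ ≤ ‖z + α • η • p‖ := fun α hα => by
    rw [← hnorm]
    exact hρ.trans (hb.norm_le_norm_add hz (mul_nonneg hα hη))
  have hGpos : ∀ α, 0 < G α := fun α => hb.loss_pos _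
  have hGd0 : HasDerivAt G (-(η * ‖p‖ ^ 2)) 0 := by
    refine (hb.hasDerivAt_expLoss_line (hne 0 le_rfl)).congr_deriv ?_
    rw [zero_smul, add_zero]
    have : ∑ n, Real.exp (-q n z) * inner ℝ (∇ (q n) z) (η • p) = inner ℝ p (η • p) := by
      conv_rhs => arg 2; rw [hp, gradDir, descentDir]
      rw [sum_inner]
      simp only [real_inner_smul_left]
    rw [this, real_inner_smul_right, real_inner_self_eq_norm_sq]
  set good : ℝ → Prop := fun α => G α ≤ expLoss q z ∧
    γ * ‖z + α • η • p‖ ^ L ≤ -Real.log (G α) with hgood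
  -- Good points before T bound the curvature by 2 C_η K ‖η p‖², and Taylor's formula turns this
  -- into the descent estimate at T itself.
  have hcalc : ∀ T ∈ Set.Icc (0 : ℝ) 1, (∀ β ∈ Set.Ico 0 T, good β) →
      G T ≤ expLoss q z - T * η * (1 - T * μ) * ‖p‖ ^ 2 := by
    intro T hT hgoodT
    have h1 := le_of_second_deriv_le (G := G) (M := 2 * rateConst L ρ₀ γ b₀ b₁ b₂ * K *
        ‖η • p‖ ^ 2) hT.1
      (fun t ht => hb.hasDerivAt_expLoss_line (hne t ht.1))
      (fun t ht => hb.hasDerivAt_expLoss_line_two (hne t ht.1))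
      (fun t ht => by
        refine (expLoss_second_deriv_le _ _ _).trans ?_
        refine mul_le_mul_of_nonneg_right ?_ (sq_nonneg _)
        refine (hb.curvature_le hρ₀ (hge t ht.1) hγ (hgoodT t ht).2).trans ?_
        refine mul_le_mul_of_nonneg_left (hK _ (hGpos t) (hgoodT t ht).1) ?_
        have := hb.rateConst_nonneg (γ := γ) hρ₀
        positivity)
    have h2 := (hb.hasDerivAt_expLoss_line (w := η • p) (hne 0 le_rfl)).unique hGd0
    rw [h2, hG0, norm_smul, Real.norm_of_nonneg hη] at h1
    have h3 := mul_le_mul_of_nonneg_right hμ (show 0 ≤ η * ‖p‖ ^ 2 * T ^ 2 by positivity)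
    nlinarith
  have hcontz : Continuous fun α : ℝ => z + α • η • p := by fun_prop
  have hGcont : Continuous G := (continuous_expLoss hb.homLip hb.L_pos).comp hcontz
  have hmcont : Continuous fun α : ℝ => γ * ‖z + α • η • p‖ ^ L :=
    continuous_const.mul (hcontz.norm.rpow_const fun _ => Or.inr hb.L_pos.le)
  have hlcont : Continuous fun α => -Real.log (G α) :=
    (hGcont.log fun α => (hGpos α).ne').neg
  have hnext : ∀ T ∈ Set.Icc (0 : ℝ) 1, (∀ β ∈ Set.Ico 0 T, good β) →
      ∀ᶠ β in 𝓝 T, T ≤ β → good β := by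
    intro T hT hgoodT
    have hGT := hcalc T hT hgoodT
    have hmT : ∀ᶠ β in 𝓝 T, γ * ‖z + β • η • p‖ ^ L < -Real.log (G β) :=
      hmcont.continuousAt.eventually_lt hlcont.continuousAt (hmargin T hT hGT)
    -- For T > 0 the loss at T is strictly below its initial value and continuity suffices. At T = 0
    -- there is no slack, so the sign of the derivative is used.
    have hlT : ∀ᶠ β in 𝓝 T, T ≤ β → G β ≤ expLoss q z := by
      rcases hT.1.eq_or_lt with rfl | hT0
      · have h1 := hGd0.tendsto_slope_zero_right.eventually
          (gt_mem_nhds (show -(η * ‖p‖ ^ 2) < 0 by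
            have : 0 < η * ‖p‖ ^ 2 := by positivity
            linarith))
        rw [eventually_nhdsWithin_iff] at h1
        filter_upwards [h1] with β hβ hβ0
        rcases hβ0.eq_or_lt with rfl | hβ1
        · exact hG0.le
        · have h2 := hβ hβ1
          rw [zero_add, smul_eq_mul, inv_mul_lt_iff₀ hβ1, mul_zero, hG0] at h2
          linarith
      · have hlt : G T < expLoss q z := by
          refine hGT.trans_lt (sub_lt_self _ ?_)
          have h1 : T * μ ≤ 1 / 2 := by
            rcases le_total 0 μ with h | h
            · nlinarith [hT.2]
            · nlinarith
          have : 0 < 1 - T * μ := by linarith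
          positivity
        exact (hGcont.continuousAt.eventually (gt_mem_nhds hlt)).mono fun β hβ _ => hβ.le
    filter_upwards [hmT, hlT] with β h1 h2 h3
    exact ⟨h2 h3, h1.le⟩
  -- The infimum of the bad parameters would have only good points before it and, by `hnext`, also
  -- just after it.
  have hall : ∀ α ∈ Set.Icc (0 : ℝ) 1, good α := by
    by_contra! hcon
    set S := {α ∈ Set.Icc (0 : ℝ) 1 | ¬good α} with hS
    have hSne : S.Nonempty := by
      obtain ⟨α, hα, hbad⟩ := hcon
      exact ⟨α, hα, hbad⟩
    have hSb : BddBelow S := ⟨0, fun α hα => hα.1.1⟩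
    set T := sInf S
    have hT0 : 0 ≤ T := le_csInf hSne fun α hα => hα.1.1
    have hT1 : T ≤ 1 := by
      obtain ⟨α, hα⟩ := hSne
      exact (csInf_le hSb hα).trans hα.1.2
    have hbelow : ∀ β ∈ Set.Ico 0 T, good β := fun β hβ => by
      by_contra hbad
      exact absurd (csInf_le hSb ⟨⟨hβ.1, hβ.2.le.trans hT1⟩, hbad⟩) (not_le.2 hβ.2)
    obtain ⟨ε, hε, hball⟩ := Metric.eventually_nhds_iff.1 (hnext T ⟨hT0, hT1⟩ hbelow)
    obtain ⟨α, hα, hαT⟩ := exists_lt_of_csInf_lt hSne (show sInf S < T + ε by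
      change T < T + ε
      linarith)
    have hTα : T ≤ α := csInf_le hSb hα
    exact hα.2 (hball (by rw [Real.dist_eq, abs_of_nonneg (by linarith)]; linarith) hTα)
  exact fun α hα => hcalc α hα fun β hβ => hall β ⟨hβ.1, hβ.2.le.trans hα.2⟩

end SmoothBounds

end Curvature

/-! ### Growth of the smoothed margin in one step of gradient descent. -/

section DescentStep

variable {d N : ℕ} {q : Fin N → Euc d → ℝ} {L b₀ b₁ b₂ : ℝ}

/-- The logarithm of the smoothed normalized margin used for gradient descent. -/
def smoothedLogMargin (q : Fin N → Euc d → ℝ) (L x₀ : ℝ) (z : Euc d) : ℝ :=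
  phi L x₀ (expLoss q z) - L * Real.log ‖z‖

theorem mu_nonneg {x₀ x : ℝ} (hx : 0 < x) (hx0 : x ≤ x₀) (h1 : x₀ < 1) : 0 ≤ mu x₀ x := by
  have e1 := neg_log_pos_of_mem hx (hx0.trans_lt h1)
  have e2 := neg_log_pos_of_mem (hx.trans_le hx0) h1
  rw [mu, log_one_div, log_one_div]
  positivity

theorem mu_le_half {x₀ x : ℝ} (hx : 0 < x) (hx0 : x ≤ x₀) (h1 : x₀ < 1) : mu x₀ x ≤ 1 / 2 := by
  have e1 := neg_log_pos_of_mem hx (hx0.trans_lt h1)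
  have e2 := Real.log_le_log hx hx0
  rw [mu, log_one_div, log_one_div, div_le_div_iff₀ (by positivity) two_pos]
  linarith

namespace SmoothBounds

variable (hb : SmoothBounds q L b₀ b₁ b₂) {z : Euc d} {x₀ ρ₀ γ η : ℝ}
include hb

theorem mul_rpow_lt_neg_log (h1 : x₀ < 1) (hz : expLoss q z ≤ x₀) (hγ : 0 < γ)
    (hΓ : Real.log γ ≤ smoothedLogMargin q L x₀ z) :
    γ * ‖z‖ ^ L < -Real.log (expLoss q z) := by
  have hℓ := hb.loss_pos z
  have hz1 := hz.trans_lt h1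
  have hρ := norm_pos_iff.2 (hb.ne_zero hz1)
  have hρL := Real.rpow_pos_of_pos hρ L
  have hφ := phi_lt hb.L_pos (hℓ.trans_le hz) h1 hℓ hz
  rw [smoothedLogMargin] at hΓ
  rw [← Real.log_lt_log_iff (by positivity) (hb.neg_log_pos hz1),
    Real.log_mul hγ.ne' hρL.ne', Real.log_rpow hρ]
  linarith

theorem mul_neg_log_le (hz : expLoss q z < 1) :
    L * -Real.log (expLoss q z) ≤ b₁ * ‖z‖ ^ L := by
  have hne := hb.ne_zero hz
  have hρ := norm_pos_iff.2 hne
  set n : Fin N := ⟨0, hb.N_pos⟩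
  have e1 := inner_gradient_self (hb.homLip n).hom (hb.differentiableAt hne)
  have e2 := real_inner_le_norm (∇ (q n) z) z
  have e3 := mul_le_mul_of_nonneg_right (hb.grad_le n z hne) hρ.le
  have e4 := mul_le_mul_of_nonneg_left (neg_log_expLoss_le (q := q) (θ := z) n) hb.L_pos.le
  have e5 : ‖z‖ ^ L = ‖z‖ ^ (L - 1) * ‖z‖ := by
    rw [← Real.rpow_add_one hρ.ne', sub_add_cancel]
  rw [e5, ← mul_assoc]
  linarith

/-- This bounds the second-order term of log‖z + α η p‖ in `smoothedLogMargin_segment`. It uses the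
b₁² part of C_η together with L log(1/ℒ) ≤ b₁ ‖z‖ ^ L. -/
theorem step_size_le (h1 : x₀ < 1) (hz : expLoss q z ≤ x₀) (hρ₀ : 0 < ρ₀) (hγ : 0 < γ)
    (hη : 0 ≤ η) (hΓ : Real.log γ ≤ smoothedLogMargin q L x₀ z)
    (hrate : η * (rateConst L ρ₀ γ b₀ b₁ b₂ * kappa L (expLoss q z)) ≤ mu x₀ (expLoss q z)) :
    L ^ 2 * expLoss q z * (-Real.log (expLoss q z)) ^ 2 * η ≤
      2 * mu x₀ (expLoss q z) * ‖z‖ ^ 2 := by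
  have hℓ := hb.loss_pos z
  have hz1 := hz.trans_lt h1
  have hne := hb.ne_zero hz1
  have hρ := norm_pos_iff.2 hne
  have hΛ := hb.neg_log_pos hz1
  have hpow := rpow_two_mul_sub_two_le hb.L_pos hρ hγ hb.b₀_pos
    (hb.mul_rpow_lt_neg_log h1 hz hγ hΓ).le (hb.neg_log_le hne)
  set Λ := -Real.log (expLoss q z)
  set m := max (γ ^ (-2 + 2 / L)) (b₀ ^ (-2 + 2 / L))
  have hm : 0 ≤ m := le_max_of_le_right (Real.rpow_pos_of_pos hb.b₀_pos _).le
  have hκ : expLoss q z * Λ ^ (2 - 2 / L) ≤ kappa L (expLoss q z) :=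
    rpow_neg_log_le_kappa hb.L_pos hℓ le_rfl hz1
  have hr := Real.rpow_pos_of_pos hρ (2 * L - 2)
  have hb2 : 0 ≤ ρ₀ ^ (-L) * b₂ := mul_nonneg (Real.rpow_pos_of_pos hρ₀ _).le hb.b₂_nonneg
  have e1 : 1 / 2 * b₁ ^ 2 * ‖z‖ ^ (2 * L - 2) * expLoss q z ≤
      rateConst L ρ₀ γ b₀ b₁ b₂ * kappa L (expLoss q z) := by
    calc 1 / 2 * b₁ ^ 2 * ‖z‖ ^ (2 * L - 2) * expLoss q z
        ≤ 1 / 2 * (b₁ ^ 2 + ρ₀ ^ (-L) * b₂) * (m * Λ ^ (2 - 2 / L)) * expLoss q z := by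
          gcongr
          linarith
      _ = 1 / 2 * (b₁ ^ 2 + ρ₀ ^ (-L) * b₂) * m * (expLoss q z * Λ ^ (2 - 2 / L)) := by ring
      _ ≤ _ := by
          rw [rateConst]
          gcongr
  have e2 : (L * Λ) ^ 2 ≤ b₁ ^ 2 * ‖z‖ ^ (2 * L - 2) * ‖z‖ ^ 2 := by
    refine (pow_le_pow_left₀ (mul_pos hb.L_pos hΛ).le (hb.mul_neg_log_le hz1) 2).trans_eq ?_
    have : (‖z‖ ^ L) ^ 2 = ‖z‖ ^ (2 * L - 2) * ‖z‖ ^ 2 := by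
      rw [← Real.rpow_natCast (‖z‖ ^ L), ← Real.rpow_mul hρ.le, ← Real.rpow_natCast ‖z‖,
        ← Real.rpow_add hρ]
      congr 1
      push_cast
      ring
    rw [mul_pow, this, mul_assoc]
  have e3 := mul_le_mul_of_nonneg_left e1 hη
  have e4 := mul_le_mul_of_nonneg_right (e3.trans hrate) (sq_nonneg ‖z‖)
  have e5 := mul_le_mul_of_nonneg_left e2 (mul_nonneg hη hℓ.le)
  nlinarith

theorem growth_nonneg (hz1 : expLoss q z < 1) :
    L * inner ℝ (gradDir q z) z / ‖z‖ ^ 2 *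
        (‖gradDir q z‖ ^ 2 * ‖z‖ ^ 2 / inner ℝ (gradDir q z) z ^ 2 - 1) ≤
      ‖gradDir q z‖ ^ 2 / (expLoss q z * -Real.log (expLoss q z)) -
        L * inner ℝ (gradDir q z) z / ‖z‖ ^ 2 := by
  have hℓ := hb.loss_pos z
  have hne := hb.ne_zero hz1
  have hρ := norm_pos_iff.2 hne
  have hΛ := hb.neg_log_pos hz1
  have hν := le_weightedMargin (q := q) (θ := z)
  have hν0 := hb.weightedMargin_pos hz1
  have hL := hb.L_pos
  rw [hb.inner_gradDir hne]
  have e1 : L * (L * weightedMargin q z) / ‖z‖ ^ 2 *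
      (‖gradDir q z‖ ^ 2 * ‖z‖ ^ 2 / (L * weightedMargin q z) ^ 2 - 1) =
      ‖gradDir q z‖ ^ 2 / weightedMargin q z - L * (L * weightedMargin q z) / ‖z‖ ^ 2 := by
    field_simp
  rw [e1]
  gcongr

/-- Convexity of φ turns the decrease of the loss into growth of φ(ℒ). The extra factor in φ'
offsets the loss factor 1 - α μ and leaves a surplus covering the second-order term of log‖·‖, so
the continuous-time growth rate survives. -/
theorem smoothedLogMargin_segment (h1 : x₀ < 1) (hz : expLoss q z ≤ x₀) (hρ₀ : 0 < ρ₀)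
    (hγ : 0 < γ) (hη : 0 ≤ η) (hΓ : Real.log γ ≤ smoothedLogMargin q L x₀ z)
    (hrate : η * (rateConst L ρ₀ γ b₀ b₁ b₂ * kappa L (expLoss q z)) ≤ mu x₀ (expLoss q z))
    {α : ℝ} (hα : α ∈ Set.Icc (0 : ℝ) 1)
    (hle : expLoss q (z + (α * η) • gradDir q z) ≤ expLoss q z -
      α * η * (1 - α * mu x₀ (expLoss q z)) * ‖gradDir q z‖ ^ 2) :
    smoothedLogMargin q L x₀ z +
        α * η * (‖gradDir q z‖ ^ 2 / (expLoss q z * -Real.log (expLoss q z)) -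
          L * inner ℝ (gradDir q z) z / ‖z‖ ^ 2) ≤
      smoothedLogMargin q L x₀ (z + (α * η) • gradDir q z) := by
  have hL := hb.L_pos
  have hℓ := hb.loss_pos z
  have hz1 := hz.trans_lt h1
  have hne := hb.ne_zero hz1
  have hρ := norm_pos_iff.2 hne
  have hΛ := hb.neg_log_pos hz1
  have hsize := hb.step_size_le h1 hz hρ₀ hγ hη hΓ hrate
  have hμ0 := mu_nonneg hℓ hz h1
  have hμ1 := mu_le_half hℓ hz h1
  have hαη : 0 ≤ α * η := mul_nonneg hα.1 hη
  have hnorm : ‖z + (α * η) • gradDir q z‖ ^ 2 =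
      ‖z‖ ^ 2 + (2 * (α * η) * inner ℝ (gradDir q z) z + (α * η) ^ 2 * ‖gradDir q z‖ ^ 2) := by
    rw [norm_add_sq_real, real_inner_smul_right, real_inner_comm, norm_smul,
      Real.norm_of_nonneg hαη]
    ring
  have hne' := norm_pos_iff.2 (hb.add_smul_ne_zero hz1 hαη)
  have hφ := phi_sub_le hL (hℓ.trans_le hz) h1 (hb.loss_pos (z + (α * η) • gradDir q z))
    (hle.trans (sub_le_self _ (by
      have : α * mu x₀ (expLoss q z) ≤ 1 := by nlinarith [hα.1, hα.2]
      have : 0 ≤ 1 - α * mu x₀ (expLoss q z) := by linarith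
      positivity))) hz
  have hslope := phiSlope_le_neg_phiDeriv (L := L) h1 hℓ hz
  rw [phiSlope, lam, log_one_div] at hslope
  set p := gradDir q z
  set ℓ := expLoss q z
  set ℓ' := expLoss q (z + (α * η) • p)
  set Λ := -Real.log ℓ
  set μ := mu x₀ ℓ
  set I := inner ℝ p z
  have hαμ : α * μ ≤ 1 / 2 := by nlinarith [hα.1, hα.2]
  have hk : 0 ≤ Λ⁻¹ / L := by positivity
  -- With k = Λ⁻¹/L the difference of the sides is (1 + k) μ ((1 - α) + (1 - 2 α μ)), nonnegative
  -- since α ≤ 1 and α μ ≤ 1/2.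
  have hcoef : 1 + α * μ * (Λ⁻¹ / L) ≤ (1 - α * μ) * (1 + 2 * (1 + Λ⁻¹ / L) * μ) := by
    have e1 : 0 ≤ (1 + Λ⁻¹ / L) * μ * (1 - α) :=
      mul_nonneg (by positivity) (by linarith [hα.2])
    have e2 : 0 ≤ (1 + Λ⁻¹ / L) * μ * (1 - 2 * (α * μ)) :=
      mul_nonneg (by positivity) (by linarith)
    nlinarith
  have hdecr : α * η * (1 - α * μ) * ‖p‖ ^ 2 ≤ ℓ - ℓ' := by linarith
  have hφ2 : (1 + α * μ * (Λ⁻¹ / L)) / (ℓ * Λ) * (α * η * ‖p‖ ^ 2) ≤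
      phi L x₀ ℓ' - phi L x₀ ℓ := by
    have e1 : (1 + α * μ * (Λ⁻¹ / L)) / (ℓ * Λ) * (α * η * ‖p‖ ^ 2) ≤
        (1 + 2 * (1 + Λ⁻¹ / L) * μ) / (ℓ * Λ) * (α * η * (1 - α * μ) * ‖p‖ ^ 2) := by
      calc (1 + α * μ * (Λ⁻¹ / L)) / (ℓ * Λ) * (α * η * ‖p‖ ^ 2)
          ≤ ((1 - α * μ) * (1 + 2 * (1 + Λ⁻¹ / L) * μ)) / (ℓ * Λ) * (α * η * ‖p‖ ^ 2) := by
            gcongr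
        _ = _ := by ring
    have e2 : (1 + 2 * (1 + Λ⁻¹ / L) * μ) / (ℓ * Λ) * (α * η * (1 - α * μ) * ‖p‖ ^ 2) ≤
        (1 + 2 * (1 + Λ⁻¹ / L) * μ) / (ℓ * Λ) * (ℓ - ℓ') :=
      mul_le_mul_of_nonneg_left hdecr (by positivity)
    have e3 : (1 + 2 * (1 + Λ⁻¹ / L) * μ) / (ℓ * Λ) * (ℓ - ℓ') ≤ -phiDeriv L x₀ ℓ * (ℓ - ℓ') := by
      refine mul_le_mul_of_nonneg_right hslope (le_trans ?_ hdecr)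
      have : 0 ≤ 1 - α * μ := by linarith
      positivity
    linarith
  have hlog : L * (Real.log ‖z + (α * η) • p‖ - Real.log ‖z‖) ≤
      α * η * (L * I / ‖z‖ ^ 2) + L * ((α * η) ^ 2 * ‖p‖ ^ 2) / (2 * ‖z‖ ^ 2) := by
    have e1 := Real.log_le_sub_one_of_pos
      (show 0 < ‖z + (α * η) • p‖ ^ 2 / ‖z‖ ^ 2 by positivity)
    rw [Real.log_div (by positivity) (by positivity), Real.log_pow, Real.log_pow, hnorm] at e1
    push_cast at e1
    have e2 : L * (‖z‖ ^ 2 + (2 * (α * η) * I + (α * η) ^ 2 * ‖p‖ ^ 2)) / ‖z‖ ^ 2 - L =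
        2 * (α * η * (L * I / ‖z‖ ^ 2) + L * ((α * η) ^ 2 * ‖p‖ ^ 2) / (2 * ‖z‖ ^ 2)) := by
      field_simp
      ring
    have e3 := mul_le_mul_of_nonneg_left e1 hL.le
    have e4 : L * ((‖z‖ ^ 2 + (2 * (α * η) * I + (α * η) ^ 2 * ‖p‖ ^ 2)) / ‖z‖ ^ 2 - 1) =
        L * (‖z‖ ^ 2 + (2 * (α * η) * I + (α * η) ^ 2 * ‖p‖ ^ 2)) / ‖z‖ ^ 2 - L := by ring
    rw [e4, e2] at e3
    linarith
  have hquad : L * ((α * η) ^ 2 * ‖p‖ ^ 2) / (2 * ‖z‖ ^ 2) ≤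
      α * μ * (Λ⁻¹ / L) / (ℓ * Λ) * (α * η * ‖p‖ ^ 2) := by
    have e1 : α * μ * (Λ⁻¹ / L) / (ℓ * Λ) * (α * η * ‖p‖ ^ 2) =
        α * μ * (α * η * ‖p‖ ^ 2) / (L * ℓ * Λ ^ 2) := by
      field_simp
    rw [e1, div_le_div_iff₀ (by positivity) (by positivity)]
    have e2 := mul_le_mul_of_nonneg_left hsize (show 0 ≤ α ^ 2 * η * ‖p‖ ^ 2 by positivity)
    nlinarith
  have hsplit : (1 + α * μ * (Λ⁻¹ / L)) / (ℓ * Λ) * (α * η * ‖p‖ ^ 2) =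
      α * η * (‖p‖ ^ 2 / (ℓ * Λ)) + α * μ * (Λ⁻¹ / L) / (ℓ * Λ) * (α * η * ‖p‖ ^ 2) := by ring
  simp only [smoothedLogMargin]
  change phi L x₀ ℓ - L * Real.log ‖z‖ + α * η * (‖p‖ ^ 2 / (ℓ * Λ) - L * I / ‖z‖ ^ 2) ≤
    phi L x₀ ℓ' - L * Real.log ‖z + (α * η) • p‖
  linarith

/-- One step of gradient descent under the learning rate condition: the loss decreases, and the
smoothed normalized margin grows. -/
theorem descent_step (h1 : x₀ < 1) (hz : expLoss q z ≤ x₀) (hρ₀ : 0 < ρ₀) (hρ : ρ₀ ≤ ‖z‖)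
    (hγ : 0 < γ) (hη : 0 ≤ η) (hΓ : Real.log γ ≤ smoothedLogMargin q L x₀ z)
    (hrate : η * (rateConst L ρ₀ γ b₀ b₁ b₂ * kappa L (expLoss q z)) ≤ mu x₀ (expLoss q z)) :
    expLoss q (z + η • gradDir q z) ≤ expLoss q z - 1 / 2 * η * ‖gradDir q z‖ ^ 2 ∧
    smoothedLogMargin q L x₀ z + η * (L * inner ℝ (gradDir q z) z / ‖z‖ ^ 2 *
        (‖gradDir q z‖ ^ 2 * ‖z‖ ^ 2 / inner ℝ (gradDir q z) z ^ 2 - 1)) ≤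
      smoothedLogMargin q L x₀ (z + η • gradDir q z) := by
  have hℓ := hb.loss_pos z
  have hz1 := hz.trans_lt h1
  have hμ0 := mu_nonneg hℓ hz h1
  have hμ1 := mu_le_half hℓ hz h1
  have hgrow := hb.growth_nonneg hz1
  have hgrow0 : 0 ≤ L * inner ℝ (gradDir q z) z / ‖z‖ ^ 2 *
      (‖gradDir q z‖ ^ 2 * ‖z‖ ^ 2 / inner ℝ (gradDir q z) z ^ 2 - 1) := by
    have e1 := hb.inner_gradDir_pos hz1
    have e2 := one_le_norm_sq_mul_div_inner_sq e1
    have := hb.L_pos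
    exact mul_nonneg (by positivity) (by linarith)
  have hseg := hb.loss_segment_le hρ₀ hρ hz1 hγ hη
    (fun y hy hyℓ => rpow_neg_log_le_kappa hb.L_pos hy hyℓ hz1) hrate hμ1
    -- The loss bound at a parameter yields the margin bound at the same parameter, with strictness
    -- coming from φ(x) < log log(1/x).
    (fun α hα hle => by
      have h2 := hb.smoothedLogMargin_segment h1 hz hρ₀ hγ hη hΓ hrate hα hle
      have hαη : 0 ≤ α * η := mul_nonneg hα.1 hη
      have h3 : 0 ≤ 1 - α * mu x₀ (expLoss q z) := by nlinarith [hα.1, hα.2]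
      refine hb.mul_rpow_lt_neg_log h1 (hle.trans ((sub_le_self _ (by positivity)).trans hz)) hγ
        (hΓ.trans (le_trans ?_ h2))
      exact le_add_of_nonneg_right (mul_nonneg hαη (hgrow0.trans hgrow)))
  have h4 := hseg 1 (Set.right_mem_Icc.2 zero_le_one)
  have h5 := hb.smoothedLogMargin_segment h1 hz hρ₀ hγ hη hΓ hrate
    (Set.right_mem_Icc.2 zero_le_one) h4
  simp only [one_mul] at h4 h5
  refine ⟨h4.trans ?_, le_trans ?_ h5⟩
  · have : 0 ≤ η * ‖gradDir q z‖ ^ 2 := by positivity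
    nlinarith
  · have := mul_le_mul_of_nonneg_left hgrow hη
    linarith

end SmoothBounds

end DescentStep

/-! ### Gradient descent: invariants, divergence of the norm, aligned points. -/

section GradientDescent

variable {d N : ℕ}

theorem norm_normalized_sub_le {x y : Euc d} (hx : x ≠ 0) (hy : y ≠ 0) :
    ‖‖x‖⁻¹ • x - ‖y‖⁻¹ • y‖ ≤ 2 * ‖x - y‖ / ‖y‖ := by
  have hx' := norm_pos_iff.2 hx
  have hy' := norm_pos_iff.2 hy
  have e1 : ‖x‖⁻¹ • x - ‖y‖⁻¹ • y = ‖y‖⁻¹ • (x - y) + ((‖y‖ - ‖x‖) / ‖y‖) • ‖x‖⁻¹ • x := by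
    rw [smul_sub, smul_smul]
    have : (‖y‖ - ‖x‖) / ‖y‖ * ‖x‖⁻¹ = ‖x‖⁻¹ - ‖y‖⁻¹ := by field_simp
    rw [this, sub_smul]
    abel
  rw [e1]
  refine (norm_add_le _ _).trans ?_
  rw [norm_smul, norm_smul, norm_normalized hx, norm_div, norm_inv, norm_norm, mul_one,
    inv_mul_eq_div, ← add_div]
  have := abs_norm_sub_norm_le y x
  rw [norm_sub_rev, ← Real.norm_eq_abs] at this
  gcongr
  linarith

/-- Gradient descent on the exponential loss for smooth homogeneous margins, under the learning
rate condition from time `t₀` on, at which the loss is below `1`. -/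
structure IsExpDescent (q : Fin N → Euc d → ℝ) (L b₀ b₁ b₂ γ : ℝ) (η : ℕ → ℝ)
    (θ : ℕ → Euc d) (t₀ : ℕ) : Prop where
  bounds : SmoothBounds q L b₀ b₁ b₂
  step : ∀ t, t₀ ≤ t → θ t ≠ 0 → θ (t + 1) = θ t + η t • gradDir q (θ t)
  loss_lt : expLoss q (θ t₀) < 1
  γ_pos : 0 < γ
  log_γ : Real.log γ = smoothedLogMargin q L (expLoss q (θ t₀)) (θ t₀)
  η_nonneg : ∀ t, 0 ≤ η t
  η_sum : Tendsto (fun T => ∑ t ∈ Finset.range T, η t) atTop atTop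
  η_le : ∀ t, t₀ ≤ t → η t ≤ mu (expLoss q (θ t₀)) (expLoss q (θ t)) /
    (rateConst L ‖θ t₀‖ γ b₀ b₁ b₂ * kappa L (expLoss q (θ t)))

namespace IsExpDescent

variable {q : Fin N → Euc d → ℝ} {L b₀ b₁ b₂ γ : ℝ} {η : ℕ → ℝ} {θ : ℕ → Euc d} {t₀ : ℕ}
  (hD : IsExpDescent q L b₀ b₁ b₂ γ η θ t₀)
include hD

theorem norm_init_pos : 0 < ‖θ t₀‖ := norm_pos_iff.2 (hD.bounds.ne_zero hD.loss_lt)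

theorem rateConst_pos : 0 < rateConst L ‖θ t₀‖ γ b₀ b₁ b₂ := by
  have hb := hD.bounds
  have hρ := hD.norm_init_pos
  have h1 : 0 < b₁ := by
    have h2 := hb.mul_neg_log_le hD.loss_lt
    have h3 : 0 < L * -Real.log (expLoss q (θ t₀)) :=
      mul_pos hb.L_pos (hb.neg_log_pos hD.loss_lt)
    exact pos_of_mul_pos_left (h3.trans_le h2) (by positivity)
  have h4 := hb.b₂_nonneg
  have h5 := hb.b₀_pos
  have h6 : 0 < max (γ ^ (-2 + 2 / L)) (b₀ ^ (-2 + 2 / L)) :=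
    lt_max_of_lt_right (by positivity)
  rw [rateConst]
  positivity

theorem rate_le {t : ℕ} (ht : t₀ ≤ t) (hlt : expLoss q (θ t) < 1) :
    η t * (rateConst L ‖θ t₀‖ γ b₀ b₁ b₂ * kappa L (expLoss q (θ t))) ≤
      mu (expLoss q (θ t₀)) (expLoss q (θ t)) := by
  have h1 := hD.η_le t ht
  rwa [le_div_iff₀ (mul_pos hD.rateConst_pos (kappa_pos (hD.bounds.loss_pos _) hlt))] at h1

/-- The three bounds are proved in one induction because `descent_step` needs all of them as input.
-/
theorem invariants {t : ℕ} (ht : t₀ ≤ t) : expLoss q (θ t) ≤ expLoss q (θ t₀) ∧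
    ‖θ t₀‖ ≤ ‖θ t‖ ∧ Real.log γ ≤ smoothedLogMargin q L (expLoss q (θ t₀)) (θ t) := by
  induction t, ht using Nat.le_induction with
  | base => exact ⟨le_rfl, le_rfl, hD.log_γ.le⟩
  | succ t ht ih =>
    obtain ⟨hℓ, hρ, hΓ⟩ := ih
    have hlt := hℓ.trans_lt hD.loss_lt
    obtain ⟨e1, e2⟩ := hD.bounds.descent_step hD.loss_lt hℓ hD.norm_init_pos hρ hD.γ_pos
      (hD.η_nonneg t) hΓ (hD.rate_le ht hlt)
    have hη := hD.η_nonneg t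
    rw [hD.step t ht (hD.bounds.ne_zero hlt)]
    refine ⟨e1.trans ((sub_le_self _ (by positivity)).trans hℓ),
      hρ.trans (hD.bounds.norm_le_norm_add hlt hη), hΓ.trans (le_trans ?_ e2)⟩
    have hpos := hD.bounds.inner_gradDir_pos hlt
    have := one_le_norm_sq_mul_div_inner_sq hpos
    have hL := hD.bounds.L_pos
    exact le_add_of_nonneg_right (mul_nonneg hη (mul_nonneg (by positivity) (by linarith)))

theorem loss_lt_one {t : ℕ} (ht : t₀ ≤ t) : expLoss q (θ t) < 1 :=
  (hD.invariants ht).1.trans_lt hD.loss_lt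

theorem ne_zero {t : ℕ} (ht : t₀ ≤ t) : θ t ≠ 0 := hD.bounds.ne_zero (hD.loss_lt_one ht)

theorem loss_succ_le {t : ℕ} (ht : t₀ ≤ t) :
    expLoss q (θ (t + 1)) ≤ expLoss q (θ t) - 1 / 2 * η t * ‖gradDir q (θ t)‖ ^ 2 := by
  obtain ⟨hℓ, hρ, hΓ⟩ := hD.invariants ht
  rw [hD.step t ht (hD.ne_zero ht)]
  exact (hD.bounds.descent_step hD.loss_lt hℓ hD.norm_init_pos hρ hD.γ_pos
      (hD.η_nonneg t) hΓ (hD.rate_le ht (hD.loss_lt_one ht))).1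

theorem norm_mono {s t : ℕ} (hs : t₀ ≤ s) (hst : s ≤ t) : ‖θ s‖ ≤ ‖θ t‖ := by
  induction t, hst using Nat.le_induction with
  | base => rfl
  | succ t hst ih =>
    have ht := hs.trans hst
    rw [hD.step t ht (hD.ne_zero ht)]
    exact ih.trans (hD.bounds.norm_le_norm_add (hD.loss_lt_one ht) (hD.η_nonneg t))

omit hD in
/-- The relative radial displacement in one step. -/
def radialStep (q : Fin N → Euc d → ℝ) (η : ℕ → ℝ) (θ : ℕ → Euc d) (t : ℕ) : ℝ :=
  η t * inner ℝ (gradDir q (θ t)) (θ t) / ‖θ t‖ ^ 2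

theorem radialStep_nonneg {t : ℕ} (ht : t₀ ≤ t) : 0 ≤ radialStep q η θ t := by
  have h1 := hD.bounds.inner_gradDir_pos (hD.loss_lt_one ht)
  have h2 := hD.η_nonneg t
  rw [radialStep]
  positivity

theorem logMargin_succ {t : ℕ} (ht : t₀ ≤ t) :
    smoothedLogMargin q L (expLoss q (θ t₀)) (θ t) + L * radialStep q η θ t *
        (‖gradDir q (θ t)‖ ^ 2 * ‖θ t‖ ^ 2 / inner ℝ (gradDir q (θ t)) (θ t) ^ 2 - 1) ≤
      smoothedLogMargin q L (expLoss q (θ t₀)) (θ (t + 1)) := by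
  obtain ⟨hℓ, hρ, hΓ⟩ := hD.invariants ht
  rw [hD.step t ht (hD.ne_zero ht)]
  refine le_trans (le_of_eq ?_) (hD.bounds.descent_step hD.loss_lt hℓ hD.norm_init_pos hρ hD.γ_pos
      (hD.η_nonneg t) hΓ (hD.rate_le ht (hD.loss_lt_one ht))).2
  rw [radialStep]
  ring

theorem logMargin_mono {s t : ℕ} (hs : t₀ ≤ s) (hst : s ≤ t) :
    smoothedLogMargin q L (expLoss q (θ t₀)) (θ s) ≤
      smoothedLogMargin q L (expLoss q (θ t₀)) (θ t) := by
  induction t, hst using Nat.le_induction with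
  | base => rfl
  | succ t hst ih =>
    have ht := hs.trans hst
    refine ih.trans (le_trans ?_ (hD.logMargin_succ ht))
    have h1 := hD.radialStep_nonneg ht
    have h2 := one_le_norm_sq_mul_div_inner_sq (hD.bounds.inner_gradDir_pos (hD.loss_lt_one ht))
    have hL := hD.bounds.L_pos
    exact le_add_of_nonneg_right (mul_nonneg (by positivity) (by linarith))

theorem margin_lt {t : ℕ} (ht : t₀ ≤ t) : γ * ‖θ t‖ ^ L < -Real.log (expLoss q (θ t)) :=
  hD.bounds.mul_rpow_lt_neg_log hD.loss_lt (hD.invariants ht).1 hD.γ_pos (hD.invariants ht).2.2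

theorem le_inner_gradDir {t : ℕ} (ht : t₀ ≤ t) :
    expLoss q (θ t) * (L * -Real.log (expLoss q (θ t))) ≤ inner ℝ (gradDir q (θ t)) (θ t) := by
  rw [hD.bounds.inner_gradDir (hD.ne_zero ht)]
  have := le_weightedMargin (q := q) (θ := θ t)
  have := hD.bounds.L_pos
  nlinarith

theorem norm_gradDir_mul_le {t : ℕ} (ht : t₀ ≤ t) : ‖gradDir q (θ t)‖ * ‖θ t‖ ≤
    b₁ / (L * γ) * inner ℝ (gradDir q (θ t)) (θ t) := by
  have hb := hD.bounds
  have hne := hD.ne_zero ht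
  have hρ := norm_pos_iff.2 hne
  have hL := hb.L_pos
  have hγ := hD.γ_pos
  have hℓ := hb.loss_pos (θ t)
  have e1 : ‖gradDir q (θ t)‖ ≤ expLoss q (θ t) * (b₁ * ‖θ t‖ ^ (L - 1)) :=
    norm_descentDir_le fun n => hb.grad_le n _ hne
  have e2 : ‖θ t‖ ^ L = ‖θ t‖ ^ (L - 1) * ‖θ t‖ := by
    rw [← Real.rpow_add_one hρ.ne', sub_add_cancel]
  have e3 : expLoss q (θ t) * (L * (γ * ‖θ t‖ ^ L)) ≤ inner ℝ (gradDir q (θ t)) (θ t) := by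
    refine le_trans ?_ (hD.le_inner_gradDir ht)
    have := (hD.margin_lt ht).le
    gcongr
  rw [div_mul_eq_mul_div, le_div_iff₀ (by positivity)]
  calc ‖gradDir q (θ t)‖ * ‖θ t‖ * (L * γ)
      ≤ expLoss q (θ t) * (b₁ * ‖θ t‖ ^ (L - 1)) * ‖θ t‖ * (L * γ) := by gcongr
    _ = b₁ * (expLoss q (θ t) * (L * (γ * ‖θ t‖ ^ L))) := by
        rw [e2]
        ring
    _ ≤ _ := mul_le_mul_of_nonneg_left e3 hb.b₁_nonneg

theorem relative_step_le {t : ℕ} (ht : t₀ ≤ t) :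
    ‖θ (t + 1) - θ t‖ / ‖θ t‖ ≤ b₁ / (L * γ) * radialStep q η θ t := by
  have hρ := norm_pos_iff.2 (hD.ne_zero ht)
  have hη := hD.η_nonneg t
  have h1 := mul_le_mul_of_nonneg_left (hD.norm_gradDir_mul_le ht) hη
  rw [hD.step t ht (hD.ne_zero ht), add_sub_cancel_left, norm_smul, Real.norm_of_nonneg hη, radialStep,
    ← mul_div_assoc, div_le_div_iff₀ hρ (by positivity)]
  nlinarith

/-- Sums of radial steps replace log‖θ‖ as the clock in discrete time. This inequality, with the
norm unbounded, shows that the clock runs without bound. -/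
theorem log_norm_sub_le {s t : ℕ} (hs : t₀ ≤ s) (hst : s ≤ t) :
    Real.log ‖θ t‖ - Real.log ‖θ s‖ ≤
      b₁ / (L * γ) * ∑ i ∈ Finset.Ico s t, radialStep q η θ i := by
  induction t, hst using Nat.le_induction with
  | base => simp
  | succ t hst ih =>
    have ht := hs.trans hst
    have hρ := norm_pos_iff.2 (hD.ne_zero ht)
    have hρ' := norm_pos_iff.2 (hD.ne_zero (ht.trans (Nat.le_succ t)))
    rw [Finset.sum_Ico_succ_top hst, mul_add]
    have h1 := Real.log_le_sub_one_of_pos (show 0 < ‖θ (t + 1)‖ / ‖θ t‖ by positivity)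
    rw [Real.log_div hρ'.ne' hρ.ne'] at h1
    have h2 : ‖θ (t + 1)‖ / ‖θ t‖ - 1 ≤ ‖θ (t + 1) - θ t‖ / ‖θ t‖ := by
      rw [div_sub_one hρ.ne']
      gcongr
      exact norm_sub_norm_le _ _
    have h3 := hD.relative_step_le ht
    linarith

theorem norm_normalized_sub_sum_le {s t : ℕ} (hs : t₀ ≤ s) (hst : s ≤ t) :
    ‖‖θ t‖⁻¹ • θ t - ‖θ s‖⁻¹ • θ s‖ ≤
      2 * (b₁ / (L * γ)) * ∑ i ∈ Finset.Ico s t, radialStep q η θ i := by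
  induction t, hst using Nat.le_induction with
  | base => simp
  | succ t hst ih =>
    have ht := hs.trans hst
    rw [Finset.sum_Ico_succ_top hst, mul_add]
    have h1 := norm_normalized_sub_le (hD.ne_zero (ht.trans (Nat.le_succ t))) (hD.ne_zero ht)
    have h2 := hD.relative_step_le ht
    rw [mul_div_assoc] at h1
    have h3 := norm_sub_le_norm_sub_add_norm_sub (‖θ (t + 1)‖⁻¹ • θ (t + 1)) (‖θ t‖⁻¹ • θ t)
      (‖θ s‖⁻¹ • θ s)
    linarith

theorem exists_lt_norm (R : ℝ) : ∃ t, t₀ ≤ t ∧ R < ‖θ t‖ := by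
  by_contra! hR
  have hb := hD.bounds
  have hL := hb.L_pos
  have hR0 : 0 < R := hD.norm_init_pos.trans_le (hR t₀ le_rfl)
  have hb0 := hb.b₀_pos
  set c := Real.exp (-(b₀ * R ^ L))
  have hc0 : 0 < c := Real.exp_pos _
  have hc : ∀ t, t₀ ≤ t → c ≤ expLoss q (θ t) := fun t ht => by
    refine le_trans ?_ (exp_neg_le_expLoss ⟨0, hb.N_pos⟩)
    rw [Real.exp_le_exp, neg_le_neg_iff]
    refine (hb.val_le _ _ (hD.ne_zero ht)).trans ?_
    gcongr
    exact hR t ht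
  set l := -Real.log (expLoss q (θ t₀))
  have hl0 : 0 < l := hb.neg_log_pos hD.loss_lt
  set δ := c * (L * l) / R
  have hδ : 0 < δ := by positivity
  have hgrad : ∀ t, t₀ ≤ t → δ ≤ ‖gradDir q (θ t)‖ := fun t ht => by
    have h1 := (hD.le_inner_gradDir ht).trans (real_inner_le_norm _ _)
    have h2 : l ≤ -Real.log (expLoss q (θ t)) :=
      neg_le_neg (Real.log_le_log (hb.loss_pos _) (hD.invariants ht).1)
    have h3 : c * (L * l) ≤ expLoss q (θ t) * (L * -Real.log (expLoss q (θ t))) := by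
      have := hc t ht
      have := (hb.loss_pos (θ t)).le
      gcongr
    rw [div_le_iff₀ hR0]
    refine (h3.trans h1).trans ?_
    gcongr
    exact hR t ht
  have hdecr : ∀ t, t₀ ≤ t → expLoss q (θ t) ≤ expLoss q (θ t₀) -
      1 / 2 * δ ^ 2 * (∑ i ∈ Finset.range t, η i - ∑ i ∈ Finset.range t₀, η i) := by
    intro t ht
    induction t, ht using Nat.le_induction with
    | base => simp
    | succ t ht ih =>
      rw [Finset.sum_range_succ]
      have h1 := hD.loss_succ_le ht
      have h2 := pow_le_pow_left₀ hδ.le (hgrad t ht) 2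
      have h3 := mul_le_mul_of_nonneg_left h2 (hD.η_nonneg t)
      linarith
  obtain ⟨t, ht, hsum⟩ := ((eventually_ge_atTop t₀).and (hD.η_sum.eventually_ge_atTop
    (∑ i ∈ Finset.range t₀, η i + 2 * expLoss q (θ t₀) / δ ^ 2))).exists
  have h1 := hdecr t ht
  have h2 : 1 / 2 * δ ^ 2 * (2 * expLoss q (θ t₀) / δ ^ 2) = expLoss q (θ t₀) := by
    field_simp
  have h3 := mul_le_mul_of_nonneg_left (sub_le_sub_right hsum (∑ i ∈ Finset.range t₀, η i))
    (show 0 ≤ 1 / 2 * δ ^ 2 by positivity)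
  rw [add_sub_cancel_left, h2] at h3
  have := hb.loss_pos (θ t)
  linarith

theorem logMargin_le {t : ℕ} (ht : t₀ ≤ t) :
    smoothedLogMargin q L (expLoss q (θ t₀)) (θ t) ≤ Real.log b₀ := by
  have hb := hD.bounds
  have hρ := norm_pos_iff.2 (hD.ne_zero ht)
  have hρL := Real.rpow_pos_of_pos hρ L
  have h1 := (phi_lt hb.L_pos (hb.loss_pos _) hD.loss_lt (hb.loss_pos (θ t))
    (hD.invariants ht).1).le
  have h2 := Real.log_le_log (hb.neg_log_pos (hD.loss_lt_one ht)) (hb.neg_log_le (hD.ne_zero ht))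
  rw [Real.log_mul hb.b₀_pos.ne' hρL.ne', Real.log_rpow hρ] at h2
  rw [smoothedLogMargin]
  linarith

theorem hasAlignedPoints {v : Euc d} (hv : IsLimitDirection θ v) : HasAlignedPoints q L γ v := by
  intro ε hε
  have hb := hD.bounds
  have hL := hb.L_pos
  have hγ := hD.γ_pos
  have hb1 := hb.b₁_nonneg
  -- The summand 1 makes `C` positive from b₁ ≥ 0 alone.
  set C := 2 * (b₁ / (L * γ)) + 1 with hC
  have hC0 : 0 < C := by positivity
  set Γ : ℕ → ℝ := fun t => smoothedLogMargin q L (expLoss q (θ t₀)) (θ t) with hΓ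
  set w := ε / (2 * C)
  have hw : 0 < w := by positivity
  have hCw : C * w = ε / 2 := by
    simp only [w]
    field_simp
  obtain ⟨T, hT, hTle⟩ : ∃ T, t₀ ≤ T ∧ ∀ t, T ≤ t → Γ t - Γ T < L * ε * w := by
    by_contra! hcon
    have hstep : ∀ k : ℕ, ∃ t, t₀ ≤ t ∧ Γ t₀ + k * (L * ε * w) ≤ Γ t := by
      intro k
      induction k with
      | zero => exact ⟨t₀, le_rfl, by simp⟩
      | succ k ih =>
        obtain ⟨t, ht, hle⟩ := ih
        obtain ⟨s, hs, hsle⟩ := hcon t ht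
        refine ⟨s, ht.trans hs, ?_⟩
        push_cast
        linarith
    obtain ⟨k, hk⟩ := exists_nat_gt ((Real.log b₀ - Γ t₀) / (L * ε * w))
    obtain ⟨t, ht, hle⟩ := hstep k
    rw [div_lt_iff₀ (by positivity)] at hk
    have := hD.logMargin_le ht
    linarith
  obtain ⟨T', hT', hRT'⟩ := hD.exists_lt_norm (1 / ε)
  obtain ⟨t₁, ht₁, hclose⟩ := (frequently_atTop.1
    ((mapClusterPt_iff_frequently.1 hv) _ (Metric.ball_mem_nhds v (half_pos hε)))) (max T T')
  rw [Metric.mem_ball, dist_eq_norm] at hclose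
  have htT : T ≤ t₁ := (le_max_left _ _).trans ht₁
  have htT' : T' ≤ t₁ := (le_max_right _ _).trans ht₁
  have ht₀₁ : t₀ ≤ t₁ := hT.trans htT
  set A : ℕ → ℝ := fun t => ∑ i ∈ Finset.Ico t₁ t, radialStep q η θ i with hA
  have hA0 : ∀ t, t₁ ≤ t → 0 ≤ A t := fun t _ =>
    Finset.sum_nonneg fun i hi => hD.radialStep_nonneg (ht₀₁.trans (Finset.mem_Ico.1 hi).1)
  by_contra hcon
  have hcon' : ∀ t, t₁ ≤ t → A t ≤ w →
      (1 + ε) * inner ℝ (gradDir q (θ t)) (θ t) ^ 2 < ‖gradDir q (θ t)‖ ^ 2 * ‖θ t‖ ^ 2 := by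
    intro t ht hAw
    by_contra! h6
    have htt := ht₀₁.trans ht
    refine hcon ⟨θ t, fun n => ∇ (q n) (θ t), hD.ne_zero htt, fun n => ?_, (hD.margin_lt htt).le,
      ?_, hRT'.trans_le (hD.norm_mono hT' (htT'.trans ht)), h6⟩
    · exact subset_convexHull ℝ _
        (gradient_mem_limitingGradients (hb.differentiableAt (hD.ne_zero htt)))
    · have h1 := hD.norm_normalized_sub_sum_le ht₀₁ ht
      have h2 : 2 * (b₁ / (L * γ)) * A t ≤ C * w := by
        have := hA0 t ht
        have : 2 * (b₁ / (L * γ)) ≤ C := by linarith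
        gcongr
      have h4 := norm_sub_le_norm_sub_add_norm_sub (‖θ t‖⁻¹ • θ t) (‖θ t₁‖⁻¹ • θ t₁) v
      have h5 : ‖‖θ t‖⁻¹ • θ t - ‖θ t₁‖⁻¹ • θ t₁‖ ≤ C * w := h1.trans h2
      linarith
  -- The second component also covers the step that carries the clock past w: its growth depends
  -- only on misalignment at its starting point, where A t ≤ w still holds.
  have hgrow : ∀ t, t₁ ≤ t → A t ≤ w → Γ t₁ + L * ε * A t ≤ Γ t ∧
      Γ t + L * ε * radialStep q η θ t ≤ Γ (t + 1) := by
    have hone : ∀ t, t₁ ≤ t → A t ≤ w → Γ t + L * ε * radialStep q η θ t ≤ Γ (t + 1) := by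
      intro t ht hAw
      have htt := ht₀₁.trans ht
      refine le_trans ?_ (hD.logMargin_succ htt)
      have h1 := hb.inner_gradDir_pos (hD.loss_lt_one htt)
      have h2 : ε ≤ ‖gradDir q (θ t)‖ ^ 2 * ‖θ t‖ ^ 2 /
          inner ℝ (gradDir q (θ t)) (θ t) ^ 2 - 1 := by
        rw [le_sub_iff_add_le, le_div_iff₀ (by positivity)]
        have := hcon' t ht hAw
        linarith
      have h3 := mul_le_mul_of_nonneg_left h2 (mul_nonneg hL.le (hD.radialStep_nonneg htt))
      simp only [hΓ]
      linarith
    intro t ht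
    induction t, ht using Nat.le_induction with
    | base => exact fun h => ⟨by simp [hA], hone _ le_rfl h⟩
    | succ t ht ih =>
      intro hAw
      have hAsucc : A (t + 1) = A t + radialStep q η θ t := Finset.sum_Ico_succ_top ht _
      have h1 := hD.radialStep_nonneg (ht₀₁.trans ht)
      obtain ⟨h2, h3⟩ := ih (by linarith)
      refine ⟨?_, hone _ (ht.trans (Nat.le_succ t)) hAw⟩
      rw [hAsucc]
      linarith
  obtain ⟨S, hS, hSR⟩ : ∃ S, t₁ ≤ S ∧ w < A S := by
    obtain ⟨S, hS, hSR⟩ := hD.exists_lt_norm (Real.exp (Real.log ‖θ t₁‖ + C * w))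
    have hS1 : Real.log ‖θ t₁‖ + C * w < Real.log ‖θ S‖ := by
      rw [Real.lt_log_iff_exp_lt (norm_pos_iff.2 (hD.ne_zero hS))]
      exact hSR
    have htS : t₁ ≤ S := by
      by_contra! h
      have := Real.log_le_log (norm_pos_iff.2 (hD.ne_zero hS)) (hD.norm_mono hS h.le)
      have := mul_pos hC0 hw
      linarith
    refine ⟨S, htS, ?_⟩
    have h1 := hD.log_norm_sub_le ht₀₁ htS
    have h2 : b₁ / (L * γ) * A S ≤ C * A S := by
      refine mul_le_mul_of_nonneg_right ?_ (hA0 S htS)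
      have : 0 ≤ b₁ / (L * γ) := by positivity
      linarith
    have h3 : C * w < C * A S := by
      refine lt_of_lt_of_le ?_ h2
      have : Real.log ‖θ S‖ - Real.log ‖θ t₁‖ ≤ b₁ / (L * γ) * A S := h1
      linarith
    exact lt_of_mul_lt_mul_left h3 hC0.le
  -- The step from s to s + 1 is the one that crosses w; up to s + 1 the margin has grown by more
  -- than `L * ε * w`, contradicting the choice of T.
  obtain ⟨s, ⟨hs, hsw⟩, hmin⟩ : ∃ s, (t₁ ≤ s ∧ A s ≤ w) ∧ w < A (s + 1) := by
    by_contra! hno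
    have : ∀ t, t₁ ≤ t → A t ≤ w := by
      intro t ht
      induction t, ht using Nat.le_induction with
      | base => simpa [hA] using hw.le
      | succ t ht ih => exact hno t ⟨ht, ih⟩
    exact absurd (this S hS) (not_le.2 hSR)
  obtain ⟨h1, h2⟩ := hgrow s hs hsw
  have hAsucc : A (s + 1) = A s + radialStep q η θ s := Finset.sum_Ico_succ_top hs _
  have h3 := hTle (s + 1) (htT.trans (hs.trans (Nat.le_succ s)))
  have h4 : Γ T ≤ Γ t₁ := hD.logMargin_mono hT htT
  have h5 : L * ε * w < L * ε * (A s + radialStep q η θ s) := by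
    rw [← hAsucc]
    have : 0 < L * ε := by positivity
    gcongr
  linarith

theorem isKKTDirection {v : Euc d} (hv : IsLimitDirection θ v) : IsKKTDirection q v :=
  (hD.hasAlignedPoints hv).isKKTDirection hD.bounds.N_pos hD.bounds.L_pos hD.bounds.homLip
    hD.γ_pos

end IsExpDescent

end GradientDescent

/-! ### Homogeneous bounds from suprema over the unit sphere. -/

section UnitSphere

variable {d N : ℕ}

theorem bddAbove_unitSphere_values {F : Fin N → Euc d → ℝ}
    (hF : ∀ n θ, θ ≠ 0 → ContinuousAt (F n) θ) :
    BddAbove {r | ∃ (θ : Euc d) (n : Fin N), ‖θ‖ = 1 ∧ r = F n θ} := by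
  have h : ∀ n, BddAbove (F n '' Metric.sphere 0 1) := fun n =>
    ((isCompact_sphere (0 : Euc d) 1).image_of_continuousOn fun θ hθ =>
      (hF n θ (ne_zero_of_norm_eq_one (mem_sphere_zero_iff_norm.1 hθ))).continuousWithinAt).bddAbove
  refine ((Set.finite_univ (α := Fin N)).bddAbove_biUnion
    (S := fun n => F n '' Metric.sphere 0 1)).2 (fun n _ => h n) |>.mono ?_
  rintro r ⟨θ, n, hθ, rfl⟩
  exact Set.mem_biUnion (Set.mem_univ n) ⟨θ, mem_sphere_zero_iff_norm.2 hθ, rfl⟩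

theorem le_rpow_mul_sSup_unitSphere {F : Fin N → Euc d → ℝ} {p : ℝ}
    (hF : ∀ n θ, θ ≠ 0 → ContinuousAt (F n) θ)
    (hom : ∀ n θ (c : ℝ), 0 < c → θ ≠ 0 → F n (c • θ) = c ^ p * F n θ) (n : Fin N) {θ : Euc d}
    (hθ : θ ≠ 0) :
    F n θ ≤ sSup {r | ∃ (θ : Euc d) (n : Fin N), ‖θ‖ = 1 ∧ r = F n θ} * ‖θ‖ ^ p := by
  have hρ := norm_pos_iff.2 hθ
  have h1 : ‖‖θ‖⁻¹ • θ‖ = 1 := norm_normalized hθ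
  have h2 := hom n (‖θ‖⁻¹ • θ) ‖θ‖ hρ (ne_zero_of_norm_eq_one h1)
  rw [smul_smul, mul_inv_cancel₀ hρ.ne', one_smul] at h2
  rw [h2, mul_comm]
  gcongr
  exact le_csSup (bddAbove_unitSphere_values hF) ⟨_, n, h1, rfl⟩

theorem contDiffAt_gradient {f : Euc d → ℝ} {θ : Euc d} (h : ContDiffAt ℝ 2 f θ) :
    ContDiffAt ℝ 1 (∇ f) θ :=
  (InnerProductSpace.toDual ℝ (Euc d)).symm.contDiff.contDiffAt.comp θ
    (h.fderiv_right (m := 1) (by norm_num))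

/-- Differentiate the relation ∇f(c z) = c ^ (L - 1) ∇f(z) in z and cancel one factor c. -/
theorem fderiv_gradient_smul {f : Euc d → ℝ} {L : ℝ}
    (hom : ∀ (c : ℝ) (θ : Euc d), 0 < c → f (c • θ) = c ^ L * f θ)
    (hf : ∀ θ, θ ≠ 0 → ContDiffAt ℝ 2 f θ) {θ : Euc d} {c : ℝ} (hc : 0 < c) (hθ : θ ≠ 0) :
    fderiv ℝ (∇ f) (c • θ) = c ^ (L - 2) • fderiv ℝ (∇ f) θ := by
  have hcθ : c • θ ≠ 0 := smul_ne_zero hc.ne' hθ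
  have hd : ∀ z, z ≠ 0 → DifferentiableAt ℝ (∇ f) z := fun z hz =>
    (contDiffAt_gradient (hf z hz)).differentiableAt one_ne_zero
  have h1 : (fun z => ∇ f (c • z)) =ᶠ[𝓝 θ] fun z => c ^ (L - 1) • ∇ f z := by
    filter_upwards [isOpen_ne.mem_nhds hθ] with z hz
    exact (hasGradientAt_smul hom hc ((hf z hz).differentiableAt two_ne_zero)).gradient
  have h2 : HasFDerivAt (fun z => ∇ f (c • z))
      ((fderiv ℝ (∇ f) (c • θ)).comp (c • ContinuousLinearMap.id ℝ (Euc d))) θ :=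
    (hd _ hcθ).hasFDerivAt.comp θ ((hasFDerivAt_id θ).const_smul c)
  have h3 := ((hd θ hθ).hasFDerivAt.const_smul (c ^ (L - 1))).congr_of_eventuallyEq h1
  have h4 := h2.unique h3
  ext1 w
  have h5 := congrArg (fun A : Euc d →L[ℝ] Euc d => c⁻¹ • A w) h4
  simp only [ContinuousLinearMap.comp_apply, smul_apply,
    ContinuousLinearMap.id_apply, map_smul, smul_smul, inv_mul_cancel₀ hc.ne', one_smul] at h5
  rw [h5, smul_apply, ← Real.rpow_neg_one, ← Real.rpow_add hc]
  congr 2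
  ring

end UnitSphere

/-! ### Application of the descent results to networks. -/

section Network

variable {d dx N : ℕ} {Φ : Euc d → Euc dx → ℝ} {xs : Fin N → Euc dx} {ys : Fin N → ℝ} {L : ℝ}

theorem IsSmoothNet.smoothBounds (hs : IsSmoothNet Φ) (hΦ : IsHomogeneousNet Φ L) (hN : 0 < N)
    (hL : 0 < L) {θ₀ : Euc d} (hloss : trainLoss Φ xs ys θ₀ < 1) :
    SmoothBounds (margin Φ xs ys) L (B0 Φ xs ys) (B1 Φ xs ys) (B2 Φ xs ys) := by
  have hq : ∀ n, IsHomLip L (margin Φ xs ys n) := IsHomLip.margin (hs.isHomLip hΦ)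
  have hC : ∀ n θ, θ ≠ 0 → ContDiffAt ℝ 2 (margin Φ xs ys n) θ := fun n θ hθ =>
    contDiffAt_const.mul (hs.contDiffAt (xs n) hθ)
  have hval : ∀ n θ, θ ≠ 0 → margin Φ xs ys n θ ≤ B0 Φ xs ys * ‖θ‖ ^ L := fun n θ hθ =>
    le_rpow_mul_sSup_unitSphere (fun n θ hθ => (hC n θ hθ).continuousAt)
      (fun n θ c hc _ => (hq n).hom c θ hc) n hθ
  refine ⟨hN, hL, hq, hC, hval, fun n θ hθ => ?_, fun n θ hθ => ?_, ?_, ?_, ?_⟩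
  · refine le_rpow_mul_sSup_unitSphere (F := fun n θ => ‖∇ (margin Φ xs ys n) θ‖)
      (fun n θ hθ => (contDiffAt_gradient (hC n θ hθ)).continuousAt.norm)
      (fun n θ c hc hθ => ?_) n hθ
    rw [(hasGradientAt_smul (hq n).hom hc ((hC n θ hθ).differentiableAt two_ne_zero)).gradient,
      norm_smul, Real.norm_of_nonneg (by positivity)]
  · refine le_rpow_mul_sSup_unitSphere
      (F := fun n θ => ‖fderiv ℝ (∇ (margin Φ xs ys n)) θ‖)
      (fun n θ hθ => ((contDiffAt_gradient (hC n θ hθ)).fderiv_right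
        (m := 0) (by norm_num)).continuousAt.norm)
      (fun n θ c hc hθ => ?_) n hθ
    rw [fderiv_gradient_smul (hq n).hom (hC n) hc hθ,
      norm_smul, Real.norm_of_nonneg (by positivity)]
  -- B₀ is positive because a loss below 1 makes every margin at θ₀ positive.
  · have hne : θ₀ ≠ 0 := ne_zero_of_expLoss_lt_one hN hq hL hloss
    have h1 := hval ⟨0, hN⟩ θ₀ hne
    have h2 : Real.exp (-margin Φ xs ys ⟨0, hN⟩ θ₀) ≤ trainLoss Φ xs ys θ₀ :=
      exp_neg_le_expLoss (q := margin Φ xs ys) ⟨0, hN⟩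
    have h3 : 0 < margin Φ xs ys ⟨0, hN⟩ θ₀ := by
      have := Real.exp_lt_one_iff.1 (h2.trans_lt hloss)
      linarith
    have hρ := norm_pos_iff.2 hne
    exact pos_of_mul_pos_left (h3.trans_le h1) (by positivity)
  · exact Real.sSup_nonneg fun r ⟨θ, n, _, hr⟩ => hr ▸ norm_nonneg _
  · exact Real.sSup_nonneg fun r ⟨θ, n, _, hr⟩ => hr ▸ norm_nonneg _

theorem IsGradientDescent.isExpDescent {η : ℕ → ℝ} {θ : ℕ → Euc d} {t₀ : ℕ} (hN : 0 < N)
    (hL : 0 < L) (hΦ : IsHomogeneousNet Φ L) (hs : IsSmoothNet Φ)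
    (hθ : IsGradientDescent (trainLoss Φ xs ys) η θ) (hloss : trainLoss Φ xs ys (θ t₀) < 1)
    (hη : LearningRateCondition Φ xs ys L η θ t₀) :
    IsExpDescent (margin Φ xs ys) L (B0 Φ xs ys) (B1 Φ xs ys) (B2 Φ xs ys)
      (gammaHat Φ xs ys L (trainLoss Φ xs ys (θ t₀)) (θ t₀)) η θ t₀ := by
  have hb := hs.smoothBounds hΦ hN hL hloss
  have hρ := norm_pos_iff.2 (hb.ne_zero hloss)
  refine ⟨hb, fun t _ hne => ?_, hloss, div_pos (Real.exp_pos _) (by positivity), ?_, hη.nonneg,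
    hη.sum_eq_top, hη.le_bound⟩
  · have h := (hb.hasGradientAt hne).gradient
    rw [hθ t, trainLoss_eq, h, smul_neg, sub_neg_eq_add]
  · rw [gammaHat, Real.log_div (Real.exp_ne_zero _) (by positivity), Real.log_exp,
      Real.log_rpow hρ]
    rfl

theorem isMaxMarginDirection_of_smooth_descent {η : ℕ → ℝ} {θ : ℕ → Euc d} {t₀ : ℕ} {v : Euc d}
    (hN : 0 < N) (hL : 0 < L) (hys : ∀ n, ys n = 1 ∨ ys n = -1) (hΦ : IsHomogeneousNet Φ L)
    (hs : IsSmoothNet Φ) (hθ : IsGradientDescent (trainLoss Φ xs ys) η θ)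
    (hloss : trainLoss Φ xs ys (θ t₀) < 1) (hη : LearningRateCondition Φ xs ys L η θ t₀)
    (hv : IsLimitDirection θ v) : IsMaxMarginDirection (ntk Φ v) (gradFeature Φ v) xs ys v := by
  have hD := hθ.isExpDescent hN hL hΦ hs hloss hη
  have hv0 : v ≠ 0 := hv.ne_zero ((eventually_ge_atTop t₀).mono fun t ht => hD.ne_zero ht)
  exact (hD.isKKTDirection hv).isMaxMarginDirection_ntk hys hN hL (hs.isHomLip hΦ) fun x =>
    (hs.contDiffAt x hv0).of_le one_le_two

end Network

end HomNet

end

theorem corollary4p5 (d dx N : ℕ) (hN : 0 < N)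
    (Φ : HomNet.Euc d → HomNet.Euc dx → ℝ)
    (xs : Fin N → HomNet.Euc dx) (ys : Fin N → ℝ) (hys : ∀ n, ys n = 1 ∨ ys n = -1)
    (L : ℝ) (hL : 0 < L) (hΦ : HomNet.IsHomogeneousNet Φ L) :
    -- gradient flow, smooth networks
    (HomNet.IsSmoothNet Φ →
      ∀ θ : ℝ → HomNet.Euc d, HomNet.IsGradientFlow (HomNet.trainLoss Φ xs ys) θ →
      ∀ t₀ : ℝ, 0 ≤ t₀ → HomNet.trainLoss Φ xs ys (θ t₀) < 1 →
      ∀ θbar : HomNet.Euc d, HomNet.IsLimitDirection θ θbar →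
        HomNet.IsMaxMarginDirection (HomNet.ntk Φ θbar) (HomNet.gradFeature Φ θbar) xs ys θbar) ∧
    -- gradient descent, smooth networks
    (HomNet.IsSmoothNet Φ →
      ∀ (η : ℕ → ℝ) (θ : ℕ → HomNet.Euc d),
      HomNet.IsGradientDescent (HomNet.trainLoss Φ xs ys) η θ →
      ∀ t₀ : ℕ, HomNet.trainLoss Φ xs ys (θ t₀) < 1 →
      HomNet.LearningRateCondition Φ xs ys L η θ t₀ →
      ∀ θbar : HomNet.Euc d, HomNet.IsLimitDirection θ θbar →
        HomNet.IsMaxMarginDirection (HomNet.ntk Φ θbar) (HomNet.gradFeature Φ θbar) xs ys θbar) ∧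
    -- gradient flow, nonsmooth networks
    (HomNet.IsRegularNet Φ →
      ∀ θ : ℝ → HomNet.Euc d, HomNet.IsGradientFlow (HomNet.trainLoss Φ xs ys) θ →
      ∀ t₀ : ℝ, 0 ≤ t₀ → HomNet.trainLoss Φ xs ys (θ t₀) < 1 →
      ∀ θbar : HomNet.Euc d, HomNet.IsLimitDirection θ θbar →
        ∃ h : HomNet.Euc dx → HomNet.Euc d,
          (∀ x, h x ∈ HomNet.clarkeSubdiff (fun ϑ => Φ ϑ x) θbar) ∧
          HomNet.IsMaxMarginDirection (HomNet.featureKernel h) h xs ys θbar) := by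
  refine ⟨fun hs θ hθ t₀ ht₀ hloss θbar hv => ?_, fun hs η θ hθ t₀ hloss hη θbar hv => ?_,
    fun hr θ hθ t₀ ht₀ hloss θbar hv => ?_⟩
  · exact HomNet.isMaxMarginDirection_of_smooth_flow hN hL hys hΦ hs hθ ht₀ hloss hv
  · exact HomNet.isMaxMarginDirection_of_smooth_descent hN hL hys hΦ hs hθ hloss hη hv
  · exact HomNet.exists_isMaxMarginDirection_of_regular_flow hN hL hys hΦ hr hθ ht₀ hloss hv
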